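/- Let $M$ be a smooth manifold (finite-dimensional, Hausdorff, second countable, without boundary) and let $E\to M$ be a Courant algebroid: a smooth real vector bundle with a smooth fibrewise nondegenerate symmetric bilinear form $\langle\cdot,\cdot\rangle$, a bundle map $\rho:E\to TM$ and an $\mathbb R$-bilinear bracket $[\![\cdot,\cdot]\!]$ on $\Gamma(E)$ such that, for $e_i\in\Gamma(E)$ and $f\in C^\infty(M)$, $[\![e_1,fe_2]\!]=\rho(e_1)(f)e_2+f[\![e_1,e_2]\!]$; $\rho(e_1)\langle e_2,e_3\rangle=\langle[\![e_1,e_2]\!],e_3\rangle+\langle e_2,[\![e_1,e_3]\!]\rangle$; $[\![[\![e_1,e_2]\!],e_3]\!]=[\![e_1,[\![e_2,e_3]\!]]\!]-[\![e_2,[\![e_1,e_3]\!]]\!]$; and $[\![e_1,e_2]\!]+[\![e_2,e_1]\!]=\mathcal D\langle e_1,e_2\rangle$, where $\langle\mathcal Df,e\rangle=\rho(e)(f)$. Let $C^0(E)=C^\infty(M)$, and for $n\ge 1$ let $C^n(E)$ be the space of maps $\omega:\Gamma(E)^n\to C^\infty(M)$ that are $C^\infty(M)$-linear in the last entry and, if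 $n\ge2$, admit a map $\sigma_\omega:\Gamma(E)^{n-2}\to\mathfrak X(M)$ with $$\omega(\dots,e_i,e_{i+1},\dots)+\omega(\dots,e_{i+1},e_i,\dots)=\sigma_\omega(e_1,\dots,\widehat{e_i},\widehat{e_{i+1}},\dots,e_n)(\langle e_i,e_{i+1}\rangle)$$ for all $e_1,\dots,e_n\in\Gamma(E)$ and $1\le i\le n-1$. The differential $d_E$ is given on $\omega\in C^n(E)$ by $$(d_E\omega)(e_0,\dots,e_n)=\sum_{i}(-1)^i\rho(e_i)\,\omega(e_0,\dots,\widehat{e_i},\dots,e_n)-\sum_{i<j}(-1)^i\omega(e_0,\dots,\widehat{e_i},\dots,e_{j-1},[\![e_i,e_j]\!],e_{j+1},\dots,e_n),$$ and $H^n(E)$ is the space of $\omega\in C^n(E)$ with $d_E\omega=0$ modulo $d_E C^{n-1}(E)$. Let $B\to M$ be a smooth real vector bundle. An $E$-connection on $B$ is an $\mathbb R$-bilinear map $\nabla:\Gamma(E)\times\Gamma(B)\to\Gamma(B)$ with $\nabla_e(fb)=f\nabla_eb+\rho(e)(f)b$ and $\nabla_{fe}b=f\nabla_eb$. Its curvature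 is $F_\nabla(e_1,e_2)=\nabla_{e_1}\nabla_{e_2}-\nabla_{e_2}\nabla_{e_1}-\nabla_{[\![e_1,e_2]\!]}$, which takes values in $\Gamma(\mathrm{End}\,B)$. Let $\smallsmile$ denote the shuffle product of $\mathrm{End}(B)$-valued cochains, $$(\phi\smallsmile\psi)(e_1,\dots,e_{k+m})=\sum_{\pi\in \mathrm{Sh}(k,m)}\mathrm{sgn}(\pi)\,\phi(e_{\pi(1)},\dots,e_{\pi(k)})\,\psi(e_{\pi(k+1)},\dots,e_{\pi(k+m)}),$$ and for $k\ge1$ put $\mathrm{ch}_k(\nabla)=\mathrm{tr}(F_\nabla^k)$. A (smooth) path of $E$-connections on $B$ is a family $\nabla_t$, $0\le t\le1$, such that $\nabla_{t,e}b$ depends smoothly on $(t,x)\in[0,1]\times M$ for all $e\in\Gamma(E)$, $b\in\Gamma(B)$; put $$\mathrm{cs}_k(\nabla_t)=k\int_0^1\mathrm{tr}\Big(\tfrac{d}{dt}[\nabla_t]\smallsmile F_{\nabla_t}^{k-1}\Big)\,dt .$$ Let $k\ge1$. For every path $\nabla_t$ of $E$-connections on $B$, the integral above exists, $\mathrm{cs}_k(\nabla_t)\in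 C^{2k-1}(E)$, and $$d_E\,\mathrm{cs}_k(\nabla_t)=\mathrm{ch}_k(\nabla_1)-\mathrm{ch}_k(\nabla_0).$$ Moreover, for every $E$-connection $\nabla$ on $B$, $\mathrm{ch}_k(\nabla)\in C^{2k}(E)$ and $d_E\,\mathrm{ch}_k(\nabla)=0$, and the cohomology class $[\mathrm{ch}_k(\nabla)]\in H^{2k}(E)$ does not depend on $\nabla$. -/

import Mathlib

open Bundle Set Topology
open scoped Manifold ContDiff

noncomputable section
namespace CourantCS

set_option linter.unusedSectionVars false

section Sections

variable {EM HM M : Type*} [NormedAddCommGroup EM] [NormedSpace ℝ EM]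
  [TopologicalSpace HM] {I : ModelWithCorners ℝ EM HM} [TopologicalSpace M] [ChartedSpace HM M]
  {F : Type*} [NormedAddCommGroup F] [NormedSpace ℝ F]
  {V : M → Type*} [TopologicalSpace (TotalSpace F V)] [∀ x, TopologicalSpace (V x)]
  [FiberBundle F V] [∀ x, AddCommGroup (V x)] [∀ x, Module ℝ (V x)] [VectorBundle ℝ F V]

instance secSMul : SMul C^∞⟮I, M; ℝ⟯ Cₛ^∞⟮I; F, V⟯ :=
  ⟨fun f s => ⟨fun x => f x • s x, f.contMDiff.smul_section s.contMDiff⟩⟩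

@[simp]
theorem sec_smul_apply (f : C^∞⟮I, M; ℝ⟯) (s : Cₛ^∞⟮I; F, V⟯) (x : M) :
    (f • s) x = f x • s x := rfl

instance secModule : Module C^∞⟮I, M; ℝ⟯ Cₛ^∞⟮I; F, V⟯ where
  one_smul s := by ext x; simp
  mul_smul f g s := by ext x; simp [mul_smul]
  smul_zero f := by ext x; simp
  smul_add f s t := by ext x; simp
  add_smul f g s := by ext x; simp [add_smul]
  zero_smul s := by ext x; simp

instance secScalarTower : IsScalarTower ℝ C^∞⟮I, M; ℝ⟯ Cₛ^∞⟮I; F, V⟯ where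
  smul_assoc c f s := by ext x; simp [mul_smul]

variable [FiniteDimensional ℝ EM] [T2Space M] [IsManifold I ∞ M] [FiniteDimensional ℝ F] [ContMDiffVectorBundle ∞ F V I]

theorem exists_cutoff (x : M) {U : Set M} (hU : U ∈ 𝓝 x) :
    ∃ φ : C^∞⟮I, M; ℝ⟯, (∀ᶠ y in 𝓝 x, φ y = 1) ∧ tsupport φ ⊆ U := by
  obtain ⟨f, -, hf⟩ := (SmoothBumpFunction.nhds_basis_tsupport (I := I) x).mem_iff.1 hU
  exact ⟨⟨f, f.contMDiff⟩, f.eventuallyEq_one, hf⟩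


/-- A vector `v` in the fibre over `x` extended to a global smooth section, linearly in `v`. -/
theorem exists_linear_extension (x : M) :
    ∃ L : V x →ₗ[ℝ] Cₛ^∞⟮I; F, V⟯, ∀ v, L v x = v := by
  let e := trivializationAt F V x
  have hx : x ∈ e.baseSet := FiberBundle.mem_baseSet_trivializationAt F V x
  obtain ⟨φ, hφ, hs⟩ := exists_cutoff (I := I) x (e.open_baseSet.mem_nhds hx)
  have hsm : ∀ v : V x, ContMDiff I (I.prod 𝓘(ℝ, F)) ∞
      (fun y => (⟨y, ((φ : M → ℝ) • fun y => e.symmL ℝ y (e.continuousLinearMapAt ℝ x v)) y⟩ :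
        TotalSpace F V)) := by
    intro v
    refine ContMDiffOn.smul_section_of_tsupport (u := e.baseSet)
      φ.contMDiff.contMDiffOn e.open_baseSet hs ?_
    rw [e.contMDiffOn_section_baseSet_iff]
    refine (contMDiffOn_const (c := e.continuousLinearMapAt ℝ x v)).congr fun y hy => ?_
    simp [Trivialization.apply_mk_symm, hy]
  refine ⟨{ toFun := fun v => ⟨_, hsm v⟩, map_add' := ?_, map_smul' := ?_ }, ?_⟩
  · intro v w; ext y; simp
  · intro c v
    ext y
    change φ y • e.symmL ℝ y (e.continuousLinearMapAt ℝ x (c • v)) =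
      c • (φ y • e.symmL ℝ y (e.continuousLinearMapAt ℝ x v))
    rw [map_smul, map_smul, smul_comm]
  · intro v
    change φ x • e.symmL ℝ x (e.continuousLinearMapAt ℝ x v) = v
    rw [hφ.self_of_nhds, one_smul, e.symmL_continuousLinearMapAt hx]

/-- A finite family of global smooth sections that is a frame near `x`, with smooth coefficients:
there is a cutoff `φ`, equal to `1` near `x`, such that `φ • s = ∑ i, cᵢ(s) • σᵢ`. -/
theorem exists_frame (x : M) : ∃ (ι : Type) (_ : Fintype ι) (σ : ι → Cₛ^∞⟮I; F, V⟯)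
    (c : ι → ∀ y, V y →ₗ[ℝ] ℝ) (φ : C^∞⟮I, M; ℝ⟯) (U : Set M), U ∈ 𝓝 x ∧
      (∀ y ∈ U, φ y = 1) ∧
      (∀ y ∈ U, ∃ b : Module.Basis ι ℝ (V y), (∀ i, b i = σ i y) ∧ ∀ i, c i y = b.coord i) ∧
      ∀ s : Cₛ^∞⟮I; F, V⟯, ∃ g : ι → C^∞⟮I, M; ℝ⟯, φ • s = ∑ i, g i • σ i ∧
        ∀ y ∈ U, ∀ i, g i y = c i y (s y) := by
  let e := trivializationAt F V x
  have hx : x ∈ e.baseSet := FiberBundle.mem_baseSet_trivializationAt F V x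
  let b := Module.finBasis ℝ F
  classical
  obtain ⟨φ, hφ, hs⟩ := exists_cutoff (I := I) x (e.open_baseSet.mem_nhds hx)
  have hσ : ∀ i, ContMDiff I (I.prod 𝓘(ℝ, F)) ∞
      (fun y => (⟨y, ((φ : M → ℝ) • e.localFrame b i) y⟩ : TotalSpace F V)) := fun i =>
    ContMDiffOn.smul_section_of_tsupport (u := e.baseSet)
      φ.contMDiff.contMDiffOn e.open_baseSet hs (e.contMDiffOn_localFrame_baseSet _ b i)
  have hg : ∀ (s : Cₛ^∞⟮I; F, V⟯) (i), ContMDiff I 𝓘(ℝ, ℝ) ∞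
      (fun y => φ y * e.localFrameCoeff I b i y (s y)) := by
    intro s i y
    by_cases hy : y ∈ e.baseSet
    · exact (φ.contMDiff y).mul (contMDiffAt_localFrameCoeff b hy (s.contMDiff y) i)
    · have hy' : y ∈ (tsupport φ)ᶜ := fun h => hy (hs h)
      refine (contMDiffAt_const (c := (0 : ℝ))).congr_of_eventuallyEq ?_
      filter_upwards [(isClosed_tsupport φ).isOpen_compl.mem_nhds hy'] with z hz
      rw [image_eq_zero_of_notMem_tsupport hz, zero_mul]
  let σ : Fin (Module.finrank ℝ F) → Cₛ^∞⟮I; F, V⟯ := fun i => ⟨_, hσ i⟩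
  let g : Cₛ^∞⟮I; F, V⟯ → Fin (Module.finrank ℝ F) → C^∞⟮I, M; ℝ⟯ := fun s i => ⟨_, hg s i⟩
  refine ⟨Fin (Module.finrank ℝ F), inferInstance, σ,
    fun i => e.localFrameCoeff I b i, φ * φ, {y | φ y = 1} ∩ e.baseSet,
    Filter.inter_mem hφ (e.open_baseSet.mem_nhds hx), ?_, ?_, ?_⟩
  · rintro y ⟨hy, -⟩
    have hy : φ y = 1 := hy
    simp [hy]
  · rintro y ⟨hy1, hy⟩
    have hy1 : φ y = 1 := hy1
    refine ⟨e.basisAt b hy, fun i => ?_, fun i => ?_⟩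
    · change _ = φ y • e.localFrame b i y
      simp [hy1, hy]
    · ext v
      have := e.localFrameCoeff_apply_of_mem_baseSet (I := I) b hy
        (fun z => if h : y = z then h ▸ v else 0) i
      simpa using this
  · intro s
    refine ⟨g s, ?_, ?_⟩
    · ext y
      change (φ y * φ y) • s y = _
      have hsum : (∑ i, g s i • σ i) y =
          ∑ i, (φ y * e.localFrameCoeff I b i y (s y)) • (φ y • e.localFrame b i y) := by
        change ContMDiffSection.coeAddHom I F ∞ V _ y = _
        rw [map_sum, Finset.sum_apply]
        rfl
      rw [hsum]
      by_cases hy : y ∈ e.baseSet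
      · conv_lhs => rw [e.eq_sum_localFrameCoeff_smul (I := I) (b := b) (s := s) hy]
        rw [Finset.smul_sum]
        refine Finset.sum_congr rfl fun i _ => ?_
        simp only [smul_smul]
        congr 1
        ring
      · have : φ y = 0 := image_eq_zero_of_notMem_tsupport fun h => hy (hs h)
        simp [this]
    · rintro y ⟨hy, -⟩ i
      have hy : φ y = 1 := hy
      change φ y * _ = _
      rw [hy, one_mul]

/-- The linear map on the fibre over `x` induced by a `C^∞(M)`-linear operator on sections. -/
def fiberMap (T : Module.End C^∞⟮I, M; ℝ⟯ Cₛ^∞⟮I; F, V⟯) (x : M) : Module.End ℝ (V x) where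
  toFun v := T ((exists_linear_extension (I := I) (F := F) x).choose v) x
  map_add' v w := by simp
  map_smul' c v := by
    rw [map_smul, LinearMap.map_smul_of_tower]; rfl

theorem fiberMap_apply (T : Module.End C^∞⟮I, M; ℝ⟯ Cₛ^∞⟮I; F, V⟯) (s : Cₛ^∞⟮I; F, V⟯) (x : M) :
    fiberMap T x (s x) = T s x := by
  suffices h : ∀ s t : Cₛ^∞⟮I; F, V⟯, s x = t x → T s x = T t x from
    h _ _ ((exists_linear_extension (I := I) (F := F) x).choose_spec (s x))
  intro s t hst
  obtain ⟨ι, _, σ, c, φ, U, hU, hφ, -, hc⟩ := exists_frame (I := I) (F := F) (V := V) x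
  have hx := mem_of_mem_nhds hU
  have key : ∀ s : Cₛ^∞⟮I; F, V⟯, T s x = ∑ i, c i x (s x) • T (σ i) x := by
    intro s
    obtain ⟨g, hg, hgc⟩ := hc s
    have h1 : T (φ • s) x = T s x := by simp [hφ x hx]
    rw [← h1, hg, map_sum]
    change ContMDiffSection.coeAddHom I F ∞ V _ x = _
    rw [map_sum, Finset.sum_apply]
    refine Finset.sum_congr rfl fun i _ => ?_
    rw [map_smul, ContMDiffSection.coeAddHom_apply, sec_smul_apply, hgc x hx i]
  rw [key, key, hst]

/-- The trace of a section of the endomorphism bundle, viewed as a `C^∞(M)`-linear operator `T`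
on sections: the function `x ↦ tr (Tₓ : V x → V x)`. -/
def bundleTrace (T : Module.End C^∞⟮I, M; ℝ⟯ Cₛ^∞⟮I; F, V⟯) : C^∞⟮I, M; ℝ⟯ :=
  ⟨fun x => LinearMap.trace ℝ (V x) (fiberMap T x), by
    intro x
    obtain ⟨ι, _, σ, c, φ, U, hU, hφ, hb, hc⟩ := exists_frame (I := I) (F := F) (V := V) x
    classical
    choose g hg hgc using fun i => hc (T (σ i))
    have hsm : ContMDiff I 𝓘(ℝ, ℝ) ∞ (fun y => ∑ i, g i i y) :=
      contMDiff_finsetSum fun i _ => (g i i).contMDiff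
    refine (hsm x).congr_of_eventuallyEq ?_
    filter_upwards [hU] with y hy
    obtain ⟨b, hb1, hb2⟩ := hb y hy
    rw [LinearMap.trace_eq_matrix_trace ℝ b, Matrix.trace]
    refine Finset.sum_congr rfl fun i _ => ?_
    rw [Matrix.diag_apply, LinearMap.toMatrix_apply, hb1, fiberMap_apply, hgc i y hy i, hb2]
    rfl⟩


section Deriv

variable {W G : Type*} [AddCommGroup W] [Module ℝ W] [TopologicalSpace W] [ContinuousSMul ℝ W]
  [AddCommGroup G] [Module ℝ G] [TopologicalSpace G] [ContinuousSMul ℝ G]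

theorem hasDerivWithinAt_clm_comp (L : W →L[ℝ] G) {f : ℝ → W} {f' : W} {s : Set ℝ} {t : ℝ}
    (h : HasDerivWithinAt f f' s t) : HasDerivWithinAt (fun r => L (f r)) (L f') s t := by
  have h' : HasFDerivWithinAt f (ContinuousLinearMap.toSpanSingleton ℝ f') s t := h
  have : HasFDerivWithinAt (fun r => L (f r)) (ContinuousLinearMap.toSpanSingleton ℝ (L f')) s t := by
    rw [hasFDerivWithinAt_iff_isLittleOTVS] at h' ⊢
    refine ((L.isBigOTVS_comp).trans_isLittleOTVS h').congr_left fun r => ?_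
    simp
  exact this

theorem hasDerivWithinAt_add_tvs [ContinuousAdd W] {f g : ℝ → W} {f' g' : W} {s : Set ℝ} {t : ℝ}
    (hf : HasDerivWithinAt f f' s t) (hg : HasDerivWithinAt g g' s t) :
    HasDerivWithinAt (fun r => f r + g r) (f' + g') s t := by
  have hf' : HasFDerivWithinAt f (ContinuousLinearMap.toSpanSingleton ℝ f') s t := hf
  have hg' : HasFDerivWithinAt g (ContinuousLinearMap.toSpanSingleton ℝ g') s t := hg
  have : HasFDerivWithinAt (fun r => f r + g r)
      (ContinuousLinearMap.toSpanSingleton ℝ (f' + g')) s t := by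
    rw [hasFDerivWithinAt_iff_isLittleOTVS] at hf' hg' ⊢
    refine (hf'.add hg').congr_left fun r => ?_
    simp only [ContinuousLinearMap.toSpanSingleton_apply, Pi.add_apply, smul_add]
    abel
  exact this

theorem hasDerivWithinAt_const_tvs (w : W) (s : Set ℝ) (t : ℝ) :
    HasDerivWithinAt (fun _ => w) 0 s t := by
  have : HasFDerivWithinAt (fun _ : ℝ => w) (ContinuousLinearMap.toSpanSingleton ℝ (0 : W)) s t := by
    rw [ContinuousLinearMap.toSpanSingleton_zero]
    exact hasFDerivWithinAt_const w t s
  exact this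

theorem inTangentCoordinates_model_space' {G : Type*} [NormedAddCommGroup G] [NormedSpace ℝ G]
    (f : M → ℝ) (g : M → G) (ϕ : ∀ y, TangentSpace 𝓘(ℝ, ℝ) (f y) →L[ℝ] TangentSpace 𝓘(ℝ, G) (g y))
    (x₀ : M) : inTangentCoordinates 𝓘(ℝ, ℝ) 𝓘(ℝ, G) f g ϕ x₀ = ϕ :=
  inTangentCoordinates_model_space (I := 𝓘(ℝ, ℝ)) (I' := 𝓘(ℝ, G)) f g ϕ x₀

end Deriv

section Deriv2
variable [∀ x, ContinuousSMul ℝ (V x)]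

theorem section_hasDeriv {s : ℝ → Cₛ^∞⟮I; F, V⟯} {J : Set ℝ} (hJ : UniqueDiffOn ℝ J)
    (h : ContMDiffOn (𝓘(ℝ, ℝ).prod I) (I.prod 𝓘(ℝ, F)) ∞
      (fun p : ℝ × M => (⟨p.2, s p.1 p.2⟩ : TotalSpace F V)) (J ×ˢ univ)) {t : ℝ} (ht : t ∈ J) :
    ∃! D : Cₛ^∞⟮I; F, V⟯, ∀ x, HasDerivWithinAt (fun r => s r x) (D x) J t := by
  have hsm : ∀ x₀ : M, ContMDiffWithinAt (I.prod 𝓘(ℝ, ℝ)) 𝓘(ℝ, F) ∞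
      (fun p : M × ℝ => (trivializationAt F V x₀ ⟨p.1, s p.2 p.1⟩).2) (univ ×ˢ J) (x₀, t) := by
    intro x₀
    have h1 := (contMDiffWithinAt_totalSpace.1 (h (t, x₀) ⟨ht, mem_univ _⟩)).2
    have hsw : ContMDiffWithinAt (I.prod 𝓘(ℝ, ℝ)) (𝓘(ℝ, ℝ).prod I) ∞
        (fun p : M × ℝ => (p.2, p.1)) (univ ×ˢ J) (x₀, t) :=
      contMDiffWithinAt_snd.prodMk contMDiffWithinAt_fst
    exact ContMDiffWithinAt.comp (g := fun p : ℝ × M => (trivializationAt F V x₀ ⟨p.2, s p.1 p.2⟩).2)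
      (f := fun p : M × ℝ => (p.2, p.1)) (x₀, t) h1 hsw
      (fun p hp => Set.mk_mem_prod hp.2 (mem_univ _))
  have hmd : ∀ x₀ y : M, y ∈ (trivializationAt F V x₀).baseSet →
      DifferentiableWithinAt ℝ (fun r => (trivializationAt F V x₀ ⟨y, s r y⟩).2) J t := by
    intro x₀ y hy
    have h1 : ContMDiffWithinAt 𝓘(ℝ, ℝ) (I.prod 𝓘(ℝ, F)) ∞
        (fun r => (⟨y, s r y⟩ : TotalSpace F V)) J t := by
      have h2 : ContMDiffWithinAt 𝓘(ℝ, ℝ) (𝓘(ℝ, ℝ).prod I) ∞ (fun r : ℝ => (r, y)) J t :=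
        contMDiffWithinAt_id.prodMk contMDiffWithinAt_const
      exact ContMDiffWithinAt.comp (g := fun p : ℝ × M => (⟨p.2, s p.1 p.2⟩ : TotalSpace F V))
        (f := fun r : ℝ => (r, y)) t (h (t, y) ⟨ht, mem_univ _⟩) h2
        (fun r hr => Set.mk_mem_prod hr (mem_univ _))
    have h3 := ((Trivialization.contMDiffWithinAt_iff
      (e := trivializationAt F V x₀) (by
        rw [Trivialization.mem_source]; exact hy)).1 h1).2
    exact (contMDiffWithinAt_iff_contDiffWithinAt.1 h3).differentiableWithinAt (by simp)
  have hD : ∀ x₀ y : M, ∀ hy : y ∈ (trivializationAt F V x₀).baseSet,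
      HasDerivWithinAt (fun r => s r y) ((trivializationAt F V x₀).symmL ℝ y
        (derivWithin (fun r => (trivializationAt F V x₀ ⟨y, s r y⟩).2) J t)) J t := by
    intro x₀ y hy
    have := hasDerivWithinAt_clm_comp ((trivializationAt F V x₀).symmL ℝ y)
      (hmd x₀ y hy).hasDerivWithinAt
    have heq : (fun r => (trivializationAt F V x₀).symmL ℝ y
        (trivializationAt F V x₀ ⟨y, s r y⟩).2) = fun r => s r y := by
      funext r
      simp [hy]
    rwa [heq] at this
  have huniq : ∀ x₀ y : M, ∀ hy : y ∈ (trivializationAt F V x₀).baseSet, ∀ w,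
      HasDerivWithinAt (fun r => s r y) w J t → (trivializationAt F V x₀ ⟨y, w⟩).2 =
        derivWithin (fun r => (trivializationAt F V x₀ ⟨y, s r y⟩).2) J t := by
    intro x₀ y hy w hw
    have := hasDerivWithinAt_clm_comp ((trivializationAt F V x₀).continuousLinearMapAt ℝ y) hw
    have := (this.derivWithin (hJ t ht)).symm
    simpa [hy] using this
  have hmem : ∀ x : M, x ∈ (trivializationAt F V x).baseSet :=
    fun x => FiberBundle.mem_baseSet_trivializationAt F V x
  refine ⟨⟨fun x => (trivializationAt F V x).symmL ℝ x
    (derivWithin (fun r => (trivializationAt F V x ⟨x, s r x⟩).2) J t), ?_⟩,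
    fun x => hD x x (hmem x), fun D' hD' => ?_⟩
  swap
  · ext x
    have h1 := huniq x x (hmem x) _ (hD' x)
    have h2 := huniq x x (hmem x) _ (hD x x (hmem x))
    have h3 := congrArg ((trivializationAt F V x).symmL ℝ x) (h1.trans h2.symm)
    change D' x = (trivializationAt F V x).symmL ℝ x _
    simpa [hmem x] using h3
  intro x₀
  rw [contMDiffAt_section]
  have h4 := ContMDiffWithinAt.mfderivWithin (m := ∞) (n := ∞) (t := univ) (u := J)
    (f := fun (y : M) (r : ℝ) => (trivializationAt F V x₀ ⟨y, s r y⟩).2) (g := fun _ => t)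
    (hsm x₀) contMDiffWithinAt_const (mem_univ _) (fun _ _ => ht) (by simp) hJ.uniqueMDiffOn
  have h4' : ContMDiffAt I 𝓘(ℝ, ℝ →L[ℝ] F) ∞ (fun y => fderivWithin ℝ
      (fun r => (trivializationAt F V x₀ ⟨y, s r y⟩).2) J t) x₀ := by
    rw [← contMDiffWithinAt_univ]
    rw [inTangentCoordinates_model_space'] at h4
    refine h4.congr_of_eventuallyEq (Filter.Eventually.of_forall fun y => ?_) ?_ <;>
      exact mfderivWithin_eq_fderivWithin.symm
  have h5 := h4'.clm_apply (contMDiffAt_const (c := (1 : ℝ)))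
  refine h5.congr_of_eventuallyEq ?_
  filter_upwards [(trivializationAt F V x₀).open_baseSet.mem_nhds (hmem x₀)] with y hy
  rw [huniq x₀ y hy _ (hD y y (hmem y))]
  rfl

end Deriv2
end Sections

section Courant

variable {EM HM M : Type*} [NormedAddCommGroup EM] [NormedSpace ℝ EM]
  [TopologicalSpace HM] (I : ModelWithCorners ℝ EM HM) [TopologicalSpace M] [ChartedSpace HM M]
  [IsManifold I ∞ M]
  (F : Type*) [NormedAddCommGroup F] [NormedSpace ℝ F]
  (E : M → Type*) [TopologicalSpace (TotalSpace F E)] [∀ x, TopologicalSpace (E x)]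
  [FiberBundle F E] [∀ x, AddCommGroup (E x)] [∀ x, Module ℝ (E x)] [VectorBundle ℝ F E]

/-- A smooth, fibrewise nondegenerate symmetric bilinear form on the vector bundle `E → M`. -/
structure BundlePairing where
  form (x : M) : E x →L[ℝ] E x →L[ℝ] ℝ
  symm (x : M) (v w : E x) : form x v w = form x w v
  nondegenerate (x : M) (v : E x) (hv : ∀ w, form x v w = 0) : v = 0
  contMDiff : ContMDiff I (I.prod 𝓘(ℝ, F →L[ℝ] F →L[ℝ] ℝ)) ∞
    (fun x ↦ TotalSpace.mk' (F →L[ℝ] F →L[ℝ] ℝ) x (form x))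

/-- A smooth bundle map `E → TM` covering the identity of `M`. -/
structure BundleAnchor where
  map (x : M) : E x →L[ℝ] TangentSpace I x
  contMDiff : ContMDiff I (I.prod 𝓘(ℝ, F →L[ℝ] EM)) ∞
    (fun x ↦ TotalSpace.mk' (F →L[ℝ] EM) x (map x))

variable {I F E}

/-- The function `⟨e₁, e₂⟩` for sections `e₁, e₂`. -/
def BundlePairing.pair (g : BundlePairing I F E) (e₁ e₂ : Cₛ^∞⟮I; F, E⟯) : C^∞⟮I, M; ℝ⟯ :=
  ⟨fun x => g.form x (e₁ x) (e₂ x), by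
    have h : ContMDiff I (I.prod 𝓘(ℝ, ℝ)) ∞ (fun x => TotalSpace.mk' ℝ (E := Bundle.Trivial M ℝ) x
        (g.form x (e₁ x) (e₂ x))) :=
      ContMDiff.clm_bundle_apply₂ (F₁ := F) (F₂ := F) g.contMDiff e₁.contMDiff e₂.contMDiff
    intro x
    exact (contMDiffAt_totalSpace.1 (h x)).2⟩

/-- The derivation `f ↦ ρ(e)(f)` of `C^∞(M)` given by the vector field `ρ(e)`. -/
def BundleAnchor.der (ρ : BundleAnchor I F E) (e : Cₛ^∞⟮I; F, E⟯) :
    Derivation ℝ C^∞⟮I, M; ℝ⟯ C^∞⟮I, M; ℝ⟯ :=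
  Derivation.mk'
    { toFun := fun f => ⟨fun x => mvfderiv I f x (ρ.map x (e x)), by
        have h1 : ContMDiff I (I.prod 𝓘(ℝ, EM)) ∞ (fun x =>
            (⟨x, ρ.map x (e x)⟩ : TangentBundle I M)) :=
          ContMDiff.clm_bundle_apply (F₁ := F) (F₂ := EM) ρ.contMDiff e.contMDiff
        have h2 := (f.contMDiff.contMDiff_tangentMap (m := ∞) (by simp)).comp h1
        exact (contMDiff_snd_tangentBundle_modelSpace ℝ 𝓘(ℝ, ℝ)).comp h2⟩
      map_add' := fun f g => by
        ext x
        have h := mvfderiv_add (I := I) (f.contMDiff.mdifferentiableAt (by simp) (x := x))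
          (g.contMDiff.mdifferentiableAt (by simp) (x := x))
        exact congrArg (fun L => L (ρ.map x (e x))) h
      map_smul' := fun c f => by
        ext x
        have h := mvfderiv_smul (I := I) (mdifferentiableAt_const (c := c) (x := x))
          (f.contMDiff.mdifferentiableAt (by simp) (x := x))
        have h2 : mvfderiv I ((fun _ : M => c) • (f : M → ℝ)) x (ρ.map x (e x)) =
            c * mvfderiv I f x (ρ.map x (e x)) := by
          rw [h, mvfderiv_const]
          simp
        exact h2 }
    fun f g => by
      ext x
      have h := mvfderiv_mul (I := I) (f.contMDiff.mdifferentiableAt (by simp) (x := x))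
        (g.contMDiff.mdifferentiableAt (by simp) (x := x))
      exact congrArg (fun L => L (ρ.map x (e x))) h

theorem BundleAnchor.der_apply (ρ : BundleAnchor I F E) (e : Cₛ^∞⟮I; F, E⟯) (f : C^∞⟮I, M; ℝ⟯)
    (x : M) : ρ.der e f x = mvfderiv I f x (ρ.map x (e x)) := rfl

variable (I F E) in
/-- A Courant algebroid structure on the vector bundle `E → M`, with the bracket in the Dorfman
convention. -/
structure CourantAlgebroid where
  pairing : BundlePairing I F E
  anchor : BundleAnchor I F E
  bracket : Cₛ^∞⟮I; F, E⟯ →ₗ[ℝ] Cₛ^∞⟮I; F, E⟯ →ₗ[ℝ] Cₛ^∞⟮I; F, E⟯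
  bracket_smul (e₁ e₂ : Cₛ^∞⟮I; F, E⟯) (f : C^∞⟮I, M; ℝ⟯) :
    bracket e₁ (f • e₂) = anchor.der e₁ f • e₂ + f • bracket e₁ e₂
  anchor_pair (e₁ e₂ e₃ : Cₛ^∞⟮I; F, E⟯) :
    anchor.der e₁ (pairing.pair e₂ e₃) =
      pairing.pair (bracket e₁ e₂) e₃ + pairing.pair e₂ (bracket e₁ e₃)
  jacobi (e₁ e₂ e₃ : Cₛ^∞⟮I; F, E⟯) :
    bracket (bracket e₁ e₂) e₃ = bracket e₁ (bracket e₂ e₃) - bracket e₂ (bracket e₁ e₃)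
  /-- `⟦e₁, e₂⟧ + ⟦e₂, e₁⟧ = 𝒟⟨e₁, e₂⟩`, where `𝒟 f` is the section with `⟨𝒟 f, e⟩ = ρ(e)(f)`. -/
  bracket_symm (e₁ e₂ e : Cₛ^∞⟮I; F, E⟯) :
    pairing.pair (bracket e₁ e₂ + bracket e₂ e₁) e = anchor.der e (pairing.pair e₁ e₂)

namespace CourantAlgebroid

theorem anchor_bracket [FiniteDimensional ℝ EM] [T2Space M] [FiniteDimensional ℝ F]
    [ContMDiffVectorBundle ∞ F E I] (𝒞 : CourantAlgebroid I F E) (e₁ e₂ : Cₛ^∞⟮I; F, E⟯)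
    (f : C^∞⟮I, M; ℝ⟯) : 𝒞.anchor.der (𝒞.bracket e₁ e₂) f =
      𝒞.anchor.der e₁ (𝒞.anchor.der e₂ f) - 𝒞.anchor.der e₂ (𝒞.anchor.der e₁ f) := by
  have key : ∀ s : Cₛ^∞⟮I; F, E⟯, (𝒞.anchor.der (𝒞.bracket e₁ e₂) f -
      (𝒞.anchor.der e₁ (𝒞.anchor.der e₂ f) - 𝒞.anchor.der e₂ (𝒞.anchor.der e₁ f))) • s = 0 := by
    intro s
    have h := 𝒞.jacobi e₁ e₂ (f • s)
    simp only [𝒞.bracket_smul, map_add, 𝒞.jacobi e₁ e₂ s, smul_sub] at h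
    rw [sub_smul, sub_smul, sub_eq_zero]
    rw [← sub_eq_zero] at h ⊢
    rw [← h]
    abel
  ext x
  by_cases hE : ∃ v : E x, v ≠ 0
  · obtain ⟨v, hv⟩ := hE
    obtain ⟨L, hL⟩ := exists_linear_extension (I := I) (F := F) (V := E) x
    have h := congrArg (fun t : Cₛ^∞⟮I; F, E⟯ => t x) (key (L v))
    have h' : (𝒞.anchor.der (𝒞.bracket e₁ e₂) f -
      (𝒞.anchor.der e₁ (𝒞.anchor.der e₂ f) - 𝒞.anchor.der e₂ (𝒞.anchor.der e₁ f))) x • v = 0 := by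
      rw [← hL v]
      exact h
    exact sub_eq_zero.1 ((smul_eq_zero.1 h').resolve_right hv)
  · push Not at hE
    have h0 : ∀ (e : Cₛ^∞⟮I; F, E⟯) (g : C^∞⟮I, M; ℝ⟯), 𝒞.anchor.der e g x = 0 := by
      intro e g
      rw [BundleAnchor.der_apply, hE (e x), map_zero, map_zero]
    rw [ContMDiffMap.coe_sub, Pi.sub_apply, h0, h0, h0, sub_zero]

end CourantAlgebroid

/-- `C^∞(M)`-linearity in the last entry. -/
def LinearInLast {n : ℕ} (η : (Fin (n + 1) → Cₛ^∞⟮I; F, E⟯) → C^∞⟮I, M; ℝ⟯) : Prop :=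
  (∀ e s t, η (Function.update e (Fin.last n) (s + t)) =
    η (Function.update e (Fin.last n) s) + η (Function.update e (Fin.last n) t)) ∧
  ∀ e (f : C^∞⟮I, M; ℝ⟯) s, η (Function.update e (Fin.last n) (f • s)) =
    f * η (Function.update e (Fin.last n) s)

/-- `σ` is a symbol of `η`. Vector fields on `M` are taken as derivations of `C^∞(M)`. The entries
of `σ` are those of `η` with the `i`-th and `i+1`-st ones left out. -/
def IsSymbol (g : BundlePairing I F E) {n : ℕ}
    (η : (Fin (n + 2) → Cₛ^∞⟮I; F, E⟯) → C^∞⟮I, M; ℝ⟯)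
    (σ : (Fin n → Cₛ^∞⟮I; F, E⟯) → Derivation ℝ C^∞⟮I, M; ℝ⟯ C^∞⟮I, M; ℝ⟯) : Prop :=
  ∀ (e : Fin (n + 2) → Cₛ^∞⟮I; F, E⟯) (i : Fin (n + 1)),
    η e + η (fun j => e (Equiv.swap i.castSucc i.succ j)) =
      σ (fun j => e (i.castSucc.succAbove (i.succAbove j))) (g.pair (e i.castSucc) (e i.succ))

/-- The `n`-cochains among all maps `Γ(E)ⁿ → C^∞(M)`. -/
def IsCochain (g : BundlePairing I F E) :
    (n : ℕ) → ((Fin n → Cₛ^∞⟮I; F, E⟯) → C^∞⟮I, M; ℝ⟯) → Prop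
  | 0, _ => True
  | 1, η => LinearInLast η
  | _ + 2, η => LinearInLast η ∧ ∃ σ, IsSymbol g η σ

/-- The space `C^n(E)` of `n`-cochains. -/
def cochains (g : BundlePairing I F E) (n : ℕ) :
    Submodule ℝ ((Fin n → Cₛ^∞⟮I; F, E⟯) → C^∞⟮I, M; ℝ⟯) where
  carrier := {η | IsCochain g n η}
  zero_mem' := by
    match n with
    | 0 => trivial
    | 1 => exact ⟨fun _ _ _ => by simp, fun _ _ _ => by simp⟩
    | n + 2 => exact ⟨⟨fun _ _ _ => by simp, fun _ _ _ => by simp⟩, 0, fun _ _ => by simp⟩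
  add_mem' := by
    have hl : ∀ {n : ℕ} {η τ : (Fin (n + 1) → Cₛ^∞⟮I; F, E⟯) → C^∞⟮I, M; ℝ⟯},
        LinearInLast η → LinearInLast τ → LinearInLast (η + τ) := by
      intro n η τ h1 h2
      refine ⟨fun e s t => ?_, fun e f s => ?_⟩
      · simp only [Pi.add_apply, h1.1, h2.1]; abel
      · simp only [Pi.add_apply, h1.2, h2.2, mul_add]
    match n with
    | 0 => exact fun {_ _} _ _ => trivial
    | 1 => exact fun {_ _} h1 h2 => hl h1 h2
    | n + 2 =>
      rintro η τ ⟨h1, σ₁, hσ₁⟩ ⟨h2, σ₂, hσ₂⟩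
      refine ⟨hl h1 h2, σ₁ + σ₂, fun e i => ?_⟩
      simp only [Pi.add_apply, Derivation.add_apply, ← hσ₁ e i, ← hσ₂ e i]
      abel
  smul_mem' := by
    have hl : ∀ {n : ℕ} (c : ℝ) {η : (Fin (n + 1) → Cₛ^∞⟮I; F, E⟯) → C^∞⟮I, M; ℝ⟯},
        LinearInLast η → LinearInLast (c • η) := by
      intro n c η h1
      refine ⟨fun e s t => ?_, fun e f s => ?_⟩
      · simp only [Pi.smul_apply, h1.1, smul_add]
      · simp only [Pi.smul_apply, h1.2, mul_smul_comm]
    match n with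
    | 0 => exact fun _ _ _ => trivial
    | 1 => exact fun c η h1 => hl c h1
    | n + 2 =>
      rintro c η ⟨h1, σ₁, hσ₁⟩
      refine ⟨hl c h1, c • σ₁, fun e i => ?_⟩
      simp only [Pi.smul_apply, Derivation.smul_apply, ← hσ₁ e i, smul_add]

namespace CourantAlgebroid

variable (𝒞 : CourantAlgebroid I F E)

/-- The differential `d_E`, given by the Cartan formula. -/
def d (n : ℕ) : ((Fin n → Cₛ^∞⟮I; F, E⟯) → C^∞⟮I, M; ℝ⟯) →ₗ[ℝ]
    ((Fin (n + 1) → Cₛ^∞⟮I; F, E⟯) → C^∞⟮I, M; ℝ⟯) where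
  toFun η e :=
    ∑ i : Fin (n + 1), (-1 : ℝ) ^ (i : ℕ) • 𝒞.anchor.der (e i) (η fun k => e (i.succAbove k)) -
    ∑ i : Fin (n + 1), ∑ j ∈ Finset.Ioi i, (-1 : ℝ) ^ (i : ℕ) •
      η fun k => Function.update e j (𝒞.bracket (e i) (e j)) (i.succAbove k)
  map_add' η τ := by
    funext e
    simp only [Pi.add_apply, map_add, smul_add, Finset.sum_add_distrib]
    abel
  map_smul' c η := by
    funext e
    simp only [Pi.smul_apply, Derivation.map_smul, smul_comm _ c, ← Finset.smul_sum, ← smul_sub,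
      RingHom.id_apply]

/-- The `n`-cocycles: the `n`-cochains `η` with `d_E η = 0`. -/
def cocycles (n : ℕ) : Submodule ℝ ((Fin n → Cₛ^∞⟮I; F, E⟯) → C^∞⟮I, M; ℝ⟯) :=
  cochains 𝒞.pairing n ⊓ LinearMap.ker (𝒞.d n)

/-- The `n`-coboundaries: the images under `d_E` of the `(n-1)`-cochains. -/
def coboundaries : (n : ℕ) → Submodule ℝ ((Fin n → Cₛ^∞⟮I; F, E⟯) → C^∞⟮I, M; ℝ⟯)
  | 0 => ⊥
  | n + 1 => (cochains 𝒞.pairing n).map (𝒞.d n)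

/-- The Courant algebroid cohomology `H^n(E)`: the `n`-cocycles modulo the `n`-coboundaries. -/
abbrev Cohomology (n : ℕ) : Type _ :=
  𝒞.cocycles n ⧸ (𝒞.coboundaries n).submoduleOf (𝒞.cocycles n)

/-- The class `[η] ∈ H^n(E)` of a cocycle. -/
def cohomologyClass {n : ℕ} (η : 𝒞.cocycles n) : 𝒞.Cohomology n :=
  Submodule.Quotient.mk η

end CourantAlgebroid

/-- The `(k, m)`-shuffles. -/
def shuffles (k m : ℕ) : Finset (Equiv.Perm (Fin (k + m))) :=
  open Classical in Finset.univ.filter fun p =>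
    StrictMono (fun i : Fin k => p (Fin.castAdd m i)) ∧
    StrictMono (fun j : Fin m => p (Fin.natAdd k j))

/-- The shuffle product of cochains with values in a ring `A`. -/
def cup {S A : Type*} [Ring A] {k m : ℕ} (η : (Fin k → S) → A) (τ : (Fin m → S) → A)
    (e : Fin (k + m) → S) : A :=
  ∑ p ∈ shuffles k m, (Equiv.Perm.sign p : ℤ) •
    (η (fun i => e (p (Fin.castAdd m i))) * τ (fun j => e (p (Fin.natAdd k j))))

section Connections

variable [FiniteDimensional ℝ EM] [T2Space M] [FiniteDimensional ℝ F] [ContMDiffVectorBundle ∞ F E I]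
  {𝒞 : CourantAlgebroid I F E}
  {FB : Type*} [NormedAddCommGroup FB] [NormedSpace ℝ FB] [FiniteDimensional ℝ FB]
  {B : M → Type*} [TopologicalSpace (TotalSpace FB B)] [∀ x, TopologicalSpace (B x)]
  [FiberBundle FB B] [∀ x, AddCommGroup (B x)] [∀ x, Module ℝ (B x)] [VectorBundle ℝ FB B]
  [ContMDiffVectorBundle ∞ FB B I]

variable (𝒞 FB B) in
/-- An `E`-connection `∇ : Γ(E) × Γ(B) → Γ(B)` on the vector bundle `B → M`. -/
structure EConnection where
  toFun : Cₛ^∞⟮I; F, E⟯ →ₗ[ℝ] Cₛ^∞⟮I; FB, B⟯ →ₗ[ℝ] Cₛ^∞⟮I; FB, B⟯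
  leibniz (e : Cₛ^∞⟮I; F, E⟯) (f : C^∞⟮I, M; ℝ⟯) (b : Cₛ^∞⟮I; FB, B⟯) :
    toFun e (f • b) = f • toFun e b + 𝒞.anchor.der e f • b
  smul_left (f : C^∞⟮I, M; ℝ⟯) (e : Cₛ^∞⟮I; F, E⟯) (b : Cₛ^∞⟮I; FB, B⟯) :
    toFun (f • e) b = f • toFun e b

/-- The curvature `F_∇(e₁, e₂) = [∇_{e₁}, ∇_{e₂}] - ∇_{⟦e₁, e₂⟧}`. Sections of `End B` are taken
as `C^∞(M)`-linear operators on `Γ(B)`. -/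
def EConnection.curvature (D : EConnection 𝒞 FB B) (e₁ e₂ : Cₛ^∞⟮I; F, E⟯) :
    Module.End C^∞⟮I, M; ℝ⟯ Cₛ^∞⟮I; FB, B⟯ where
  toFun b := D.toFun e₁ (D.toFun e₂ b) - D.toFun e₂ (D.toFun e₁ b) - D.toFun (𝒞.bracket e₁ e₂) b
  map_add' b c := by
    simp only [map_add]
    abel
  map_smul' f b := by
    simp only [D.leibniz, map_add, 𝒞.anchor_bracket, RingHom.id_apply, smul_sub, sub_smul]
    abel

/-- The `k`-th power `F_∇^k ∈ C^{2k}(E; End B)`. -/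
def EConnection.curvaturePow (D : EConnection 𝒞 FB B) :
    (k : ℕ) → (Fin (2 * k) → Cₛ^∞⟮I; F, E⟯) → Module.End C^∞⟮I, M; ℝ⟯ Cₛ^∞⟮I; FB, B⟯
  | 0 => fun _ => 1
  | k + 1 => cup (D.curvaturePow k) fun e : Fin 2 → Cₛ^∞⟮I; F, E⟯ => D.curvature (e 0) (e 1)

/-- The Chern form `ch_k(∇) = tr(F_∇^k)`. -/
def EConnection.chern (D : EConnection 𝒞 FB B) (k : ℕ) :
    (Fin (2 * k) → Cₛ^∞⟮I; F, E⟯) → C^∞⟮I, M; ℝ⟯ :=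
  fun e => bundleTrace (D.curvaturePow k e)

variable (𝒞 FB B) in
/-- A smooth path `∇_t`, `0 ≤ t ≤ 1`, of `E`-connections: for all `e` and `b`, the section
`∇_{t,e} b` of `B` depends smoothly on `(t, x) ∈ [0,1] × M`. -/
structure EConnectionPath where
  toFun : unitInterval → EConnection 𝒞 FB B
  contMDiffOn (e : Cₛ^∞⟮I; F, E⟯) (b : Cₛ^∞⟮I; FB, B⟯) :
    ContMDiffOn (𝓘(ℝ, ℝ).prod I) (I.prod 𝓘(ℝ, FB)) ∞
      (fun p : ℝ × M => TotalSpace.mk' FB p.2 ((toFun (projIcc 0 1 zero_le_one p.1)).toFun e b p.2))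
      (Icc 0 1 ×ˢ univ)

namespace EConnectionPath

variable [∀ x, IsTopologicalAddGroup (B x)] [∀ x, ContinuousSMul ℝ (B x)]
  (γ : EConnectionPath 𝒞 FB B)

theorem existsUnique_deriv (t : unitInterval) (e : Cₛ^∞⟮I; F, E⟯) (b : Cₛ^∞⟮I; FB, B⟯) :
    ∃! D : Cₛ^∞⟮I; FB, B⟯, ∀ x, HasDerivWithinAt
      (fun r : ℝ => (γ.toFun (projIcc 0 1 zero_le_one r)).toFun e b x) (D x) (Icc 0 1) t :=
  section_hasDeriv (s := fun r => (γ.toFun (projIcc 0 1 zero_le_one r)).toFun e b)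
    (uniqueDiffOn_Icc zero_lt_one) (γ.contMDiffOn e b) t.2

/-- The time derivative `d/dt [∇_t] ∈ C^1(E; End B)`: it sends `b` to the section whose value at
`x` is the derivative of `t ↦ (∇_{t,e} b)(x)` in the fibre `B x`. -/
def velocity (t : unitInterval) (e : Cₛ^∞⟮I; F, E⟯) :
    Module.End C^∞⟮I, M; ℝ⟯ Cₛ^∞⟮I; FB, B⟯ where
  toFun b := (γ.existsUnique_deriv t e b).choose
  map_add' b c := by
    symm
    refine (γ.existsUnique_deriv t e (b + c)).choose_spec.2 _ fun x => ?_
    have h1 := (γ.existsUnique_deriv t e b).choose_spec.1 x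
    have h2 := (γ.existsUnique_deriv t e c).choose_spec.1 x
    simpa only [map_add] using! hasDerivWithinAt_add_tvs h1 h2
  map_smul' f b := by
    symm
    refine (γ.existsUnique_deriv t e (f • b)).choose_spec.2 _ fun x => ?_
    have h1 := hasDerivWithinAt_clm_comp (f x • ContinuousLinearMap.id ℝ (B x))
      ((γ.existsUnique_deriv t e b).choose_spec.1 x)
    have h2 := hasDerivWithinAt_add_tvs h1
      (hasDerivWithinAt_const_tvs ((𝒞.anchor.der e f • b) x) (Icc 0 1) (t : ℝ))
    rw [add_zero] at h2
    simpa only [EConnection.leibniz] using! h2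

/-- The integrand `tr(d/dt [∇_t] ⌣ F_{∇_t}^k)`. -/
def transgression (k : ℕ) (t : unitInterval) (e : Fin (2 * k + 1) → Cₛ^∞⟮I; F, E⟯) :
    C^∞⟮I, M; ℝ⟯ :=
  bundleTrace (cup (fun e : Fin 1 → Cₛ^∞⟮I; F, E⟯ => γ.velocity t (e 0))
    ((γ.toFun t).curvaturePow k) fun i => e (Fin.cast (Nat.add_comm 1 (2 * k)) i))

/-- The values of the Chern–Simons form
`cs_{k+1}(∇_t) = (k+1) ∫₀¹ tr(d/dt [∇_t] ⌣ F_{∇_t}^k) dt` at the point `x`. -/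
def chernSimons (k : ℕ) (e : Fin (2 * k + 1) → Cₛ^∞⟮I; F, E⟯) (x : M) : ℝ :=
  (k + 1) * ∫ t : unitInterval, γ.transgression k t e x

end EConnectionPath

end Connections

end Courant

end CourantCS
end

/-! This is the classical Chern–Weil transgression, carried out in an algebra where it does not
matter that the Dorfman bracket fails to be skew. Cochains are replaced by arbitrary functions on
lists of sections, with values in functions or in endomorphisms of `B`. On these the operations are
determined by recursion on the first argument: `ι_e(φψ) = (ι_e φ)ψ ± φ(ι_e ψ)` for the shuffle
product, `ι_f L_e = L_e ι_f - ι_⟦e,f⟧` for the Lie derivative, and Cartan's formula `ι_e d = L_e - d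
ι_e` for the differential. The graded Leibniz rule (`diff_mul`) and the graded cyclicity of the
trace (`trace_mul_comm`) follow by induction on the list, for any bracket whatsoever; `d² = 0` is
never needed. `cup_ofFn` and `diff_ofFn` identify the recursive operations with the sums over
shuffles and over pairs of indices.

The Jacobi identity gives the Bianchi identity `d_∇ F = 0` (`diff_curvList`), and the trace
intertwines `d_∇` with `d_E` (`traceLM_covEnd`), so `tr F^k` is closed. Along a path with velocity
`A` one has `dF/dt = d_∇ A` (`hasEndDeriv_curvList`), and cyclicity, the Leibniz rule and Bianchi
give `d/dt tr F^(k+1) = (k+1) tr(d_∇ A · F^k) = (k+1) d_E tr(A · F^k)`. Integration over `t` is the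
transgression formula; the affine path between two connections shows that the class is independent
of the connection.

That these forms are cochains rests on `F(a,b) + F(b,a) = -∇_{𝒟⟨a,b⟩}`. The operator `∇_{𝒟 f}` is
`C^∞(M)`-linear because `ρ ∘ 𝒟 = 0` (`der_gradient`), and it is a derivation in `f`, so the
curvature has a symbol. Symbols obey a Leibniz rule for products (`HasSymbol.mul`) and pass through
traces and integrals.

The analysis consists of differentiation under the integral sign in charts and, as a consequence,
the commutation of `d/dt` with `ρ(e)` (`HasFamilyDeriv.der`). Statements on sections and
endomorphisms are reduced to functions by local resolutions `φ • s = ∑ lᵢ(s) • σᵢ` with a cutoff `φ`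
(`exists_dual_frame`). -/

namespace CourantCS

set_option linter.unusedSectionVars false

/-- Inhomogeneous cochains on `S` with values in `A`: a function on lists collects the values in
all degrees. -/
structure ListCochain (S A : Type*) where
  /-- The values of the cochain. -/
  toFun : List S → A

/-! ### Graded algebra of list cochains: contraction, grading, shuffle product, Cartan calculus -/

namespace ListCochain

variable {S A K : Type*}

instance : FunLike (ListCochain S A) (List S) A where
  coe := toFun
  coe_injective := by rintro ⟨f⟩ ⟨g⟩ h; exact congrArg _ h

@[ext]
theorem ext {φ ψ : ListCochain S A} (h : ∀ l, φ l = ψ l) : φ = ψ := DFunLike.ext _ _ h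

@[simp] theorem mk_apply (f : List S → A) (l : List S) : (⟨f⟩ : ListCochain S A) l = f l := rfl

section Group

variable [AddCommGroup A]

instance : Zero (ListCochain S A) := ⟨⟨0⟩⟩
instance : Add (ListCochain S A) := ⟨fun φ ψ => ⟨⇑φ + ⇑ψ⟩⟩
instance : Neg (ListCochain S A) := ⟨fun φ => ⟨-⇑φ⟩⟩
instance : Sub (ListCochain S A) := ⟨fun φ ψ => ⟨⇑φ - ⇑ψ⟩⟩
instance {R : Type*} [SMul R A] : SMul R (ListCochain S A) := ⟨fun c φ => ⟨c • ⇑φ⟩⟩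

@[simp] theorem add_apply (φ ψ : ListCochain S A) (l : List S) : (φ + ψ) l = φ l + ψ l := rfl
@[simp] theorem sub_apply (φ ψ : ListCochain S A) (l : List S) : (φ - ψ) l = φ l - ψ l := rfl
@[simp] theorem neg_apply (φ : ListCochain S A) (l : List S) : (-φ) l = -φ l := rfl
@[simp] theorem zero_apply (l : List S) : (0 : ListCochain S A) l = 0 := rfl
@[simp] theorem smul_apply {R : Type*} [SMul R A] (c : R) (φ : ListCochain S A) (l : List S) :
    (c • φ) l = c • φ l := rfl

instance : AddCommGroup (ListCochain S A) :=
  DFunLike.coe_injective.addCommGroup _ rfl (fun _ _ => rfl) (fun _ => rfl) (fun _ _ => rfl)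
    (fun _ _ => rfl) (fun _ _ => rfl)

instance [CommRing K] [Module K A] : Module K (ListCochain S A) :=
  DFunLike.coe_injective.module K
    { toFun := fun φ : ListCochain S A => ⇑φ, map_zero' := rfl, map_add' := fun _ _ => rfl }
    (fun _ _ => rfl)

/-- Contraction: insertion of `e` into the first slot. -/
def contract (e : S) : ListCochain S A →+ ListCochain S A where
  toFun φ := ⟨fun l => φ (e :: l)⟩
  map_zero' := rfl
  map_add' _ _ := rfl

@[simp] theorem contract_apply (e : S) (φ : ListCochain S A) (l : List S) :
    contract e φ l = φ (e :: l) := rfl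

/-- The grading involution: multiplication by `(-1)ⁿ` in degree `n`. -/
def grade : ListCochain S A →+ ListCochain S A where
  toFun φ := ⟨fun l => (-1 : ℤ) ^ l.length • φ l⟩
  map_zero' := by ext l; simp
  map_add' φ ψ := by ext l; simp

theorem grade_apply (φ : ListCochain S A) (l : List S) :
    grade φ l = (-1 : ℤ) ^ l.length • φ l := rfl

@[simp] theorem grade_nil (φ : ListCochain S A) : grade φ [] = φ [] := by simp [grade_apply]

theorem contract_grade (e : S) (φ : ListCochain S A) :
    contract e (grade φ) = -grade (contract e φ) := by
  ext l
  simp [grade_apply, pow_succ]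

@[simp] theorem grade_grade (φ : ListCochain S A) : grade (grade φ) = φ := by
  ext l
  simp [grade_apply, smul_smul, ← mul_pow]

end Group

section Ring

variable [Ring A]

/-- The shuffle product, by recursion on the list of arguments: the first argument goes either
into the first factor or, with the sign of its degree, into the second one. -/
def shuffleMul : List S → ListCochain S A → ListCochain S A → A
  | [], φ, ψ => φ [] * ψ []
  | e :: l, φ, ψ => shuffleMul l (contract e φ) ψ + shuffleMul l (grade φ) (contract e ψ)

instance : Mul (ListCochain S A) := ⟨fun φ ψ => ⟨fun l => shuffleMul l φ ψ⟩⟩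

instance : One (ListCochain S A) := ⟨⟨fun l => if l = [] then 1 else 0⟩⟩

@[simp] theorem mul_nil (φ ψ : ListCochain S A) : (φ * ψ) [] = φ [] * ψ [] := rfl

theorem mul_cons (φ ψ : ListCochain S A) (e : S) (l : List S) :
    (φ * ψ) (e :: l) = (contract e φ * ψ) l + (grade φ * contract e ψ) l := rfl

@[simp] theorem one_nil : (1 : ListCochain S A) [] = 1 := rfl

@[simp] theorem contract_one (e : S) : contract e (1 : ListCochain S A) = 0 := rfl

@[simp] theorem grade_one : grade (1 : ListCochain S A) = 1 := by
  ext l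
  cases l with
  | nil => simp
  | cons e l =>
    rw [grade_apply]
    exact smul_zero _

theorem mul_add_apply (l : List S) : ∀ φ ψ χ : ListCochain S A,
    (φ * (ψ + χ)) l = (φ * ψ) l + (φ * χ) l := by
  induction l with
  | nil => intro φ ψ χ; simp [mul_add]
  | cons e l ih => intro φ ψ χ; simp only [mul_cons, map_add, ih]; abel

theorem add_mul_apply (l : List S) : ∀ φ ψ χ : ListCochain S A,
    ((φ + ψ) * χ) l = (φ * χ) l + (ψ * χ) l := by
  induction l with
  | nil => intro φ ψ χ; simp [add_mul]
  | cons e l ih => intro φ ψ χ; simp only [mul_cons, map_add, ih]; abel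

instance : NonUnitalNonAssocRing (ListCochain S A) where
  left_distrib φ ψ χ := ext fun l => mul_add_apply l φ ψ χ
  right_distrib φ ψ χ := ext fun l => add_mul_apply l φ ψ χ
  zero_mul φ := by
    have h := fun l => add_mul_apply l 0 0 φ
    ext l
    simpa using h l
  mul_zero φ := by
    have h := fun l => mul_add_apply l φ 0 0
    ext l
    simpa using h l

/-- Contraction is a graded derivation; the recursive definition of the product says nothing else.
Together with the value on the empty list this rule determines the product, so identities between
products are proved by contracting both sides. -/
theorem contract_mul (e : S) (φ ψ : ListCochain S A) :
    contract e (φ * ψ) = contract e φ * ψ + grade φ * contract e ψ := rfl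

theorem grade_mul (φ ψ : ListCochain S A) : grade (φ * ψ) = grade φ * grade ψ := by
  ext l
  induction l generalizing φ ψ with
  | nil => simp
  | cons e l ih =>
    have h := DFunLike.congr_fun (contract_grade e (φ * ψ)) l
    rw [contract_mul, map_add] at h
    rw [contract_apply] at h
    rw [h, mul_cons, contract_grade, contract_grade, neg_apply, add_apply, ih, ih]
    simp only [neg_mul, mul_neg, neg_apply]
    abel

/-- Contracting either bracketing gives the same three terms, one for each factor that can receive
the first argument; `grade_mul` matches the signs of the third. -/
theorem mul_assoc_apply (l : List S) : ∀ φ ψ χ : ListCochain S A,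
    (φ * ψ * χ) l = (φ * (ψ * χ)) l := by
  induction l with
  | nil => intro φ ψ χ; simp [mul_assoc]
  | cons e l ih =>
    intro φ ψ χ
    rw [mul_cons, mul_cons, contract_mul, contract_mul, add_mul, mul_add, grade_mul]
    simp only [add_apply, ih, add_assoc]

theorem one_mul_apply (l : List S) : ∀ φ : ListCochain S A, (1 * φ) l = φ l := by
  induction l with
  | nil => intro φ; simp
  | cons e l ih => intro φ; simp [mul_cons, ih]

theorem mul_one_apply (l : List S) : ∀ φ : ListCochain S A, (φ * 1) l = φ l := by
  induction l with
  | nil => intro φ; simp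
  | cons e l ih => intro φ; simp [mul_cons, ih]

instance : Ring (ListCochain S A) where
  __ := (inferInstance : NonUnitalNonAssocRing (ListCochain S A))
  mul_assoc φ ψ χ := ext fun l => mul_assoc_apply l φ ψ χ
  one_mul φ := ext fun l => one_mul_apply l φ
  mul_one φ := ext fun l => mul_one_apply l φ

variable [CommRing K] [Algebra K A]

theorem contract_smul (e : S) (c : K) (φ : ListCochain S A) :
    contract e (c • φ) = c • contract e φ := rfl

theorem grade_smul (c : K) (φ : ListCochain S A) : grade (c • φ) = c • grade φ := by
  ext l
  rw [grade_apply, smul_apply, smul_apply, grade_apply, smul_comm]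

theorem smul_mul_apply (l : List S) : ∀ (c : K) (φ ψ : ListCochain S A),
    (c • φ * ψ) l = c • (φ * ψ) l := by
  induction l with
  | nil => intro c φ ψ; simp
  | cons e l ih => intro c φ ψ; simp only [mul_cons, contract_smul, grade_smul, ih, smul_add]

theorem mul_smul_apply (l : List S) : ∀ (c : K) (φ ψ : ListCochain S A),
    (φ * c • ψ) l = c • (φ * ψ) l := by
  induction l with
  | nil => intro c φ ψ; simp
  | cons e l ih => intro c φ ψ; simp only [mul_cons, contract_smul, ih, smul_add]

instance : Algebra K (ListCochain S A) := Algebra.ofModule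
  (fun c φ ψ => ext fun l => smul_mul_apply l c φ ψ)
  (fun c φ ψ => ext fun l => mul_smul_apply l c φ ψ)

end Ring

/-! ### Lie derivative and differential -/

section Differential

variable [AddCommGroup A] (br : S → S → S) (δ : S → A →+ A)

/-- The Lie derivative along `e`. -/
def lieAux (e : S) : List S → ListCochain S A → A
  | [], φ => δ e (φ [])
  | f :: l, φ => lieAux e l (contract f φ) - φ (br e f :: l)

theorem lieAux_add (e : S) (l : List S) (φ ψ : ListCochain S A) :
    lieAux br δ e l (φ + ψ) = lieAux br δ e l φ + lieAux br δ e l ψ := by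
  induction l generalizing φ ψ with
  | nil => exact map_add (δ e) _ _
  | cons f l ih =>
    simp only [lieAux, map_add, add_apply, ih]
    abel

/-- The Lie derivative along `e` as a homomorphism on cochains. -/
def lie (e : S) : ListCochain S A →+ ListCochain S A :=
  AddMonoidHom.mk' (fun φ => ⟨fun l => lieAux br δ e l φ⟩)
    fun φ ψ => ext fun l => lieAux_add br δ e l φ ψ

theorem lie_nil (e : S) (φ : ListCochain S A) : lie br δ e φ [] = δ e (φ []) := rfl

theorem contract_lie (e f : S) (φ : ListCochain S A) :
    contract f (lie br δ e φ) = lie br δ e (contract f φ) - contract (br e f) φ := rfl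

/-- The differential, determined by Cartan's formula. -/
def diffAux : List S → ListCochain S A → A
  | [], _ => 0
  | e :: l, φ => lie br δ e φ l - diffAux l (contract e φ)

theorem diffAux_add (l : List S) (φ ψ : ListCochain S A) :
    diffAux br δ l (φ + ψ) = diffAux br δ l φ + diffAux br δ l ψ := by
  induction l generalizing φ ψ with
  | nil => exact (add_zero _).symm
  | cons f l ih =>
    simp only [diffAux, map_add, add_apply, ih]
    abel

/-- The differential as a homomorphism on cochains. -/
def diff : ListCochain S A →+ ListCochain S A :=
  AddMonoidHom.mk' (fun φ => ⟨fun l => diffAux br δ l φ⟩)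
    fun φ ψ => ext fun l => diffAux_add br δ l φ ψ

@[simp] theorem diff_nil (φ : ListCochain S A) : diff br δ φ [] = 0 := rfl

theorem contract_diff (e : S) (φ : ListCochain S A) :
    contract e (diff br δ φ) = lie br δ e φ - diff br δ (contract e φ) := rfl

theorem grade_lie (e : S) (φ : ListCochain S A) :
    grade (lie br δ e φ) = lie br δ e (grade φ) := by
  ext l
  induction l generalizing φ with
  | nil => simp [lie_nil]
  | cons f l ih =>
    have h := DFunLike.congr_fun (contract_grade f (lie br δ e φ)) l
    have h2 := DFunLike.congr_fun (contract_lie br δ e f (grade φ)) l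
    rw [contract_apply] at h h2
    rw [h, h2, contract_lie, contract_grade, contract_grade, map_sub, neg_apply, sub_apply, ih]
    simp only [map_neg, neg_apply, sub_apply]
    abel

/-- The differential raises the degree by one, whence the sign; `grade_lie` has none because the Lie
derivative preserves the degree. -/
theorem grade_diff (φ : ListCochain S A) :
    grade (diff br δ φ) = -diff br δ (grade φ) := by
  ext l
  induction l generalizing φ with
  | nil => simp
  | cons f l ih =>
    have h := DFunLike.congr_fun (contract_grade f (diff br δ φ)) l
    have h2 := DFunLike.congr_fun (contract_diff br δ f (grade φ)) l
    rw [contract_apply] at h h2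
    rw [h, neg_apply, neg_apply, h2, contract_diff, map_sub, grade_lie, contract_grade, sub_apply,
      ih]
    simp only [map_neg, neg_apply, sub_apply]

/-- Postcomposition of a cochain with an additive map. -/
def mapVal {A' : Type*} [AddCommGroup A'] (T : A →+ A') : ListCochain S A →+ ListCochain S A' where
  toFun φ := ⟨fun l => T (φ l)⟩
  map_zero' := by ext l; simp
  map_add' φ ψ := by ext l; simp

@[simp] theorem mapVal_apply {A' : Type*} [AddCommGroup A'] (T : A →+ A') (φ : ListCochain S A)
    (l : List S) : mapVal T φ l = T (φ l) := rfl

theorem contract_mapVal {A' : Type*} [AddCommGroup A'] (T : A →+ A') (e : S)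
    (φ : ListCochain S A) : contract e (mapVal T φ) = mapVal T (contract e φ) := rfl

theorem lie_mapVal {A' : Type*} [AddCommGroup A'] (T : A →+ A') (δ' : S → A' →+ A')
    (h : ∀ e a, δ' e (T a) = T (δ e a)) (e : S) (φ : ListCochain S A) :
    lie br δ' e (mapVal T φ) = mapVal T (lie br δ e φ) := by
  ext l
  induction l generalizing φ with
  | nil => simp [lie_nil, h]
  | cons f l ih =>
    have h1 := DFunLike.congr_fun (contract_lie br δ' e f (mapVal T φ)) l
    have h2 := DFunLike.congr_fun (contract_lie br δ e f φ) l
    rw [contract_apply] at h1 h2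
    rw [mapVal_apply, h1, h2, contract_mapVal, sub_apply, sub_apply, map_sub, ih]
    simp

/-- For `T` the trace, `δ` the connection on `End B` and `δ'` the anchor, this turns `d_∇` into
`d_E`. -/
theorem diff_mapVal {A' : Type*} [AddCommGroup A'] (T : A →+ A') (δ' : S → A' →+ A')
    (h : ∀ e a, δ' e (T a) = T (δ e a)) (φ : ListCochain S A) :
    diff br δ' (mapVal T φ) = mapVal T (diff br δ φ) := by
  ext l
  induction l generalizing φ with
  | nil => simp
  | cons f l ih =>
    have h1 := DFunLike.congr_fun (contract_diff br δ' f (mapVal T φ)) l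
    have h2 := DFunLike.congr_fun (contract_diff br δ f φ) l
    rw [contract_apply] at h1 h2
    rw [mapVal_apply, h1, h2, contract_mapVal, sub_apply, sub_apply, map_sub, ih,
      lie_mapVal br δ T δ' h]
    simp

end Differential

section Leibniz

variable [Ring A] (br : S → S → S) (δ : S → A →+ A)
  (hδ : ∀ e a b, δ e (a * b) = δ e a * b + a * δ e b)
include hδ

/-- The commutator of `L_e` with a contraction is again a contraction, hence a graded derivation, so
both sides satisfy the same recursion. In degree zero the claim is `hδ`. -/
theorem lie_mul (e : S) (φ ψ : ListCochain S A) :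
    lie br δ e (φ * ψ) = lie br δ e φ * ψ + φ * lie br δ e ψ := by
  ext l
  induction l generalizing φ ψ with
  | nil => simp [lie_nil, hδ]
  | cons f l ih =>
    rw [← contract_apply, ← contract_apply, contract_lie, contract_mul, map_add, map_add,
      contract_mul, contract_mul, contract_mul, contract_lie, contract_lie, grade_lie]
    simp only [add_apply, sub_apply, ih, sub_mul, mul_sub]
    abel

/-- By Cartan's formula the contraction of either side by `f` is `L_f` of the product minus an
instance of the claim for contracted factors. The cross terms cancel because `grade` anticommutes
with both `d` and `ι_f`. -/
theorem diff_mul (φ ψ : ListCochain S A) :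
    diff br δ (φ * ψ) = diff br δ φ * ψ + grade φ * diff br δ ψ := by
  ext l
  induction l generalizing φ ψ with
  | nil => simp
  | cons f l ih =>
    rw [← contract_apply, ← contract_apply, contract_diff, contract_mul, map_add, map_add,
      contract_mul, contract_mul, contract_diff, contract_diff, lie_mul br δ hδ, grade_diff,
      contract_grade, grade_grade]
    simp only [add_apply, sub_apply, ih, sub_mul, mul_sub, grade_grade, neg_mul, neg_apply]
    abel

end Leibniz

/-! ### Graded cyclicity of the trace -/

section Trace

variable [Ring A] {G : Type*} [AddCommGroup G] (tr : A →+ G) (htr : ∀ a b, tr (a * b) = tr (b * a))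
include htr

/-- Graded cyclicity of a trace. -/
theorem trace_mul_comm (p q : ℕ) (φ ψ : ListCochain S A) (hφ : grade φ = (-1 : ℤ) ^ p • φ)
    (hψ : grade ψ = (-1 : ℤ) ^ q • ψ) :
    mapVal tr (φ * ψ) = (-1 : ℤ) ^ (p * q) • mapVal tr (ψ * φ) := by
  ext l
  induction l generalizing φ ψ p q with
  | nil =>
    -- `p` and `q` only record parities, so the sign must be absorbed here. If `p` is even it is
    -- `1`; if `p` is odd it equals `(-1)^q`, which fixes `ψ []` by `hψ`.
    have h1 : (-1 : ℤ) ^ (p * q) • (φ [] * ψ []) = φ [] * ψ [] := by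
      have h2 := DFunLike.congr_fun hφ []
      rw [grade_nil, smul_apply] at h2
      rw [pow_mul]
      rcases neg_one_pow_eq_or ℤ p with h | h
      · simp [h]
      · have h4 := DFunLike.congr_fun hψ []
        rw [grade_nil, smul_apply] at h4
        rw [h, ← mul_smul_comm, ← h4]
    have h2 : ((-1 : ℤ) ^ (p * q) • mapVal tr (ψ * φ)) [] =
      (-1 : ℤ) ^ (p * q) • tr (ψ [] * φ []) := rfl
    rw [h2, htr, ← map_zsmul, h1]
    rfl
  | cons e l ih =>
    -- Contraction flips the parity.
    have key : ∀ (n : ℕ) (χ : ListCochain S A), grade χ = (-1 : ℤ) ^ n • χ →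
        grade (contract e χ) = (-1 : ℤ) ^ (n + 1) • contract e χ := by
      intro n χ h
      have h2 := contract_grade e χ
      rw [h, map_zsmul] at h2
      rw [pow_succ, mul_neg_one, neg_smul, ← neg_eq_iff_eq_neg]
      exact h2.symm
    have h1 := ih (p + 1) q (contract e φ) ψ (key p φ hφ) hψ
    have h2 := ih p (q + 1) φ (contract e ψ) hφ (key q ψ hψ)
    rw [smul_apply] at h1 h2
    rw [smul_apply, ← contract_apply, ← contract_apply, contract_mapVal, contract_mapVal, contract_mul,
      contract_mul, map_add, map_add, add_apply, add_apply, h1, hφ, hψ, smul_mul_assoc,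
      smul_mul_assoc, map_zsmul, map_zsmul, smul_apply, smul_apply, h2, smul_add, smul_smul, smul_smul, add_comm]
    congr 2
    · rw [mul_add, mul_one, pow_add, mul_left_comm, ← pow_add, ← two_mul]
      simp
    · rw [add_mul, one_mul, pow_add]

end Trace

end ListCochain
namespace ListCochain

variable {S A K : Type*}

/-! ### Homogeneous cochains and the sum over shuffles -/

section Homogeneous

variable [AddCommGroup A]

/-- `φ` is concentrated in degree `n`. -/
def Homogeneous (n : ℕ) (φ : ListCochain S A) : Prop := ∀ l : List S, l.length ≠ n → φ l = 0

theorem Homogeneous.contract {n : ℕ} {φ : ListCochain S A} (h : Homogeneous (n + 1) φ) (e : S) :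
    Homogeneous n (contract e φ) := fun l hl => h _ (by simpa using hl)

theorem Homogeneous.contract_zero {φ : ListCochain S A} (h : Homogeneous 0 φ) (e : S) :
    ListCochain.contract e φ = 0 := ext fun l => h _ (by simp)

theorem Homogeneous.grade_eq {n : ℕ} {φ : ListCochain S A} (h : Homogeneous n φ) :
    grade φ = (-1 : ℤ) ^ n • φ := by
  ext l
  rw [grade_apply, smul_apply]
  by_cases hl : l.length = n
  · rw [hl]
  · rw [h l hl, smul_zero, smul_zero]

theorem Homogeneous.grade {n : ℕ} {φ : ListCochain S A} (h : Homogeneous n φ) :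
    Homogeneous n (grade φ) := fun l hl => by rw [grade_apply, h l hl, smul_zero]

end Homogeneous

section Ring

variable [Ring A]

theorem homogeneous_one : Homogeneous 0 (1 : ListCochain S A) := fun l hl => by
  cases l with
  | nil => exact absurd rfl hl
  | cons e l => rfl

theorem Homogeneous.mul {k m : ℕ} {φ ψ : ListCochain S A} (hφ : Homogeneous k φ)
    (hψ : Homogeneous m ψ) : Homogeneous (k + m) (φ * ψ) := by
  intro l
  induction l generalizing k m φ ψ with
  | nil =>
    intro hl
    rw [mul_nil]
    by_cases hk : k = 0
    · rw [hψ [] (by rintro rfl; simp [hk] at hl), mul_zero]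
    · rw [hφ [] (by simpa using Ne.symm hk), zero_mul]
  | cons e l ih =>
    intro hl
    rw [mul_cons]
    have h1 : (ListCochain.contract e φ * ψ) l = 0 := by
      cases k with
      | zero => rw [hφ.contract_zero, zero_mul, zero_apply]
      | succ k => exact ih (hφ.contract e) hψ (by simp only [List.length_cons] at hl; omega)
    have h2 : (ListCochain.grade φ * ListCochain.contract e ψ) l = 0 := by
      cases m with
      | zero => rw [hψ.contract_zero, mul_zero, zero_apply]
      | succ m => exact ih hφ.grade (hψ.contract e) (by simp only [List.length_cons] at hl; omega)
    rw [h1, h2, add_zero]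

section Shuffles

/-- Permutations of `Fin (n + 1)` by the preimage of `0` and the permutation induced on the
complement. -/
theorem bijective_perm_cycleRange (n : ℕ) : Function.Bijective
    (fun x : Fin (n + 1) × Equiv.Perm (Fin n) =>
      (Equiv.Perm.decomposeFin.symm (0, x.2) * x.1.cycleRange : Equiv.Perm (Fin (n + 1)))) := by
  rw [Fintype.bijective_iff_injective_and_card]
  constructor
  · rintro ⟨i, p⟩ ⟨j, q⟩ h
    -- The index `i` is recovered as the preimage of `0`; cancelling its cycle then recovers `p`,
    -- and the count `(n+1) · n! = (n+1)!` gives surjectivity.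
    have key : ∀ (i : Fin (n + 1)) (p : Equiv.Perm (Fin n)),
        (Equiv.Perm.decomposeFin.symm (0, p) * i.cycleRange : Equiv.Perm (Fin (n + 1))) i = 0 := by
      intro i p
      rw [Equiv.Perm.mul_apply, Fin.cycleRange_self, Equiv.Perm.decomposeFin_symm_apply_zero]
    have hij : i = j := by
      have h1 := key i p
      have h2 := key j q
      dsimp only at h
      rw [h] at h1
      exact Equiv.injective _ (h1.trans h2.symm)
    subst hij
    have h3 := Equiv.Perm.decomposeFin.symm.injective (mul_right_cancel h)
    simpa using h3
  · simp [Fintype.card_perm, Nat.factorial_succ]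

theorem decomposeFin_cycleRange_succAbove {n : ℕ} (i : Fin (n + 1)) (p : Equiv.Perm (Fin n))
    (j : Fin n) : (Equiv.Perm.decomposeFin.symm (0, p) * i.cycleRange : Equiv.Perm (Fin (n + 1)))
      (i.succAbove j) = (p j).succ := by
  simp [Equiv.Perm.mul_apply, Fin.cycleRange_succAbove]

theorem decomposeFin_cycleRange_self {n : ℕ} (i : Fin (n + 1)) (p : Equiv.Perm (Fin n)) :
    (Equiv.Perm.decomposeFin.symm (0, p) * i.cycleRange : Equiv.Perm (Fin (n + 1))) i = 0 := by
  rw [Equiv.Perm.mul_apply, Fin.cycleRange_self, Equiv.Perm.decomposeFin_symm_apply_zero]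

theorem strictMono_succ_comp {k n : ℕ} {f : Fin k → Fin n} :
    StrictMono (fun i => (f i).succ) ↔ StrictMono f :=
  ⟨fun h _ _ hij => Fin.succ_lt_succ_iff.1 (h hij), fun h _ _ hij => Fin.succ_lt_succ_iff.2 (h hij)⟩

theorem strictMono_of_zero_succ {k n : ℕ} {f : Fin (k + 1) → Fin (n + 1)} {g : Fin k → Fin n}
    (h0 : f 0 = 0) (hs : ∀ i, f i.succ = (g i).succ) : StrictMono f ↔ StrictMono g := by
  rw [← strictMono_succ_comp (f := g)]
  constructor
  · intro h i j hij
    dsimp only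
    rw [← hs, ← hs]
    exact h (Fin.succ_lt_succ_iff.2 hij)
  · intro h i j hij
    cases j using Fin.cases with
    | zero => exact absurd hij (Fin.not_lt_zero _)
    | succ j =>
      cases i using Fin.cases with
      | zero => rw [h0, hs]; exact Fin.succ_pos _
      | succ i => rw [hs, hs]; exact h (Fin.succ_lt_succ_iff.1 hij)

open Classical in
/-- The summand of the shuffle product at a permutation. -/
noncomputable def shuffleTerm {k m n : ℕ} (h : k + m = n) (η : (Fin k → S) → A) (τ : (Fin m → S) → A)
    (e : Fin n → S) (p : Equiv.Perm (Fin n)) : A :=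
  if StrictMono (fun i : Fin k => p (Fin.cast h (Fin.castAdd m i))) ∧
      StrictMono (fun j : Fin m => p (Fin.cast h (Fin.natAdd k j))) then
    (Equiv.Perm.sign p : ℤ) • (η (fun i => e (p (Fin.cast h (Fin.castAdd m i)))) *
      τ (fun j => e (p (Fin.cast h (Fin.natAdd k j)))))
  else 0

theorem cup_eq_sum_shuffleTerm {k m : ℕ} (η : (Fin k → S) → A) (τ : (Fin m → S) → A)
    (e : Fin (k + m) → S) : cup η τ e = ∑ p, shuffleTerm rfl η τ e p := by
  classical
  rw [cup, shuffles, Finset.sum_filter]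
  refine Finset.sum_congr rfl fun p _ => ?_
  simp only [shuffleTerm, Fin.cast_refl, id_eq]

/-- The permutations summed here put the argument `e 0` into slot `a` of the first factor. A shuffle
is increasing on that block, so only `a = 0` contributes, and its cycle is the identity: no sign
appears. -/
theorem sum_shuffleTerm_left {k m n : ℕ} (h : k + m = n + 1) (η : (Fin k → S) → A)
    (τ : (Fin m → S) → A) (e : Fin (n + 1) → S) :
    ∑ a : Fin k, ∑ p : Equiv.Perm (Fin n), shuffleTerm h η τ e
        (Equiv.Perm.decomposeFin.symm (0, p) * (Fin.cast h (Fin.castAdd m a)).cycleRange) =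
      match k, h, η with
      | 0, _, _ => 0
      | k + 1, h, η => ∑ p, shuffleTerm (k := k) (m := m) (n := n) (by omega)
          (fun f => η (Fin.cons (e 0) f)) τ (fun i => e i.succ) p := by
  match k, h, η with
  | 0, _, _ => simp
  | k + 1, h, η =>
    rw [Fin.sum_univ_succ, add_eq_left.2]
    · refine Finset.sum_congr rfl fun p _ => ?_
      have h' : k + m = n := by omega
      have e0 : Fin.cast h (Fin.castAdd m (0 : Fin (k + 1))) = 0 := by ext; simp
      rw [e0, Fin.cycleRange_zero, mul_one]
      have es : ∀ a : Fin k, Fin.cast h (Fin.castAdd m a.succ) =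
          (Fin.cast h' (Fin.castAdd m a)).succ := fun a => by ext; simp
      have et : ∀ b : Fin m, Fin.cast h (Fin.natAdd (k + 1) b) =
          (Fin.cast h' (Fin.natAdd k b)).succ := fun a => by ext; simp; omega
      have v0 : (Equiv.Perm.decomposeFin.symm ((0 : Fin (n + 1)), p)) 0 = 0 := by simp
      have vs : ∀ j : Fin n, (Equiv.Perm.decomposeFin.symm ((0 : Fin (n + 1)), p)) j.succ =
        (p j).succ := fun j => by simp
      rw [shuffleTerm, shuffleTerm]
      congr 1
      · rw [strictMono_of_zero_succ (g := fun a : Fin k => p (Fin.cast h' (Fin.castAdd m a)))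
          (by rw [e0, v0]) (fun a => by rw [es, vs])]
        simp only [et, vs, strictMono_succ_comp]
      · have hη : (fun i : Fin (k + 1) => e ((Equiv.Perm.decomposeFin.symm ((0 : Fin (n + 1)), p))
            (Fin.cast h (Fin.castAdd m i)))) =
            Fin.cons (e 0) (fun i => e (p (Fin.cast h' (Fin.castAdd m i))).succ) := by
          funext i
          cases i using Fin.cases with
          | zero => rw [e0, v0, Fin.cons_zero]
          | succ i => rw [es, vs, Fin.cons_succ]
        rw [hη]
        simp only [et, vs]
        congr 2
        simp
    · refine Finset.sum_eq_zero fun a _ => Finset.sum_eq_zero fun p _ => if_neg fun hh => ?_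
      have hlt := hh.1 (Fin.succ_pos a)
      dsimp only at hlt
      rw [decomposeFin_cycleRange_self] at hlt
      exact Fin.not_lt_zero _ hlt

/-- Again only the first slot of the block can receive `e 0`. This is position `k` overall, and the
cycle that brings it to the front has sign `(-1)^k`, the sign produced by `grade` in the recursion.
-/
theorem sum_shuffleTerm_right {k m n : ℕ} (h : k + m = n + 1) (η : (Fin k → S) → A)
    (τ : (Fin m → S) → A) (e : Fin (n + 1) → S) :
    ∑ b : Fin m, ∑ p : Equiv.Perm (Fin n), shuffleTerm h η τ e
        (Equiv.Perm.decomposeFin.symm (0, p) * (Fin.cast h (Fin.natAdd k b)).cycleRange) =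
      match m, h, τ with
      | 0, _, _ => 0
      | m + 1, h, τ => (-1 : ℤ) ^ k • ∑ p, shuffleTerm (k := k) (m := m) (n := n) (by omega)
          η (fun f => τ (Fin.cons (e 0) f)) (fun i => e i.succ) p := by
  match m, h, τ with
  | 0, _, _ => simp
  | m + 1, h, τ =>
    rw [Fin.sum_univ_succ, add_eq_left.2]
    · dsimp only
      rw [Finset.smul_sum]
      refine Finset.sum_congr rfl fun p _ => ?_
      have h' : k + m = n := by omega
      set i := Fin.cast h (Fin.natAdd k (0 : Fin (m + 1))) with hi
      have es : ∀ a : Fin k, Fin.cast h (Fin.castAdd (m + 1) a) =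
          i.succAbove (Fin.cast h' (Fin.castAdd m a)) := fun a => by
        rw [Fin.succAbove_of_castSucc_lt]
        · ext; simp
        · simp [hi, Fin.lt_def]
      have et : ∀ b : Fin m, Fin.cast h (Fin.natAdd k b.succ) =
          i.succAbove (Fin.cast h' (Fin.natAdd k b)) := fun b => by
        rw [Fin.succAbove_of_le_castSucc]
        · ext; simp; omega
        · simp [hi, Fin.le_def]
      have v0 := decomposeFin_cycleRange_self i p
      have vs := decomposeFin_cycleRange_succAbove i p
      rw [shuffleTerm, shuffleTerm, smul_ite, smul_zero]
      congr 1
      · rw [strictMono_of_zero_succ (g := fun b : Fin m => p (Fin.cast h' (Fin.natAdd k b)))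
          v0 (fun b => by rw [et, vs])]
        simp only [es, vs, strictMono_succ_comp]
      · have hτ : (fun j : Fin (m + 1) => e ((Equiv.Perm.decomposeFin.symm ((0 : Fin (n + 1)), p) *
            i.cycleRange : Equiv.Perm (Fin (n + 1))) (Fin.cast h (Fin.natAdd k j)))) =
            Fin.cons (e 0) (fun j => e (p (Fin.cast h' (Fin.natAdd k j))).succ) := by
          funext j
          cases j using Fin.cases with
          | zero => rw [← hi, v0, Fin.cons_zero]
          | succ j => rw [et, vs, Fin.cons_succ]
        rw [hτ]
        simp only [es, vs, smul_smul]
        congr 1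
        have hk : ((i : Fin (n + 1)) : ℕ) = k := by simp [hi]
        rw [Equiv.Perm.sign_mul, Fin.sign_cycleRange, hk]
        simp [mul_comm]
    · refine Finset.sum_eq_zero fun a _ => Finset.sum_eq_zero fun p _ => if_neg fun hh => ?_
      have hlt := hh.2 (Fin.succ_pos a)
      dsimp only at hlt
      rw [decomposeFin_cycleRange_self] at hlt
      exact Fin.not_lt_zero _ hlt

/-- Permutations are sorted by the slot that receives `e 0`, which lies in the first or in the
second block. -/
theorem sum_shuffleTerm_succ {k m n : ℕ} (h : k + m = n + 1) (η : (Fin k → S) → A)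
    (τ : (Fin m → S) → A) (e : Fin (n + 1) → S) :
    ∑ p, shuffleTerm h η τ e p =
      (∑ a : Fin k, ∑ p : Equiv.Perm (Fin n), shuffleTerm h η τ e
        (Equiv.Perm.decomposeFin.symm (0, p) * (Fin.cast h (Fin.castAdd m a)).cycleRange)) +
      ∑ b : Fin m, ∑ p : Equiv.Perm (Fin n), shuffleTerm h η τ e
        (Equiv.Perm.decomposeFin.symm (0, p) * (Fin.cast h (Fin.natAdd k b)).cycleRange) := by
  rw [← Fin.sum_univ_add (fun i : Fin (k + m) => ∑ p : Equiv.Perm (Fin n), shuffleTerm h η τ e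
        (Equiv.Perm.decomposeFin.symm (0, p) * (Fin.cast h i).cycleRange)),
    Fin.sum_congr' (fun i : Fin (n + 1) => ∑ p : Equiv.Perm (Fin n), shuffleTerm h η τ e
        (Equiv.Perm.decomposeFin.symm (0, p) * i.cycleRange)) h, ← Fintype.sum_prod_type']
  exact (Function.Bijective.sum_comp (bijective_perm_cycleRange n) _).symm

/-- Induction on the number of arguments: the two blocks that may receive `e 0` correspond to the
two summands of `mul_cons`. -/
theorem sum_shuffleTerm {k m n : ℕ} (h : k + m = n) {φ ψ : ListCochain S A}
    (hφ : Homogeneous k φ) (hψ : Homogeneous m ψ) (e : Fin n → S) :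
    ∑ p, shuffleTerm h (fun f => φ (List.ofFn f)) (fun f => ψ (List.ofFn f)) e p =
      (φ * ψ) (List.ofFn e) := by
  induction n generalizing k m φ ψ with
  | zero =>
    obtain ⟨rfl, rfl⟩ : k = 0 ∧ m = 0 := by omega
    rw [Fintype.sum_unique, shuffleTerm, if_pos ⟨Subsingleton.strictMono _,
      Subsingleton.strictMono _⟩]
    simp [Subsingleton.elim (default : Equiv.Perm (Fin 0)) 1]
  | succ n ih =>
    rw [sum_shuffleTerm_succ, sum_shuffleTerm_left, sum_shuffleTerm_right, List.ofFn_succ, mul_cons]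
    congr 1
    · match k, h, hφ with
      | 0, h, hφ => rw [hφ.contract_zero, zero_mul, zero_apply]
      | k + 1, h, hφ =>
        rw [← ih (by omega) (hφ.contract (e 0)) hψ]
        simp only [contract_apply, List.ofFn_cons]
    · match m, h, hψ with
      | 0, h, hψ => rw [hψ.contract_zero, mul_zero, zero_apply]
      | m + 1, h, hψ =>
        rw [hφ.grade_eq, smul_mul_assoc, smul_apply, ← ih (by omega) hφ (hψ.contract (e 0))]
        simp only [contract_apply, List.ofFn_cons]

/-- The shuffle product of homogeneous cochains is the sum over shuffles. -/
theorem cup_ofFn {k m : ℕ} {φ ψ : ListCochain S A} (hφ : Homogeneous k φ) (hψ : Homogeneous m ψ)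
    (e : Fin (k + m) → S) :
    cup (fun f : Fin k → S => φ (List.ofFn f)) (fun f : Fin m → S => ψ (List.ofFn f)) e =
      (φ * ψ) (List.ofFn e) :=
  (cup_eq_sum_shuffleTerm _ _ e).trans (sum_shuffleTerm rfl hφ hψ e)

end Shuffles
end Ring

/-! ### Symbols and linearity in the last entry -/

section Symbol

/-- `σ` is a symbol of `φ` with respect to the pairing `p`. -/
def HasSymbol [AddCommGroup A] (p : S → S → K) (φ : ListCochain S A) (σ : K → ListCochain S A) :
    Prop :=
  ∀ l₁ a b l₂, φ (l₁ ++ a :: b :: l₂) + φ (l₁ ++ b :: a :: l₂) = σ (p a b) (l₁ ++ l₂)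

section Group

variable [AddCommGroup A] {p : S → S → K} {φ : ListCochain S A} {σ : K → ListCochain S A}

theorem HasSymbol.contract (h : HasSymbol p φ σ) (e : S) :
    HasSymbol p (contract e φ) fun f => contract e (σ f) :=
  fun l₁ a b l₂ => h (e :: l₁) a b l₂

/-- The symbol takes two arguments fewer, so its grading sign is the same. -/
theorem HasSymbol.grade (h : HasSymbol p φ σ) :
    HasSymbol p (grade φ) fun f => grade (σ f) := fun l₁ a b l₂ => by
  simp only [grade_apply, List.length_append, List.length_cons]
  rw [← h, smul_add, ← add_assoc, ← add_assoc, pow_succ, pow_succ]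
  simp

theorem HasSymbol.mapVal {A' : Type*} [AddCommGroup A'] (T : A →+ A') (h : HasSymbol p φ σ) :
    HasSymbol p (mapVal T φ) fun f => mapVal T (σ f) := fun l₁ a b l₂ => by
  simp only [mapVal_apply, ← map_add, h l₁ a b l₂]

theorem HasSymbol.contract_contract (h : HasSymbol p φ σ) (a b : S) :
    ListCochain.contract b (ListCochain.contract a φ) +
      ListCochain.contract a (ListCochain.contract b φ) = σ (p a b) :=
  ext fun l => h [] a b l

/-- Arguments before the transposed pair are removed by contraction, which leaves the transposition
of the first two entries. -/
theorem HasSymbol.ofFn (h : HasSymbol p φ σ) {n : ℕ} (e : Fin (n + 2) → S) (i : Fin (n + 1)) :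
    φ (List.ofFn e) + φ (List.ofFn fun j => e (Equiv.swap i.castSucc i.succ j)) =
      σ (p (e i.castSucc) (e i.succ))
        (List.ofFn fun j => e (i.castSucc.succAbove (i.succAbove j))) := by
  induction n generalizing φ σ with
  | zero =>
    obtain rfl : i = 0 := Fin.fin_one_eq_zero i
    simpa using h [] (e 0) (e 1) []
  | succ n ih =>
    cases i using Fin.cases with
    | zero =>
      have h1 := h [] (e 0) (e 1) (List.ofFn fun j : Fin (n + 1) => e j.succ.succ)
      have hs : ∀ j : Fin (n + 1), Equiv.swap (0 : Fin (n + 3)) 1 j.succ.succ = j.succ.succ :=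
        fun j => Equiv.swap_apply_of_ne_of_ne (Fin.succ_ne_zero _)
          fun hj => Fin.succ_ne_zero j (Fin.succ_injective _ hj)
      have h2 : List.ofFn e = e 0 :: e 1 :: List.ofFn fun j : Fin (n + 1) => e j.succ.succ := by
        rw [List.ofFn_succ, List.ofFn_succ]; rfl
      have h3 : (List.ofFn fun j => e (Equiv.swap (0 : Fin (n + 3)) 1 j)) =
          e 1 :: e 0 :: List.ofFn fun j : Fin (n + 1) => e j.succ.succ := by
        rw [List.ofFn_succ, List.ofFn_succ]
        simp only [hs, Equiv.swap_apply_left]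
        congr 2
      have h4 : (fun j : Fin (n + 1) => e ((Fin.castSucc (0 : Fin (n + 2))).succAbove
          ((0 : Fin (n + 2)).succAbove j))) = fun j => e j.succ.succ := by
        funext j; simp
      rw [h4, h2]
      exact (congrArg _ (congrArg φ h3)).trans h1
    | succ i =>
      have h1 := ih (h.contract (e 0)) (fun j => e j.succ) i
      simp only [contract_apply] at h1
      have hs : ∀ j : Fin (n + 2), Equiv.swap i.succ.castSucc i.succ.succ j.succ =
          (Equiv.swap i.castSucc i.succ j).succ := fun j => by
        exact (Fin.succ_injective _).swap_apply i.castSucc i.succ j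
      have h0 : Equiv.swap i.succ.castSucc i.succ.succ 0 = 0 :=
        Equiv.swap_apply_of_ne_of_ne (by rw [← Fin.succ_castSucc]; exact (Fin.succ_ne_zero _).symm)
          (Fin.succ_ne_zero _).symm
      rw [List.ofFn_succ (f := e), List.ofFn_succ (f := fun j => e (Equiv.swap _ _ j)),
        List.ofFn_succ (f := fun j => e (i.succ.castSucc.succAbove (i.succ.succAbove j)))]
      rw [h0]
      simp only [hs]
      simp only [← Fin.succ_castSucc, Fin.succ_succAbove_zero, Fin.succ_succAbove_succ]
      exact h1

end Group

/-- Symbols have even degree, so they multiply by the Leibniz rule without signs. If the two swapped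
arguments go to different factors, the two orders contribute with opposite signs and cancel; if both
go to the same factor, its symbol appears. -/
theorem HasSymbol.mul [Ring A] {p : S → S → K} {φ ψ : ListCochain S A} {σ τ : K → ListCochain S A}
    (hφ : HasSymbol p φ σ) (hψ : HasSymbol p ψ τ) :
    HasSymbol p (φ * ψ) fun f => σ f * ψ + φ * τ f := by
  intro l₁
  induction l₁ generalizing φ ψ σ τ with
  | nil =>
    intro a b l
    simp only [List.nil_append]
    -- The symbol is the anticommutator of two contractions, and the anticommutator of odd
    -- derivations is a derivation.
    rw [← hφ.contract_contract, ← hψ.contract_contract]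
    simp only [← contract_apply, contract_mul, contract_grade, map_add, add_mul,
      mul_add, neg_mul, grade_grade, add_apply, neg_apply]
    abel
  | cons c l₁ ih =>
    intro a b l
    have h1 := ih (hφ.contract c) hψ a b l
    have h2 := ih hφ.grade (hψ.contract c) a b l
    simp only [List.cons_append, add_apply, mul_cons] at h1 h2 ⊢
    rw [add_add_add_comm, h1, h2]
    abel

/-- Linearity in the last entry. -/
def LinearLast [CommRing K] [AddCommGroup S] [Module K S] [AddCommGroup A] [Module K A]
    (φ : ListCochain S A) : Prop :=
  (∀ l a b, φ (l ++ [a + b]) = φ (l ++ [a]) + φ (l ++ [b])) ∧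
  ∀ l (f : K) a, φ (l ++ [f • a]) = f • φ (l ++ [a])

section Last

variable [CommRing K] [AddCommGroup S] [Module K S]

section

variable [AddCommGroup A] [Module K A] {φ : ListCochain S A}

theorem LinearLast.contract (h : LinearLast (K := K) φ) (e : S) :
    LinearLast (K := K) (contract e φ) :=
  ⟨fun l => h.1 (e :: l), fun l => h.2 (e :: l)⟩

theorem LinearLast.grade (h : LinearLast (K := K) φ) : LinearLast (K := K) (grade φ) := by
  constructor
  · intro l a b
    simp only [grade_apply, h.1, List.length_append, List.length_singleton, smul_add]
  · intro l f a
    simp only [grade_apply, h.2, List.length_append, List.length_singleton]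
    rw [smul_comm]

theorem LinearLast.mapVal {A' : Type*} [AddCommGroup A'] [Module K A'] (T : A →ₗ[K] A')
    (h : LinearLast (K := K) φ) : LinearLast (K := K) (mapVal T.toAddMonoidHom φ) := by
  constructor
  · intro l a b
    simp [h.1]
  · intro l f a
    simp [h.2]

end

/-- Shuffles preserve the order within each factor, so the last argument is always the last entry of
the factor that receives it. -/
theorem LinearLast.mul [Ring A] [Algebra K A] {φ ψ : ListCochain S A}
    (hφ : LinearLast (K := K) φ) (hψ : LinearLast (K := K) ψ) : LinearLast (K := K) (φ * ψ) := by
  have h1 : ∀ (l : List S) (φ ψ : ListCochain S A), LinearLast (K := K) φ → LinearLast (K := K) ψ →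
      ∀ a b, (φ * ψ) (l ++ [a + b]) = (φ * ψ) (l ++ [a]) + (φ * ψ) (l ++ [b]) := by
    intro l
    induction l with
    | nil =>
      intro φ ψ hφ hψ a b
      have e1 := hφ.1 [] a b
      have e2 := hψ.1 [] a b
      simp only [List.nil_append] at e1 e2
      simp only [List.nil_append, mul_cons, mul_nil, contract_apply, grade_nil, e1, e2, add_mul,
        mul_add]
      abel
    | cons c l ih =>
      intro φ ψ hφ hψ a b
      simp only [List.cons_append, mul_cons, ih _ _ (hφ.contract c) hψ, ih _ _ hφ.grade
        (hψ.contract c)]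
      abel
  have h2 : ∀ (l : List S) (φ ψ : ListCochain S A), LinearLast (K := K) φ → LinearLast (K := K) ψ →
      ∀ (f : K) a, (φ * ψ) (l ++ [f • a]) = f • (φ * ψ) (l ++ [a]) := by
    intro l
    induction l with
    | nil =>
      intro φ ψ hφ hψ f a
      have e1 := hφ.2 [] f a
      have e2 := hψ.2 [] f a
      simp only [List.nil_append] at e1 e2
      simp only [List.nil_append, mul_cons, mul_nil, contract_apply, grade_nil, e1, e2,
        smul_mul_assoc, mul_smul_comm, smul_add]
    | cons c l ih =>
      intro φ ψ hφ hψ f a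
      simp only [List.cons_append, mul_cons, ih _ _ (hφ.contract c) hψ, ih _ _ hφ.grade
        (hψ.contract c), smul_add]
  exact ⟨fun l => h1 l φ ψ hφ hψ, fun l => h2 l φ ψ hφ hψ⟩

end Last
end Symbol

end ListCochain
-- The recursive differential and the explicit formula for `d_E`
namespace ListCochain

variable {S A : Type*} [AddCommGroup A] (br : S → S → S) (δ : S → A →+ A)

theorem lie_ofFn {n : ℕ} (a : S) (φ : ListCochain S A) (e : Fin n → S) :
    lie br δ a φ (List.ofFn e) = δ a (φ (List.ofFn e)) -
      ∑ j, φ (List.ofFn (Function.update e j (br a (e j)))) := by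
  induction n generalizing φ with
  | zero => simp [lie_nil]
  | succ n ih =>
    have h0 : List.ofFn (Function.update e 0 (br a (e 0))) =
        br a (e 0) :: List.ofFn fun j => e j.succ := by
      rw [List.ofFn_succ]
      simp [Function.update_of_ne]
    have hs : ∀ j : Fin n, List.ofFn (Function.update e j.succ (br a (e j.succ))) =
        e 0 :: List.ofFn (Function.update (fun j => e j.succ) j (br a (e j.succ))) := fun j => by
      rw [List.ofFn_succ, Function.update_of_ne (Fin.succ_ne_zero j).symm]
      congr 2
      funext i
      exact Function.update_apply_of_injective e (Fin.succ_injective n) j _ i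
    rw [List.ofFn_succ, ← contract_apply, contract_lie, sub_apply, ih, Fin.sum_univ_succ, h0]
    simp only [hs, contract_apply]
    abel

/-- Unrolling `ι_e d = L_e - d ι_e`: the Lie derivative supplies all terms with `i = 0`, and the
remaining ones come from the contracted cochain with indices shifted by one, which accounts for the
sign `(-1)^i`. -/
theorem diff_ofFn {n : ℕ} (φ : ListCochain S A) (e : Fin (n + 1) → S) :
    diff br δ φ (List.ofFn e) =
      ∑ i : Fin (n + 1), (-1 : ℤ) ^ (i : ℕ) • δ (e i) (φ (List.ofFn fun k => e (i.succAbove k))) -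
      ∑ i : Fin (n + 1), ∑ j ∈ Finset.Ioi i, (-1 : ℤ) ^ (i : ℕ) •
        φ (List.ofFn fun k => Function.update e j (br (e i) (e j)) (i.succAbove k)) := by
  induction n generalizing φ with
  | zero =>
    have h : ∀ i : Fin 1, Finset.Ioi i = ∅ := by decide
    rw [List.ofFn_succ, ← contract_apply, contract_diff]
    simp [h, lie_nil]
  | succ n ih =>
    have h0 : ∀ j : Fin (n + 1), (fun k => Function.update e j.succ (br (e 0) (e j.succ)) k.succ) =
        Function.update (fun k => e k.succ) j (br (e 0) (e j.succ)) := fun j => by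
      funext k
      exact Function.update_apply_of_injective e (Fin.succ_injective _) j _ k
    have hs : ∀ (i j : Fin (n + 1)), (List.ofFn fun k => Function.update e j.succ
        (br (e i.succ) (e j.succ)) (i.succ.succAbove k)) =
        e 0 :: List.ofFn fun k => Function.update (fun k => e k.succ) j (br (e i.succ) (e j.succ))
          (i.succAbove k) := fun i j => by
      rw [List.ofFn_succ, Fin.succ_succAbove_zero, Function.update_of_ne (Fin.succ_ne_zero j).symm]
      congr 2
      funext k
      rw [Fin.succ_succAbove_succ]
      exact Function.update_apply_of_injective e (Fin.succ_injective _) j _ _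
    have hs' : ∀ i : Fin (n + 1), (List.ofFn fun k => e (i.succ.succAbove k)) =
        e 0 :: List.ofFn fun k => e (i.succAbove k).succ := fun i => by
      rw [List.ofFn_succ, Fin.succ_succAbove_zero]
      simp only [Fin.succ_succAbove_succ]
    have hI : Finset.Ioi (0 : Fin (n + 2)) = Finset.univ.map (Fin.succEmb (n + 1)) := by
      ext j
      cases j using Fin.cases <;> simp
    rw [List.ofFn_succ, ← contract_apply, contract_diff, sub_apply, ih, lie_ofFn,
      Fin.sum_univ_succ (n := n + 1) fun i => (-1 : ℤ) ^ (i : ℕ) • δ (e i) _,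
      Fin.sum_univ_succ (n := n + 1) fun i => ∑ j ∈ Finset.Ioi i, (-1 : ℤ) ^ (i : ℕ) • φ _,
      hI, Finset.sum_map]
    simp only [← Fin.map_succEmb_Ioi, Finset.sum_map, Fin.coe_succEmb, hs, hs', h0, Fin.val_succ,
      pow_succ, mul_neg_one, neg_smul, Finset.sum_neg_distrib, Fin.val_zero, pow_zero, one_smul,
      Fin.zero_succAbove, contract_apply]
    abel

end ListCochain

section Courant

open ListCochain

variable {EM HM M : Type*} [NormedAddCommGroup EM] [NormedSpace ℝ EM]
  [TopologicalSpace HM] {I : ModelWithCorners ℝ EM HM} [TopologicalSpace M] [ChartedSpace HM M]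
  [IsManifold I ∞ M]
  {F : Type*} [NormedAddCommGroup F] [NormedSpace ℝ F]
  {E : M → Type*} [TopologicalSpace (TotalSpace F E)] [∀ x, TopologicalSpace (E x)]
  [FiberBundle F E] [∀ x, AddCommGroup (E x)] [∀ x, Module ℝ (E x)] [VectorBundle ℝ F E]

theorem CourantAlgebroid.d_ofFn (𝒞 : CourantAlgebroid I F E) (n : ℕ)
    (φ : ListCochain Cₛ^∞⟮I; F, E⟯ C^∞⟮I, M; ℝ⟯) :
    𝒞.d n (fun e => φ (List.ofFn e)) = fun e => diff (fun a b => 𝒞.bracket a b)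
      (fun a => (𝒞.anchor.der a).toLinearMap.toAddMonoidHom) φ (List.ofFn e) := by
  funext e
  -- The signs in `d` are real scalars, those of list cochains are integers.
  have hz : ∀ (n : ℕ) (f : C^∞⟮I, M; ℝ⟯), (-1 : ℝ) ^ n • f = (-1 : ℤ) ^ n • f := fun n f => by
    rcases neg_one_pow_eq_or ℝ n with h | h <;> rcases Nat.even_or_odd n with h' | h' <;>
      simp [h'.neg_one_pow]
  rw [diff_ofFn]
  simp only [← hz]
  rfl

theorem linearInLast_ofFn {φ : ListCochain Cₛ^∞⟮I; F, E⟯ C^∞⟮I, M; ℝ⟯}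
    (h : LinearLast (K := C^∞⟮I, M; ℝ⟯) φ) (n : ℕ) :
    LinearInLast (n := n) fun e : Fin (n + 1) → Cₛ^∞⟮I; F, E⟯ => φ (List.ofFn e) := by
  have key : ∀ (e : Fin (n + 1) → Cₛ^∞⟮I; F, E⟯) s,
      List.ofFn (Function.update e (Fin.last n) s) = List.ofFn (fun i : Fin n => e i.castSucc) ++ [s] := by
    intro e s
    rw [List.ofFn_succ']
    simp [Function.update_of_ne, Fin.castSucc_ne_last]
  constructor
  · intro e s t
    simp only [key, h.1]
  · intro e f s
    simp only [key, h.2, smul_eq_mul]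

theorem isSymbol_ofFn (g : BundlePairing I F E) {φ : ListCochain Cₛ^∞⟮I; F, E⟯ C^∞⟮I, M; ℝ⟯}
    {σ : List Cₛ^∞⟮I; F, E⟯ → Derivation ℝ C^∞⟮I, M; ℝ⟯ C^∞⟮I, M; ℝ⟯}
    (h : HasSymbol g.pair φ fun f => ⟨fun l => σ l f⟩) (n : ℕ) :
    IsSymbol g (n := n) (fun e => φ (List.ofFn e)) fun e => σ (List.ofFn e) :=
  fun e i => h.ofFn e i

theorem isCochain_ofFn (g : BundlePairing I F E) {φ : ListCochain Cₛ^∞⟮I; F, E⟯ C^∞⟮I, M; ℝ⟯}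
    {σ : List Cₛ^∞⟮I; F, E⟯ → Derivation ℝ C^∞⟮I, M; ℝ⟯ C^∞⟮I, M; ℝ⟯}
    (hl : LinearLast (K := C^∞⟮I, M; ℝ⟯) φ) (h : HasSymbol g.pair φ fun f => ⟨fun l => σ l f⟩)
    (n : ℕ) : (fun e : Fin n → Cₛ^∞⟮I; F, E⟯ => φ (List.ofFn e)) ∈ cochains g n := by
  match n with
  | 0 => trivial
  | 1 => exact linearInLast_ofFn hl 0
  | n + 2 => exact ⟨linearInLast_ofFn hl (n + 1), _, isSymbol_ofFn g h n⟩

end Courant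
-- Smooth dependence of integrals on parameters
section ParametricIntegral

open MeasureTheory

variable {V : Type*} [NormedAddCommGroup V] [NormedSpace ℝ V] {G : Type*} [NormedAddCommGroup G]
  [NormedSpace ℝ G]

/-- The derivative of `f : ℝ × V → G` in the second variable. -/
noncomputable def partialSnd (f : ℝ × V → G) (U : Set V) (p : ℝ × V) : V →L[ℝ] G :=
  (fderivWithin ℝ f (Icc 0 1 ×ˢ U) p).comp (ContinuousLinearMap.inr ℝ ℝ V)

variable {f : ℝ × V → G} {U : Set V}

theorem contDiffOn_partialSnd (hU : IsOpen U) (hf : ContDiffOn ℝ ∞ f (Icc 0 1 ×ˢ U)) :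
    ContDiffOn ℝ ∞ (partialSnd f U) (Icc 0 1 ×ˢ U) :=
  (hf.fderivWithin ((uniqueDiffOn_Icc zero_lt_one).prod hU.uniqueDiffOn) (by simp)).clm_comp
    contDiffOn_const

theorem hasFDerivAt_partialSnd (hU : IsOpen U) (hf : ContDiffOn ℝ ∞ f (Icc 0 1 ×ˢ U)) {t : ℝ}
    (ht : t ∈ Icc (0 : ℝ) 1) {u : V} (hu : u ∈ U) :
    HasFDerivAt (fun v => f (t, v)) (partialSnd f U (t, u)) u := by
  have h1 := ((hf.differentiableOn (by simp)) (t, u) ⟨ht, hu⟩).hasFDerivWithinAt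
  have h2 : HasFDerivWithinAt (fun v : V => (t, v)) (ContinuousLinearMap.inr ℝ ℝ V) U u :=
    (hasFDerivAt_prodMk_right t u).hasFDerivWithinAt
  exact (h1.comp u h2 fun v hv => ⟨ht, hv⟩).hasFDerivAt (hU.mem_nhds hu)

theorem uIoc_subset_unit {r : ℝ} (hr : r ∈ Icc (0 : ℝ) 1) : uIoc 0 r ⊆ Icc 0 1 := by
  rw [uIoc_of_le hr.1]
  exact fun t ht => ⟨ht.1.le, ht.2.trans hr.2⟩

theorem continuousOn_slice {X : Type*} [TopologicalSpace X] {f : ℝ × V → X}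
    (hf : ContinuousOn f (Icc 0 1 ×ˢ U)) {u : V} (hu : u ∈ U) :
    ContinuousOn (fun t => f (t, u)) (Icc 0 1) :=
  hf.comp (by fun_prop) fun _ ht => ⟨ht, hu⟩

theorem intervalIntegrable_slice {f : ℝ × V → G} (hf : ContinuousOn f (Icc 0 1 ×ˢ U)) {u : V}
    (hu : u ∈ U) {r : ℝ} (hr : r ∈ Icc (0 : ℝ) 1) :
    IntervalIntegrable (fun t => f (t, u)) volume 0 r := by
  refine ((continuousOn_slice hf hu).mono ?_).intervalIntegrable
  rw [uIcc_of_le hr.1]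
  exact Icc_subset_Icc_right hr.2

variable [FiniteDimensional ℝ V]

theorem hasFDerivAt_integral_partialSnd [CompleteSpace G] (hU : IsOpen U)
    (hf : ContDiffOn ℝ ∞ f (Icc 0 1 ×ˢ U)) {r : ℝ} (hr : r ∈ Icc (0 : ℝ) 1) {u : V} (hu : u ∈ U) :
    HasFDerivAt (fun v => ∫ t in 0..r, f (t, v)) (∫ t in 0..r, partialSnd f U (t, u)) u := by
  have hc := hf.continuousOn
  have hp := (contDiffOn_partialSnd hU hf).continuousOn
  have : ProperSpace V := FiniteDimensional.proper ℝ V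
  obtain ⟨ε, hε, hK⟩ := Metric.nhds_basis_closedBall.mem_iff.1 (hU.mem_nhds hu)
  -- The dominating function is a constant: the partial derivative is continuous on the compact set
  -- `[0,1] × closedBall u ε`.
  obtain ⟨C, hC⟩ := (isCompact_Icc.prod (isCompact_closedBall u ε)).exists_bound_of_continuousOn
    (hp.mono (prod_mono_right hK))
  refine intervalIntegral.hasFDerivAt_integral_of_dominated_of_fderiv_le
    (bound := fun _ => C) (F := fun v t => f (t, v)) (F' := fun v t => partialSnd f U (t, v))
    (Metric.closedBall_mem_nhds u hε) ?_ ?_ ?_ ?_ ?_ ?_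
  · filter_upwards [hU.mem_nhds hu] with v hv
    exact (continuousOn_slice hc hv).aestronglyMeasurable_of_subset_isCompact isCompact_Icc
      measurableSet_uIoc (uIoc_subset_unit hr)
  · exact intervalIntegrable_slice hc hu hr
  · exact (continuousOn_slice hp hu).aestronglyMeasurable_of_subset_isCompact isCompact_Icc
      measurableSet_uIoc (uIoc_subset_unit hr)
  · exact Filter.Eventually.of_forall fun t ht v hv => hC (t, v) ⟨uIoc_subset_unit hr ht, hv⟩
  · exact intervalIntegrable_const
  · exact Filter.Eventually.of_forall fun t ht v hv =>
      hasFDerivAt_partialSnd hU hf (uIoc_subset_unit hr ht) (hK hv)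

/-- Induction on the order of differentiability. The derivative of the integral is the integral of
the partial derivative; evaluation at a vector `y` makes this a real-valued integral of the same
kind. -/
theorem contDiffOn_integral {f : ℝ × V → ℝ} (hU : IsOpen U)
    (hf : ContDiffOn ℝ ∞ f (Icc 0 1 ×ˢ U)) {r : ℝ} (hr : r ∈ Icc (0 : ℝ) 1) :
    ContDiffOn ℝ ∞ (fun v => ∫ t in 0..r, f (t, v)) U := by
  rw [contDiffOn_infty]
  intro n
  induction n generalizing f with
  | zero =>
    rw [Nat.cast_zero, contDiffOn_zero]
    exact fun u hu => (hasFDerivAt_integral_partialSnd hU hf hr hu).continuousAt.continuousWithinAt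
  | succ n ih =>
    rw [Nat.cast_succ, contDiffOn_succ_iff_fderiv_of_isOpen hU]
    refine ⟨fun u hu => (hasFDerivAt_integral_partialSnd hU hf
      hr hu).differentiableAt.differentiableWithinAt, by simp, ?_⟩
    rw [contDiffOn_clm_apply]
    intro y
    refine (ih (f := fun p => partialSnd f U p y)
      ((contDiffOn_partialSnd hU hf).clm_apply contDiffOn_const)).congr fun u hu => ?_
    rw [(hasFDerivAt_integral_partialSnd hU hf hr hu).fderiv]
    exact (ContinuousLinearMap.intervalIntegral_apply
      (intervalIntegrable_slice (contDiffOn_partialSnd hU hf).continuousOn hu hr) y)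

end ParametricIntegral

/-! ### Smooth families of functions and their time derivatives -/

section Families

open MeasureTheory

variable {EM HM M : Type*} [NormedAddCommGroup EM] [NormedSpace ℝ EM]
  [TopologicalSpace HM] {I : ModelWithCorners ℝ EM HM} [TopologicalSpace M] [ChartedSpace HM M]

/-- A family of functions `g t`, `0 ≤ t ≤ 1`, that is smooth in `(t, x) ∈ [0, 1] × M`. -/
def IsSmoothFamily (g : unitInterval → C^∞⟮I, M; ℝ⟯) : Prop :=
  ContMDiffOn (𝓘(ℝ, ℝ).prod I) 𝓘(ℝ, ℝ) ∞
    (fun p : ℝ × M => g (projIcc 0 1 zero_le_one p.1) p.2) (Icc 0 1 ×ˢ univ)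

variable {g h : unitInterval → C^∞⟮I, M; ℝ⟯}

theorem IsSmoothFamily.const (f : C^∞⟮I, M; ℝ⟯) : IsSmoothFamily fun _ => f :=
  (f.contMDiff.comp contMDiff_snd).contMDiffOn

theorem IsSmoothFamily.add (hg : IsSmoothFamily g) (hh : IsSmoothFamily h) :
    IsSmoothFamily fun t => g t + h t := ContMDiffOn.add hg hh

theorem IsSmoothFamily.mul (hg : IsSmoothFamily g) (hh : IsSmoothFamily h) :
    IsSmoothFamily fun t => g t * h t := ContMDiffOn.mul hg hh

theorem IsSmoothFamily.const_mul (f : C^∞⟮I, M; ℝ⟯) (hg : IsSmoothFamily g) :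
    IsSmoothFamily fun t => f * g t := (IsSmoothFamily.const f).mul hg

theorem IsSmoothFamily.neg (hg : IsSmoothFamily g) : IsSmoothFamily fun t => -g t := by
  simpa using hg.const_mul (-1)

theorem IsSmoothFamily.sum {ι : Type*} {g : ι → unitInterval → C^∞⟮I, M; ℝ⟯} (s : Finset ι)
    (hg : ∀ i, IsSmoothFamily (g i)) : IsSmoothFamily fun t => ∑ i ∈ s, g i t := by
  classical
  induction s using Finset.induction_on with
  | empty => simpa using IsSmoothFamily.const (0 : C^∞⟮I, M; ℝ⟯)
  | insert i s hi ih => simpa [Finset.sum_insert hi] using (hg i).add ih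

theorem IsSmoothFamily.of_local (hg : ∀ x : M, ∃ φ : C^∞⟮I, M; ℝ⟯, (∀ᶠ y in 𝓝 x, φ y = 1) ∧
    IsSmoothFamily fun t => φ * g t) : IsSmoothFamily g := by
  rintro ⟨t, x⟩ hp
  obtain ⟨φ, hφ, h⟩ := hg x
  have h1 : ∀ᶠ p : ℝ × M in 𝓝 (t, x), φ p.2 = 1 := (continuous_snd.tendsto (t, x)).eventually hφ
  refine (h (t, x) hp).congr_of_eventuallyEq ?_ ?_
  · filter_upwards [mem_nhdsWithin_of_mem_nhds h1] with p hp
    change _ = φ p.2 * _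
    rw [hp, one_mul]
  · change _ = φ x * _
    rw [hφ.self_of_nhds, one_mul]

theorem IsSmoothFamily.continuousOn (hg : IsSmoothFamily g) (x : M) :
    ContinuousOn (fun t : ℝ => g (projIcc 0 1 zero_le_one t) x) (Icc 0 1) :=
  (ContMDiffOn.continuousOn hg).comp (f := fun t : ℝ => (t, x)) (by fun_prop)
    fun _ ht => ⟨ht, mem_univ _⟩

/-- Clamping the time by `projIcc` gives continuity on all of `ℝ`, hence integrability over every
interval. -/
theorem IsSmoothFamily.continuous (hg : IsSmoothFamily g) (x : M) :
    Continuous fun t : ℝ => g (projIcc 0 1 zero_le_one t) x := by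
  have h1 := (hg.continuousOn x).domRestrict
  have h2 := h1.comp (continuous_projIcc (a := (0 : ℝ)) (b := 1) (h := zero_le_one))
  refine h2.congr fun t => ?_
  simp [projIcc_val]

variable [IsManifold I ∞ M]

theorem uniqueMDiffOn_unit_prod :
    UniqueMDiffOn (𝓘(ℝ, ℝ).prod I) (Icc (0 : ℝ) 1 ×ˢ (univ : Set M)) :=
  (uniqueDiffOn_Icc zero_lt_one).uniqueMDiffOn.prod uniqueMDiffOn_univ

/-- The derivative of a smooth family along a smooth vector field on `ℝ × M`. -/
theorem IsSmoothFamily.contMDiffOn_mfderivWithin (hg : IsSmoothFamily g)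
    {a : ℝ → ℝ} (ha : ContMDiff 𝓘(ℝ, ℝ) (𝓘(ℝ, ℝ).prod 𝓘(ℝ, ℝ)) ∞
      fun t => (⟨t, a t⟩ : TangentBundle 𝓘(ℝ, ℝ) ℝ))
    {X : ∀ x : M, TangentSpace I x}
    (hX : ContMDiff I (I.prod 𝓘(ℝ, EM)) ∞ fun x => (⟨x, X x⟩ : TangentBundle I M)) :
    ContMDiffOn (𝓘(ℝ, ℝ).prod I) 𝓘(ℝ, ℝ) ∞ (fun p : ℝ × M =>
      (mfderivWithin (𝓘(ℝ, ℝ).prod I) 𝓘(ℝ, ℝ)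
        (fun p : ℝ × M => g (projIcc 0 1 zero_le_one p.1) p.2) (Icc 0 1 ×ˢ univ) p
        ((a p.1, X p.2) : ℝ × EM) : ℝ)) (Icc 0 1 ×ˢ univ) := by
  have h1 : ContMDiff (𝓘(ℝ, ℝ).prod I) (𝓘(ℝ, ℝ).prod I).tangent ∞ (fun p : ℝ × M =>
      (⟨p, ((a p.1, X p.2) : ℝ × EM)⟩ : TangentBundle (𝓘(ℝ, ℝ).prod I) (ℝ × M))) :=
    (contMDiff_equivTangentBundleProd_symm (I := 𝓘(ℝ, ℝ)) (M := ℝ) (I' := I) (M' := M)).comp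
      ((ha.comp contMDiff_fst).prodMk (hX.comp contMDiff_snd))
  have h2 := ContMDiffOn.contMDiffOn_tangentMapWithin (m := ∞) hg (by simp)
    uniqueMDiffOn_unit_prod
  exact (contMDiff_snd_tangentBundle_modelSpace ℝ 𝓘(ℝ, ℝ)).comp_contMDiffOn
    (h2.comp h1.contMDiffOn fun p hp => hp)

theorem IsSmoothFamily.mdifferentiableWithinAt (hg : IsSmoothFamily g) {t : ℝ}
    (ht : t ∈ Icc (0 : ℝ) 1) (x : M) :
    MDifferentiableWithinAt (𝓘(ℝ, ℝ).prod I) 𝓘(ℝ, ℝ)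
      (fun p : ℝ × M => g (projIcc 0 1 zero_le_one p.1) p.2) (Icc 0 1 ×ˢ univ) (t, x) :=
  ContMDiffWithinAt.mdifferentiableWithinAt (hg (t, x) ⟨ht, mem_univ _⟩) (by simp)

theorem IsSmoothFamily.mfderivWithin_snd (hg : IsSmoothFamily g) {t : ℝ}
    (ht : t ∈ Icc (0 : ℝ) 1) (x : M) (v : TangentSpace I x) :
    (mfderivWithin (𝓘(ℝ, ℝ).prod I) 𝓘(ℝ, ℝ)
        (fun p : ℝ × M => g (projIcc 0 1 zero_le_one p.1) p.2) (Icc 0 1 ×ˢ univ) (t, x)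
        ((0, v) : ℝ × EM) : ℝ) = mvfderiv I (g (projIcc 0 1 zero_le_one t)) x v := by
  have h1 := (hg.mdifferentiableWithinAt ht x).hasMFDerivWithinAt
  have h2 : HasMFDerivWithinAt I (𝓘(ℝ, ℝ).prod I) (fun y : M => (t, y)) univ x
      (ContinuousLinearMap.inr ℝ ℝ EM) := by
    have h3 := (hasMFDerivAt_const (I := I) (I' := 𝓘(ℝ, ℝ)) t x).prodMk (hasMFDerivAt_id x)
    exact h3.hasMFDerivWithinAt
  have h3 := (h1.comp x h2 fun y _ => ⟨ht, mem_univ _⟩)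
  rw [hasMFDerivWithinAt_univ] at h3
  have h4 := h3.mfderiv
  exact (congrArg (fun L : EM →L[ℝ] ℝ => L v) h4).symm

theorem IsSmoothFamily.hasDerivWithinAt_mfderivWithin (hg : IsSmoothFamily g) {t : ℝ}
    (ht : t ∈ Icc (0 : ℝ) 1) (x : M) :
    HasDerivWithinAt (fun r : ℝ => g (projIcc 0 1 zero_le_one r) x)
      (mfderivWithin (𝓘(ℝ, ℝ).prod I) 𝓘(ℝ, ℝ)
        (fun p : ℝ × M => g (projIcc 0 1 zero_le_one p.1) p.2) (Icc 0 1 ×ˢ univ) (t, x)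
        ((1, 0) : ℝ × EM) : ℝ) (Icc 0 1) t := by
  have h1 := (hg.mdifferentiableWithinAt ht x).hasMFDerivWithinAt
  have h2 : HasMFDerivWithinAt 𝓘(ℝ, ℝ) (𝓘(ℝ, ℝ).prod I) (fun r : ℝ => (r, x)) (Icc 0 1) t
      (ContinuousLinearMap.inl ℝ ℝ EM) := by
    have h3 := (hasMFDerivAt_id (I := 𝓘(ℝ, ℝ)) t).prodMk
      (hasMFDerivAt_const (I := 𝓘(ℝ, ℝ)) (I' := I) x t)
    exact h3.hasMFDerivWithinAt
  have hst : Icc (0 : ℝ) 1 ⊆ (fun r : ℝ => (r, x)) ⁻¹' (Icc 0 1 ×ˢ univ) :=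
    fun y hy => ⟨hy, mem_univ _⟩
  have h3 := h1.comp t h2 hst
  let L : ℝ × EM →L[ℝ] ℝ := mfderivWithin (𝓘(ℝ, ℝ).prod I) 𝓘(ℝ, ℝ)
    (fun p : ℝ × M => g (projIcc 0 1 zero_le_one p.1) p.2) (Icc 0 1 ×ˢ univ) (t, x)
  have h4 : HasFDerivWithinAt (fun r : ℝ => g (projIcc 0 1 zero_le_one r) x)
      (L.comp (ContinuousLinearMap.inl ℝ ℝ EM)) (Icc 0 1) t :=
    hasMFDerivWithinAt_iff_hasFDerivWithinAt.1 h3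
  exact h4.hasDerivWithinAt

/-- `g'` is the time derivative of the smooth family `g`. -/
structure HasFamilyDeriv (g g' : unitInterval → C^∞⟮I, M; ℝ⟯) : Prop where
  smooth : IsSmoothFamily g
  hasDerivWithinAt (t : unitInterval) (x : M) :
    HasDerivWithinAt (fun r : ℝ => g (projIcc 0 1 zero_le_one r) x) (g' t x) (Icc 0 1) t

variable {g' h' : unitInterval → C^∞⟮I, M; ℝ⟯}

/-- The time derivative is the derivative along the smooth vector field `(1, 0)` on `ℝ × M`;
derivatives within `[0,1]` are unique, so `g'` is this function. -/
theorem HasFamilyDeriv.smooth_deriv (hg : HasFamilyDeriv g g') : IsSmoothFamily g' := by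
  have ha : ContMDiff 𝓘(ℝ, ℝ) (𝓘(ℝ, ℝ).prod 𝓘(ℝ, ℝ)) ∞
      fun t : ℝ => (⟨t, (1 : ℝ)⟩ : TangentBundle 𝓘(ℝ, ℝ) ℝ) := by
    intro t
    exact contMDiffAt_vectorSpace_iff_contDiffAt.2 contDiffAt_const
  have hX : ContMDiff I (I.prod 𝓘(ℝ, EM)) ∞ fun x : M => (⟨x, 0⟩ : TangentBundle I M) :=
    contMDiff_zeroSection ℝ (TangentSpace I : M → Type _)
  refine (hg.smooth.contMDiffOn_mfderivWithin ha hX).congr ?_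
  rintro ⟨t, x⟩ ⟨ht, -⟩
  have h1 := (hg.smooth.hasDerivWithinAt_mfderivWithin ht x).derivWithin
    (uniqueDiffOn_Icc zero_lt_one t ht)
  have h2 := (hg.hasDerivWithinAt ⟨t, ht⟩ x).derivWithin (uniqueDiffOn_Icc zero_lt_one t ht)
  exact (congrArg (fun s => g' s x) (projIcc_of_mem zero_le_one ht)).trans (h2.symm.trans h1)

variable {F : Type*} [NormedAddCommGroup F] [NormedSpace ℝ F]
  {E : M → Type*} [TopologicalSpace (TotalSpace F E)] [∀ x, TopologicalSpace (E x)]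
  [FiberBundle F E] [∀ x, AddCommGroup (E x)] [∀ x, Module ℝ (E x)] [VectorBundle ℝ F E]

theorem IsSmoothFamily.der (hg : IsSmoothFamily g) (ρ : BundleAnchor I F E)
    (e : Cₛ^∞⟮I; F, E⟯) : IsSmoothFamily fun t => ρ.der e (g t) := by
  have ha : ContMDiff 𝓘(ℝ, ℝ) (𝓘(ℝ, ℝ).prod 𝓘(ℝ, ℝ)) ∞
      fun t : ℝ => (⟨t, (0 : ℝ)⟩ : TangentBundle 𝓘(ℝ, ℝ) ℝ) :=
    contMDiff_zeroSection ℝ (TangentSpace 𝓘(ℝ, ℝ) : ℝ → Type _)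
  have hX : ContMDiff I (I.prod 𝓘(ℝ, EM)) ∞ (fun x =>
      (⟨x, ρ.map x (e x)⟩ : TangentBundle I M)) :=
    ContMDiff.clm_bundle_apply (F₁ := F) (F₂ := EM) ρ.contMDiff e.contMDiff
  refine (hg.contMDiffOn_mfderivWithin ha hX).congr ?_
  rintro ⟨t, x⟩ ⟨ht, -⟩
  exact (hg.mfderivWithin_snd ht x _).symm

section Integral

variable [FiniteDimensional ℝ EM] [BoundarylessManifold I M]

/-- The absence of boundary enters here: near the centre of a chart, functions live on an open
subset of the model vector space. -/
theorem interior_extChartAt_target_mem (x : M) :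
    extChartAt I x x ∈ interior (extChartAt I x).target := by
  rw [mem_interior_iff_mem_nhds]
  have h1 := range_mem_nhds_isInteriorPoint (I := I) (x := x) BoundarylessManifold.isInteriorPoint
  have h2 := extChartAt_target_mem_nhdsWithin (I := I) x
  rwa [nhdsWithin_eq_nhds.2 h1] at h2

theorem mvfderiv_eq_fderiv_chart (f : C^∞⟮I, M; ℝ⟯) (x : M) (v : TangentSpace I x) :
    mvfderiv I f x v = fderiv ℝ (fun u => f ((extChartAt I x).symm u)) (extChartAt I x x) v := by
  have h1 := range_mem_nhds_isInteriorPoint (I := I) (x := x) BoundarylessManifold.isInteriorPoint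
  have h2 : mfderiv I 𝓘(ℝ, ℝ) f x = fderivWithin ℝ (writtenInExtChartAt I 𝓘(ℝ, ℝ) x f) (range I)
    (extChartAt I x x) := (f.contMDiff.mdifferentiableAt (by simp)).mfderiv
  rw [fderivWithin_of_mem_nhds h1] at h2
  exact congrArg (fun L : EM →L[ℝ] ℝ => L v) h2

theorem IsSmoothFamily.contDiffOn_chart (hg : IsSmoothFamily g) (x : M) :
    ContDiffOn ℝ ∞ (fun p : ℝ × EM => g (projIcc 0 1 zero_le_one p.1) ((extChartAt I x).symm p.2))
      (Icc 0 1 ×ˢ interior (extChartAt I x).target) := by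
  have h1 : ContMDiffOn (𝓘(ℝ, ℝ).prod 𝓘(ℝ, EM)) (𝓘(ℝ, ℝ).prod I) ∞
      (fun p : ℝ × EM => (p.1, (extChartAt I x).symm p.2))
      (Icc 0 1 ×ˢ interior (extChartAt I x).target) :=
    contMDiffOn_fst.prodMk ((contMDiffOn_extChartAt_symm x).comp contMDiffOn_snd
      fun p hp => interior_subset (s := (extChartAt I x).target) hp.2)
  have h2 := ContMDiffOn.comp (g := fun p : ℝ × M => g (projIcc 0 1 zero_le_one p.1) p.2) hg h1
    fun p hp => ⟨hp.1, mem_univ _⟩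
  rw [← contMDiffOn_iff_contDiffOn, modelWithCornersSelf_prod, ← chartedSpaceSelf_prod]
  exact h2

/-- Integrals of smooth families are smooth and may be differentiated under the integral sign. -/
theorem IsSmoothFamily.exists_integral (hg : IsSmoothFamily g) {r : ℝ} (hr : r ∈ Icc (0 : ℝ) 1) :
    ∃ G : C^∞⟮I, M; ℝ⟯, (∀ x, G x = ∫ t in 0..r, g (projIcc 0 1 zero_le_one t) x) ∧
      ∀ x v, mvfderiv I G x v = ∫ t in 0..r, mvfderiv I (g (projIcc 0 1 zero_le_one t)) x v := by
  have hsm : ContMDiff I 𝓘(ℝ, ℝ) ∞ fun x => ∫ t in 0..r, g (projIcc 0 1 zero_le_one t) x := by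
    intro x
    have h1 := (contDiffOn_integral isOpen_interior (hg.contDiffOn_chart x) hr).contDiffAt
      (isOpen_interior.mem_nhds (interior_extChartAt_target_mem x))
    have h2 := h1.contMDiffAt.comp x (contMDiffAt_extChartAt (I := I) (n := ∞) (x := x))
    refine h2.congr_of_eventuallyEq ?_
    filter_upwards [extChartAt_source_mem_nhds (I := I) x] with y hy
    simp only [Function.comp, (extChartAt I x).left_inv hy]
  let G : C^∞⟮I, M; ℝ⟯ := ⟨_, hsm⟩
  refine ⟨G, fun x => rfl, fun x v => ?_⟩
  have hx := interior_extChartAt_target_mem (I := I) x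
  have hf := hg.contDiffOn_chart x
  refine (mvfderiv_eq_fderiv_chart G x v).trans ?_
  have h1 := hasFDerivAt_integral_partialSnd isOpen_interior hf hr hx
  refine (congrArg (fun L : EM →L[ℝ] ℝ => L v) h1.fderiv).trans ?_
  refine (ContinuousLinearMap.intervalIntegral_apply (intervalIntegrable_slice
    (contDiffOn_partialSnd isOpen_interior hf).continuousOn hx hr) v).trans ?_
  refine intervalIntegral.integral_congr fun t ht => ?_
  rw [uIcc_of_le hr.1] at ht
  rw [mvfderiv_eq_fderiv_chart]
  exact (congrArg (fun L : EM →L[ℝ] ℝ => L v)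
    (hasFDerivAt_partialSnd isOpen_interior hf ⟨ht.1, ht.2.trans hr.2⟩ hx).fderiv).symm

theorem HasFamilyDeriv.integral_eq_sub (hg : HasFamilyDeriv g g') {r : ℝ}
    (hr : r ∈ Icc (0 : ℝ) 1) (x : M) :
    ∫ t in 0..r, g' (projIcc 0 1 zero_le_one t) x = g (projIcc 0 1 zero_le_one r) x - g 0 x := by
  have h0 : g 0 x = g (projIcc 0 1 zero_le_one 0) x := by rw [projIcc_left]; rfl
  rw [h0]
  refine intervalIntegral.integral_eq_sub_of_hasDerivAt_of_le hr.1
    (hg.smooth.continuous x).continuousOn (fun t ht => ?_)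
    ((hg.smooth_deriv.continuous x).intervalIntegrable _ _)
  have ht' : t ∈ Icc (0 : ℝ) 1 := ⟨ht.1.le, ht.2.le.trans hr.2⟩
  rw [projIcc_of_mem zero_le_one ht']
  exact (hg.hasDerivWithinAt ⟨t, ht'⟩ x).hasDerivAt (Icc_mem_nhds ht.1 (ht.2.trans_le hr.2))

/-- Time and space derivatives commute: write `g r = g 0 + ∫₀^r g'`, differentiate under the
integral sign along `ρ(e)`, and apply the fundamental theorem of calculus to the result. -/
theorem HasFamilyDeriv.der (hg : HasFamilyDeriv g g') (ρ : BundleAnchor I F E)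
    (e : Cₛ^∞⟮I; F, E⟯) : HasFamilyDeriv (fun t => ρ.der e (g t)) fun t => ρ.der e (g' t) := by
  refine ⟨hg.smooth.der ρ e, fun t x => ?_⟩
  have hc := (hg.smooth_deriv.der ρ e).continuous x
  have h1 : HasDerivWithinAt (fun r : ℝ => ρ.der e (g 0) x +
      ∫ s in 0..r, ρ.der e (g' (projIcc 0 1 zero_le_one s)) x) (ρ.der e (g' t) x) (Icc 0 1) t := by
    have h2 := (hc.integral_hasStrictDerivAt 0 (t : ℝ)).hasDerivAt.hasDerivWithinAt (s := Icc 0 1)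
    rw [projIcc_val] at h2
    exact h2.const_add _
  refine h1.congr_of_mem (fun r hr => ?_) t.2
  obtain ⟨G, hG, hG'⟩ := hg.smooth_deriv.exists_integral hr
  have h3 : g (projIcc 0 1 zero_le_one r) = g 0 + G := by
    ext y
    change _ = g 0 y + G y
    rw [hG, hg.integral_eq_sub hr]
    ring
  rw [h3, map_add]
  change ρ.der e (g 0) x + ρ.der e G x = _
  rw [ρ.der_apply e G, hG']
  rfl

end Integral

theorem HasFamilyDeriv.const (f : C^∞⟮I, M; ℝ⟯) : HasFamilyDeriv (fun _ => f) 0 :=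
  ⟨.const f, fun _ _ => hasDerivWithinAt_const _ _ _⟩

theorem HasFamilyDeriv.add (hg : HasFamilyDeriv g g') (hh : HasFamilyDeriv h h') :
    HasFamilyDeriv (fun t => g t + h t) fun t => g' t + h' t :=
  ⟨hg.smooth.add hh.smooth, fun t x => (hg.hasDerivWithinAt t x).add (hh.hasDerivWithinAt t x)⟩

theorem HasFamilyDeriv.mul (hg : HasFamilyDeriv g g') (hh : HasFamilyDeriv h h') :
    HasFamilyDeriv (fun t => g t * h t) fun t => g' t * h t + g t * h' t :=
  ⟨hg.smooth.mul hh.smooth, fun t x => by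
    have h1 := (hg.hasDerivWithinAt t x).mul (hh.hasDerivWithinAt t x)
    rw [projIcc_val] at h1
    exact h1⟩

theorem HasFamilyDeriv.const_mul (f : C^∞⟮I, M; ℝ⟯) (hg : HasFamilyDeriv g g') :
    HasFamilyDeriv (fun t => f * g t) fun t => f * g' t := by
  simpa using (HasFamilyDeriv.const f).mul hg

theorem HasFamilyDeriv.neg (hg : HasFamilyDeriv g g') :
    HasFamilyDeriv (fun t => -g t) fun t => -g' t := by
  simpa using hg.const_mul (-1)

theorem HasFamilyDeriv.sub (hg : HasFamilyDeriv g g') (hh : HasFamilyDeriv h h') :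
    HasFamilyDeriv (fun t => g t - h t) fun t => g' t - h' t := by
  simpa [sub_eq_add_neg] using hg.add hh.neg

theorem HasFamilyDeriv.sum {ι : Type*} {g g' : ι → unitInterval → C^∞⟮I, M; ℝ⟯} (s : Finset ι)
    (hg : ∀ i, HasFamilyDeriv (g i) (g' i)) :
    HasFamilyDeriv (fun t => ∑ i ∈ s, g i t) fun t => ∑ i ∈ s, g' i t := by
  classical
  induction s using Finset.induction_on with
  | empty => simpa using! HasFamilyDeriv.const (0 : C^∞⟮I, M; ℝ⟯)
  | insert i s hi ih => simpa [Finset.sum_insert hi] using (hg i).add ih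

theorem HasFamilyDeriv.of_local (hg : ∀ x : M, ∃ φ : C^∞⟮I, M; ℝ⟯, (∀ᶠ y in 𝓝 x, φ y = 1) ∧
    HasFamilyDeriv (fun t => φ * g t) fun t => φ * g' t) : HasFamilyDeriv g g' := by
  refine ⟨.of_local fun x => ?_, fun t x => ?_⟩
  · obtain ⟨φ, hφ, h⟩ := hg x
    exact ⟨φ, hφ, h.smooth⟩
  · obtain ⟨φ, hφ, h⟩ := hg x
    have h1 := h.hasDerivWithinAt t x
    have h2 : ∀ f : C^∞⟮I, M; ℝ⟯, (φ * f) x = f x := fun f => by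
      change φ x * f x = f x
      rw [hφ.self_of_nhds, one_mul]
    simpa only [h2] using h1

end Families
-- Integrals of smooth families over `[0, 1]`
section Integral

open MeasureTheory

variable {EM HM M : Type*} [NormedAddCommGroup EM] [NormedSpace ℝ EM]
  [TopologicalSpace HM] {I : ModelWithCorners ℝ EM HM} [TopologicalSpace M] [ChartedSpace HM M]

/-- `G` is the integral over `[0, 1]` of the smooth family `g`. -/
structure HasFamilyIntegral (g : unitInterval → C^∞⟮I, M; ℝ⟯) (G : C^∞⟮I, M; ℝ⟯) : Prop where
  smooth : IsSmoothFamily g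
  integral_eq (x : M) : G x = ∫ t in (0 : ℝ)..1, g (projIcc 0 1 zero_le_one t) x

variable {g h : unitInterval → C^∞⟮I, M; ℝ⟯} {G H : C^∞⟮I, M; ℝ⟯}

theorem HasFamilyIntegral.unique (hg : HasFamilyIntegral g G) (hg' : HasFamilyIntegral g H) :
    G = H := by
  ext x
  rw [hg.integral_eq, hg'.integral_eq]

theorem HasFamilyIntegral.add (hg : HasFamilyIntegral g G) (hh : HasFamilyIntegral h H) :
    HasFamilyIntegral (fun t => g t + h t) (G + H) := by
  refine ⟨hg.smooth.add hh.smooth, fun x => ?_⟩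
  change G x + H x = _
  rw [hg.integral_eq, hh.integral_eq]
  exact (intervalIntegral.integral_add ((hg.smooth.continuous x).intervalIntegrable _ _)
    ((hh.smooth.continuous x).intervalIntegrable _ _)).symm

theorem HasFamilyIntegral.const_mul (f : C^∞⟮I, M; ℝ⟯) (hg : HasFamilyIntegral g G) :
    HasFamilyIntegral (fun t => f * g t) (f * G) := by
  refine ⟨hg.smooth.const_mul f, fun x => ?_⟩
  change f x * G x = _
  rw [hg.integral_eq]
  exact (intervalIntegral.integral_const_mul _ _).symm

theorem HasFamilyIntegral.sub (hg : HasFamilyIntegral g G) (hh : HasFamilyIntegral h H) :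
    HasFamilyIntegral (fun t => g t - h t) (G - H) := by
  simpa [sub_eq_add_neg] using hg.add (hh.const_mul (-1))

theorem HasFamilyIntegral.zero : HasFamilyIntegral (fun _ => (0 : C^∞⟮I, M; ℝ⟯)) 0 :=
  ⟨.const 0, fun x => by
    change 0 = ∫ t in (0 : ℝ)..1, (0 : ℝ)
    simp⟩

theorem integral_unitInterval (f : unitInterval → ℝ) :
    ∫ t : unitInterval, f t = ∫ t in (0 : ℝ)..1, f (projIcc 0 1 zero_le_one t) := by
  rw [intervalIntegral.integral_of_le zero_le_one, ← integral_Icc_eq_integral_Ioc,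
    ← integral_subtype measurableSet_Icc (fun t : ℝ => f (projIcc 0 1 zero_le_one t))]
  simp only [projIcc_val]

theorem IsSmoothFamily.integrable (hg : IsSmoothFamily g) (x : M) :
    Integrable fun t : unitInterval => g t x := by
  have h1 : Continuous fun t : unitInterval => g t x := by
    refine ((hg.continuous x).comp continuous_subtype_val).congr fun t => ?_
    simp [projIcc_val]
  exact h1.integrable_of_hasCompactSupport (HasCompactSupport.of_compactSpace _)

theorem HasFamilyIntegral.eq_integral_unitInterval (hg : HasFamilyIntegral g G) (x : M) :
    G x = ∫ t : unitInterval, g t x := by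
  rw [hg.integral_eq, integral_unitInterval]

variable [IsManifold I ∞ M] [FiniteDimensional ℝ EM] [BoundarylessManifold I M]

theorem IsSmoothFamily.exists_hasFamilyIntegral (hg : IsSmoothFamily g) :
    ∃ G, HasFamilyIntegral g G := by
  obtain ⟨G, hG, -⟩ := hg.exists_integral (right_mem_Icc.2 zero_le_one)
  exact ⟨G, hg, hG⟩

theorem HasFamilyDeriv.hasFamilyIntegral {g' : unitInterval → C^∞⟮I, M; ℝ⟯}
    (hg : HasFamilyDeriv g g') : HasFamilyIntegral g' (g 1 - g 0) := by
  refine ⟨hg.smooth_deriv, fun x => ?_⟩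
  rw [hg.integral_eq_sub (right_mem_Icc.2 zero_le_one), projIcc_right]
  rfl

variable {F : Type*} [NormedAddCommGroup F] [NormedSpace ℝ F]
  {E : M → Type*} [TopologicalSpace (TotalSpace F E)] [∀ x, TopologicalSpace (E x)]
  [FiberBundle F E] [∀ x, AddCommGroup (E x)] [∀ x, Module ℝ (E x)] [VectorBundle ℝ F E]

theorem HasFamilyIntegral.der (hg : HasFamilyIntegral g G) (ρ : BundleAnchor I F E)
    (e : Cₛ^∞⟮I; F, E⟯) : HasFamilyIntegral (fun t => ρ.der e (g t)) (ρ.der e G) := by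
  refine ⟨hg.smooth.der ρ e, fun x => ?_⟩
  obtain ⟨G', hG', hd⟩ := hg.smooth.exists_integral (right_mem_Icc.2 zero_le_one)
  obtain rfl : G = G' := hg.unique ⟨hg.smooth, hG'⟩
  rw [ρ.der_apply, hd]
  rfl

end Integral

/-! ### Dual frames -/

section Bundle

variable {EM HM M : Type*} [NormedAddCommGroup EM] [NormedSpace ℝ EM]
  [TopologicalSpace HM] {I : ModelWithCorners ℝ EM HM} [TopologicalSpace M] [ChartedSpace HM M]
  {F : Type*} [NormedAddCommGroup F] [NormedSpace ℝ F]
  {V : M → Type*} [TopologicalSpace (TotalSpace F V)] [∀ x, TopologicalSpace (V x)]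
  [FiberBundle F V] [∀ x, AddCommGroup (V x)] [∀ x, Module ℝ (V x)] [VectorBundle ℝ F V]

@[simp]
theorem sec_add_apply (s t : Cₛ^∞⟮I; F, V⟯) (x : M) : (s + t) x = s x + t x := rfl

theorem sec_sum_apply {ι : Type*} (u : Finset ι) (s : ι → Cₛ^∞⟮I; F, V⟯) (x : M) :
    (∑ i ∈ u, s i) x = ∑ i ∈ u, s i x := by
  change ContMDiffSection.coeAddHom I F ∞ V _ x = _
  rw [map_sum, Finset.sum_apply]
  rfl

@[simp]
theorem smooth_mul_apply (f g : C^∞⟮I, M; ℝ⟯) (x : M) : (f * g) x = f x * g x := rfl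

theorem smooth_sum_apply {ι : Type*} (u : Finset ι) (s : ι → C^∞⟮I, M; ℝ⟯) (x : M) :
    (∑ i ∈ u, s i) x = ∑ i ∈ u, s i x := by
  change ContMDiffMap.coeFnAddMonoidHom _ x = _
  rw [map_sum, Finset.sum_apply]
  rfl

variable [FiniteDimensional ℝ EM] [T2Space M] [IsManifold I ∞ M] [FiniteDimensional ℝ F]
  [ContMDiffVectorBundle ∞ F V I]

/-- Sections and functionals that resolve a cutoff function: `φ • s = ∑ i, ℓᵢ(s) • σᵢ`. -/
theorem exists_dual_frame (x : M) : ∃ (ι : Type) (_ : Fintype ι) (σ : ι → Cₛ^∞⟮I; F, V⟯)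
    (l : ι → Cₛ^∞⟮I; F, V⟯ →ₗ[C^∞⟮I, M; ℝ⟯] C^∞⟮I, M; ℝ⟯) (φ : C^∞⟮I, M; ℝ⟯),
      (∀ᶠ y in 𝓝 x, φ y = 1) ∧ (∀ s, φ • s = ∑ i, l i s • σ i) ∧
      (∀ i s y, s y = 0 → l i s y = 0) ∧
      ∀ s : unitInterval → Cₛ^∞⟮I; F, V⟯, ContMDiffOn (𝓘(ℝ, ℝ).prod I) (I.prod 𝓘(ℝ, F)) ∞
        (fun p : ℝ × M => TotalSpace.mk' F p.2 (s (projIcc 0 1 zero_le_one p.1) p.2))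
        (Icc 0 1 ×ˢ univ) → ∀ i, IsSmoothFamily fun t => l i (s t) := by
  let e := trivializationAt F V x
  have hx : x ∈ e.baseSet := FiberBundle.mem_baseSet_trivializationAt F V x
  let b := Module.finBasis ℝ F
  obtain ⟨φ, hφ, hs⟩ := exists_cutoff (I := I) x (e.open_baseSet.mem_nhds hx)
  have hφ0 : ∀ y ∉ e.baseSet, φ y = 0 := fun y hy =>
    image_eq_zero_of_notMem_tsupport fun h => hy (hs h)
  have hloc : ∀ y ∉ e.baseSet, ∀ᶠ z in 𝓝 y, φ z = 0 := fun y hy => by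
    have hy' : y ∈ (tsupport φ)ᶜ := fun h => hy (hs h)
    filter_upwards [(isClosed_tsupport φ).isOpen_compl.mem_nhds hy'] with z hz
    exact image_eq_zero_of_notMem_tsupport hz
  have hσ : ∀ i, ContMDiff I (I.prod 𝓘(ℝ, F)) ∞
      (fun y => (⟨y, ((φ : M → ℝ) • fun y => e.symmL ℝ y (b i)) y⟩ : TotalSpace F V)) := by
    intro i
    refine ContMDiffOn.smul_section_of_tsupport (u := e.baseSet)
      φ.contMDiff.contMDiffOn e.open_baseSet hs ?_
    rw [e.contMDiffOn_section_baseSet_iff]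
    refine (contMDiffOn_const (c := b i)).congr fun y hy => ?_
    simp [Trivialization.apply_mk_symm, hy]
  let B : Fin (Module.finrank ℝ F) → F →L[ℝ] ℝ := fun i => (b.coord i).toContinuousLinearMap
  have hl : ∀ (s : Cₛ^∞⟮I; F, V⟯) i, ContMDiff I 𝓘(ℝ, ℝ) ∞
      (fun y => φ y * B i (e.linearMapAt ℝ y (s y))) := by
    intro s i y
    by_cases hy : y ∈ e.baseSet
    · refine (φ.contMDiff y).mul ((B i).contMDiff.contMDiffAt.comp y ?_)
      have h1 := (e.contMDiffAt_section_iff (s := s) hy).1 (s.contMDiff y)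
      refine h1.congr_of_eventuallyEq ?_
      filter_upwards [e.open_baseSet.mem_nhds hy] with z hz
      rw [e.linearMapAt_apply, if_pos hz]
    · refine (contMDiffAt_const (c := (0 : ℝ))).congr_of_eventuallyEq ?_
      filter_upwards [hloc y hy] with z hz
      rw [hz, zero_mul]
  let l : Fin (Module.finrank ℝ F) → Cₛ^∞⟮I; F, V⟯ →ₗ[C^∞⟮I, M; ℝ⟯] C^∞⟮I, M; ℝ⟯ := fun i =>
    { toFun := fun s => ⟨_, hl s i⟩
      map_add' := fun s t => by
        ext y
        change φ y * B i (e.linearMapAt ℝ y (s y + t y)) =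
          φ y * B i (e.linearMapAt ℝ y (s y)) + φ y * B i (e.linearMapAt ℝ y (t y))
        rw [map_add, map_add, mul_add]
      map_smul' := fun f s => by
        ext y
        change φ y * B i (e.linearMapAt ℝ y (f y • s y)) =
          f y * (φ y * B i (e.linearMapAt ℝ y (s y)))
        rw [map_smul, map_smul, smul_eq_mul, mul_left_comm] }
  have hlapp : ∀ i s y, l i s y = φ y * B i (e.linearMapAt ℝ y (s y)) := fun _ _ _ => rfl
  -- The cutoff occurs squared because one factor `φ` is needed to globalise the sections and
  -- another to globalise the coordinate functionals.
  refine ⟨Fin (Module.finrank ℝ F), inferInstance, fun i => ⟨_, hσ i⟩, l, φ * φ, ?_, ?_, ?_, ?_⟩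
  · filter_upwards [hφ] with y hy
    rw [smooth_mul_apply, hy, one_mul]
  · intro s
    ext y
    rw [sec_sum_apply]
    simp only [sec_smul_apply, hlapp, smooth_mul_apply]
    change _ = ∑ i, (φ y * B i (e.linearMapAt ℝ y (s y))) • (φ y • e.symmL ℝ y (b i))
    by_cases hy : y ∈ e.baseSet
    · have h1 : ∑ i, (φ y * B i (e.linearMapAt ℝ y (s y))) • (φ y • e.symmL ℝ y (b i)) =
          (φ y * φ y) • e.symmL ℝ y (∑ i, B i (e.linearMapAt ℝ y (s y)) • b i) := by
        rw [map_sum, Finset.smul_sum]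
        refine Finset.sum_congr rfl fun i _ => ?_
        rw [map_smul, smul_smul, smul_smul]
        congr 1
        ring
      have h2 : ∑ i, B i (e.linearMapAt ℝ y (s y)) • b i = e.linearMapAt ℝ y (s y) :=
        b.sum_repr _
      rw [h1, h2]
      congr 1
      exact (e.symmₗ_linearMapAt hy (s y)).symm
    · simp [hφ0 y hy]
  · intro i s y hy
    rw [hlapp, hy, map_zero, map_zero, mul_zero]
  · rintro s h i ⟨t, y⟩ hp
    by_cases hy : y ∈ e.baseSet
    · have h1 := ((Trivialization.contMDiffWithinAt_iff (e := e)
        (by rw [Trivialization.mem_source]; exact hy)).1 (h (t, y) hp)).2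
      have h2 : ContMDiffWithinAt (𝓘(ℝ, ℝ).prod I) 𝓘(ℝ, ℝ) ∞ (fun p : ℝ × M => φ p.2 *
          B i (e (TotalSpace.mk' F p.2 (s (projIcc 0 1 zero_le_one p.1) p.2))).2)
          (Icc 0 1 ×ˢ univ) (t, y) :=
        ((φ.contMDiff.comp contMDiff_snd).contMDiffAt.contMDiffWithinAt).mul
          ((B i).contMDiff.contMDiffAt.comp_contMDiffWithinAt _ h1)
      have h3 : ∀ p : ℝ × M, p.2 ∈ e.baseSet → l i (s (projIcc 0 1 zero_le_one p.1)) p.2 =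
          φ p.2 * B i (e (TotalSpace.mk' F p.2 (s (projIcc 0 1 zero_le_one p.1) p.2))).2 := by
        intro p hp
        rw [hlapp, e.linearMapAt_apply, if_pos hp]
      have h4 : ∀ᶠ p : ℝ × M in 𝓝 (t, y), p.2 ∈ e.baseSet :=
        (continuous_snd.tendsto (t, y)).eventually (e.open_baseSet.mem_nhds hy)
      refine h2.congr_of_eventuallyEq ?_ (h3 (t, y) hy)
      filter_upwards [mem_nhdsWithin_of_mem_nhds h4] with p hp using h3 p hp
    · have h4 : ∀ᶠ p : ℝ × M in 𝓝 (t, y), φ p.2 = 0 :=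
        (continuous_snd.tendsto (t, y)).eventually (hloc y hy)
      refine (contMDiffWithinAt_const (c := (0 : ℝ))).congr_of_eventuallyEq ?_ ?_
      · filter_upwards [mem_nhdsWithin_of_mem_nhds h4] with p hp
        rw [hlapp, hp, zero_mul]
      · rw [hlapp, hφ0 y hy, zero_mul]

end Bundle
-- Every fibre is isomorphic to the model fibre `F`, so one zero fibre forces all of them to vanish.
theorem fiber_eq_zero {M : Type*} [TopologicalSpace M] (F : Type*) [NormedAddCommGroup F]
    [NormedSpace ℝ F] {E : M → Type*} [TopologicalSpace (TotalSpace F E)]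
    [∀ x, TopologicalSpace (E x)] [FiberBundle F E] [∀ x, AddCommGroup (E x)]
    [∀ x, Module ℝ (E x)] [VectorBundle ℝ F E] {x : M} (h : ∀ v : E x, v = 0) (y : M) (v : E y) :
    v = 0 := by
  let e := (trivializationAt F E x).continuousLinearEquivAt ℝ x
    (FiberBundle.mem_baseSet_trivializationAt F E x)
  have hF : ∀ f : F, f = 0 := fun f => by
    rw [← e.apply_symm_apply f, h (e.symm f), map_zero]
  let e' := (trivializationAt F E y).continuousLinearEquivAt ℝ y
    (FiberBundle.mem_baseSet_trivializationAt F E y)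
  exact e'.injective ((hF _).trans (hF _).symm)

/-! ### The trace on endomorphisms and its compatibility with connections -/

section Bundle

variable {EM HM M : Type*} [NormedAddCommGroup EM] [NormedSpace ℝ EM]
  [TopologicalSpace HM] {I : ModelWithCorners ℝ EM HM} [TopologicalSpace M] [ChartedSpace HM M]
  {F : Type*} [NormedAddCommGroup F] [NormedSpace ℝ F]
  {V : M → Type*} [TopologicalSpace (TotalSpace F V)] [∀ x, TopologicalSpace (V x)]
  [FiberBundle F V] [∀ x, AddCommGroup (V x)] [∀ x, Module ℝ (V x)] [VectorBundle ℝ F V]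
  [FiniteDimensional ℝ EM] [T2Space M] [IsManifold I ∞ M] [FiniteDimensional ℝ F]
  [ContMDiffVectorBundle ∞ F V I]

theorem smooth_ext_of_local {f g : C^∞⟮I, M; ℝ⟯}
    (h : ∀ x, ∃ φ : C^∞⟮I, M; ℝ⟯, (∀ᶠ y in 𝓝 x, φ y = 1) ∧ φ * f = φ * g) : f = g := by
  ext x
  obtain ⟨φ, hφ, hfg⟩ := h x
  have h1 := congrArg (fun k : C^∞⟮I, M; ℝ⟯ => k x) hfg
  simpa [hφ.self_of_nhds] using h1

/-- Tensoriality: near `x` the section is `∑ lᵢ(s) • σᵢ`, and its coefficients vanish at `x`. -/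
theorem functional_apply_eq_zero (l : Cₛ^∞⟮I; F, V⟯ →ₗ[C^∞⟮I, M; ℝ⟯] C^∞⟮I, M; ℝ⟯)
    (s : Cₛ^∞⟮I; F, V⟯) (x : M) (hs : s x = 0) : l s x = 0 := by
  obtain ⟨ι, _, σ, k, φ, hφ, hf, h0, -⟩ := exists_dual_frame (I := I) (F := F) (V := V) x
  have h1 : l (φ • s) x = l s x := by simp [hφ.self_of_nhds]
  rw [← h1, hf, map_sum, smooth_sum_apply]
  refine Finset.sum_eq_zero fun i _ => ?_
  rw [map_smul, smul_eq_mul, smooth_mul_apply, h0 i s x hs, zero_mul]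

/-- The linear form on the fibre over `x` induced by a `C^∞(M)`-linear functional on sections. -/
noncomputable def fiberFunctional (l : Cₛ^∞⟮I; F, V⟯ →ₗ[C^∞⟮I, M; ℝ⟯] C^∞⟮I, M; ℝ⟯) (x : M) :
    V x →ₗ[ℝ] ℝ where
  toFun v := l ((exists_linear_extension (I := I) (F := F) x).choose v) x
  map_add' v w := by rw [map_add, map_add]; rfl
  map_smul' c v := by
    rw [map_smul, LinearMap.map_smul_of_tower]; rfl

theorem fiberFunctional_apply (l : Cₛ^∞⟮I; F, V⟯ →ₗ[C^∞⟮I, M; ℝ⟯] C^∞⟮I, M; ℝ⟯)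
    (s : Cₛ^∞⟮I; F, V⟯) (x : M) : fiberFunctional l x (s x) = l s x := by
  let t := (exists_linear_extension (I := I) (F := F) x).choose (s x)
  have ht : t x = s x := (exists_linear_extension (I := I) (F := F) x).choose_spec (s x)
  have h1 := functional_apply_eq_zero l (t - s) x (by
    change t x - s x = 0
    rw [ht, sub_self])
  rw [map_sub] at h1
  exact sub_eq_zero.1 h1

/-- `fiberFunctional` is continuous. -/
noncomputable def fiberFunctionalL (l : Cₛ^∞⟮I; F, V⟯ →ₗ[C^∞⟮I, M; ℝ⟯] C^∞⟮I, M; ℝ⟯) (x : M) :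
    V x →L[ℝ] ℝ :=
  (((fiberFunctional l x).comp ((trivializationAt F V x).symmL ℝ x).toLinearMap).toContinuousLinearMap
    ).comp ((trivializationAt F V x).continuousLinearMapAt ℝ x)

theorem fiberFunctionalL_apply (l : Cₛ^∞⟮I; F, V⟯ →ₗ[C^∞⟮I, M; ℝ⟯] C^∞⟮I, M; ℝ⟯)
    (s : Cₛ^∞⟮I; F, V⟯) (x : M) : fiberFunctionalL l x (s x) = l s x := by
  rw [← fiberFunctional_apply]
  change fiberFunctional l x ((trivializationAt F V x).symmL ℝ x
    ((trivializationAt F V x).continuousLinearMapAt ℝ x (s x))) = _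
  rw [(trivializationAt F V x).symmL_continuousLinearMapAt
    (FiberBundle.mem_baseSet_trivializationAt F V x)]

theorem fiberMap_eq (T : Module.End C^∞⟮I, M; ℝ⟯ Cₛ^∞⟮I; F, V⟯) (x : M) (L : Module.End ℝ (V x))
    (h : ∀ s, L (s x) = T s x) : fiberMap T x = L := by
  ext v
  obtain ⟨X, hX⟩ := exists_linear_extension (I := I) (F := F) (V := V) x
  rw [← hX v, fiberMap_apply, h]

theorem bundleTrace_apply (T : Module.End C^∞⟮I, M; ℝ⟯ Cₛ^∞⟮I; F, V⟯) (x : M) :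
    bundleTrace T x = LinearMap.trace ℝ (V x) (fiberMap T x) := rfl

/-- `bundleTrace` as a `C^∞(M)`-linear map. -/
noncomputable def traceLM :
    Module.End C^∞⟮I, M; ℝ⟯ Cₛ^∞⟮I; F, V⟯ →ₗ[C^∞⟮I, M; ℝ⟯] C^∞⟮I, M; ℝ⟯ where
  toFun := bundleTrace
  map_add' T T' := by
    ext x
    change _ = bundleTrace T x + bundleTrace T' x
    rw [bundleTrace_apply, fiberMap_eq (T + T') x (fiberMap T x + fiberMap T' x) fun s => by
      rw [LinearMap.add_apply, fiberMap_apply, fiberMap_apply]; rfl, map_add]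
    rfl
  map_smul' f T := by
    ext x
    change _ = f x * bundleTrace T x
    rw [bundleTrace_apply, fiberMap_eq (f • T) x (f x • fiberMap T x) fun s => by
      rw [LinearMap.smul_apply, fiberMap_apply]; rfl, map_smul]
    rfl

theorem traceLM_apply (T : Module.End C^∞⟮I, M; ℝ⟯ Cₛ^∞⟮I; F, V⟯) : traceLM T = bundleTrace T := rfl

theorem traceLM_mul_comm (T T' : Module.End C^∞⟮I, M; ℝ⟯ Cₛ^∞⟮I; F, V⟯) :
    traceLM (T * T') = traceLM (T' * T) := by
  have h : ∀ (T T' : Module.End C^∞⟮I, M; ℝ⟯ Cₛ^∞⟮I; F, V⟯) x,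
      fiberMap (T * T') x = fiberMap T x * fiberMap T' x := fun T T' x =>
    fiberMap_eq _ x _ fun s => by
      rw [Module.End.mul_apply, fiberMap_apply, fiberMap_apply, Module.End.mul_apply]
  ext x
  rw [traceLM_apply, traceLM_apply, bundleTrace_apply, bundleTrace_apply, h, h,
    LinearMap.trace_mul_comm]

theorem traceLM_smulRight (l : Cₛ^∞⟮I; F, V⟯ →ₗ[C^∞⟮I, M; ℝ⟯] C^∞⟮I, M; ℝ⟯)
    (s : Cₛ^∞⟮I; F, V⟯) : traceLM (l.smulRight s) = l s := by
  ext x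
  have : FiniteDimensional ℝ (V x) := VectorBundle.finiteDimensional ℝ F V x
  rw [traceLM_apply, bundleTrace_apply, fiberMap_eq (l.smulRight s) x
    ((fiberFunctional l x).smulRight (s x)) fun t => by
      rw [LinearMap.smulRight_apply, fiberFunctional_apply]; rfl, ← fiberFunctional_apply]
  simp

/-- The resolution makes `φ • T` a sum of the rank-one operators `lᵢ ⊗ T σᵢ`, whose traces are `lᵢ(T
σᵢ)`. Locally this makes the trace an algebraic expression in functions. -/
theorem mul_traceLM {ι : Type*} [Fintype ι] {σ : ι → Cₛ^∞⟮I; F, V⟯}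
    {l : ι → Cₛ^∞⟮I; F, V⟯ →ₗ[C^∞⟮I, M; ℝ⟯] C^∞⟮I, M; ℝ⟯} {φ : C^∞⟮I, M; ℝ⟯}
    (h : ∀ s, φ • s = ∑ i, l i s • σ i) (T : Module.End C^∞⟮I, M; ℝ⟯ Cₛ^∞⟮I; F, V⟯) :
    φ * traceLM T = ∑ i, l i (T (σ i)) := by
  have h1 : φ • T = ∑ i, (l i).smulRight (T (σ i)) := by
    refine LinearMap.ext fun s => ?_
    rw [LinearMap.smul_apply, ← map_smul, h, map_sum, LinearMap.sum_apply]
    simp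
  rw [← smul_eq_mul, ← map_smul, h1, map_sum]
  simp only [traceLM_smulRight]

/-- The commutator of an endomorphism with a covariant derivative operator. -/
noncomputable def covEnd (N : Cₛ^∞⟮I; F, V⟯ →ₗ[ℝ] Cₛ^∞⟮I; F, V⟯)
    (D : Derivation ℝ C^∞⟮I, M; ℝ⟯ C^∞⟮I, M; ℝ⟯) (hN : ∀ f s, N (f • s) = f • N s + D f • s) :
    Module.End C^∞⟮I, M; ℝ⟯ Cₛ^∞⟮I; F, V⟯ →+ Module.End C^∞⟮I, M; ℝ⟯ Cₛ^∞⟮I; F, V⟯ where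
  toFun T :=
    { toFun := fun s => N (T s) - T (N s)
      map_add' := fun s t => by simp only [map_add]; abel
      map_smul' := fun f s => by
        simp only [map_smul, hN, map_add, RingHom.id_apply, smul_sub]; abel }
  map_zero' := by ext s; simp
  map_add' T T' := by
    refine LinearMap.ext fun s => ?_
    simp only [LinearMap.coe_mk, AddHom.coe_mk, LinearMap.add_apply, map_add]
    abel

theorem covEnd_apply (N : Cₛ^∞⟮I; F, V⟯ →ₗ[ℝ] Cₛ^∞⟮I; F, V⟯)
    (D : Derivation ℝ C^∞⟮I, M; ℝ⟯ C^∞⟮I, M; ℝ⟯) (hN : ∀ f s, N (f • s) = f • N s + D f • s)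
    (T : Module.End C^∞⟮I, M; ℝ⟯ Cₛ^∞⟮I; F, V⟯) (s : Cₛ^∞⟮I; F, V⟯) :
    covEnd N D hN T s = N (T s) - T (N s) := rfl

theorem covEnd_mul (N : Cₛ^∞⟮I; F, V⟯ →ₗ[ℝ] Cₛ^∞⟮I; F, V⟯)
    (D : Derivation ℝ C^∞⟮I, M; ℝ⟯ C^∞⟮I, M; ℝ⟯) (hN : ∀ f s, N (f • s) = f • N s + D f • s)
    (T T' : Module.End C^∞⟮I, M; ℝ⟯ Cₛ^∞⟮I; F, V⟯) :
    covEnd N D hN (T * T') = covEnd N D hN T * T' + T * covEnd N D hN T' := by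
  refine LinearMap.ext fun s => ?_
  simp only [covEnd_apply, Module.End.mul_apply, LinearMap.add_apply, map_sub]
  abel

/-- The trace intertwines the commutator with `∇` and the derivation of functions. -/
theorem traceLM_covEnd (N : Cₛ^∞⟮I; F, V⟯ →ₗ[ℝ] Cₛ^∞⟮I; F, V⟯)
    (D : Derivation ℝ C^∞⟮I, M; ℝ⟯ C^∞⟮I, M; ℝ⟯) (hN : ∀ f s, N (f • s) = f • N s + D f • s)
    (T : Module.End C^∞⟮I, M; ℝ⟯ Cₛ^∞⟮I; F, V⟯) :
    traceLM (covEnd N D hN T) = D (traceLM T) := by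
  refine smooth_ext_of_local fun x => ?_
  obtain ⟨ι, _, σ, l, φ, hφ, hf, -, -⟩ := exists_dual_frame (I := I) (F := F) (V := V) x
  refine ⟨φ, hφ, ?_⟩
  -- The dual connection applied to `lᵢ`.
  let l' : ι → Cₛ^∞⟮I; F, V⟯ →ₗ[C^∞⟮I, M; ℝ⟯] C^∞⟮I, M; ℝ⟯ := fun i =>
    { toFun := fun s => D (l i s) - l i (N s)
      map_add' := fun s t => by simp only [map_add]; abel
      map_smul' := fun f s => by
        simp only [map_smul, hN, map_add, smul_eq_mul, Derivation.leibniz, RingHom.id_apply]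
        ring }
  have hl' : ∀ i s, l' i s = D (l i s) - l i (N s) := fun _ _ => rfl
  -- Apply `N` to `φ • s = ∑ lᵢ(s) • σᵢ`, remove the part coming from `N s`, and compose with `T`.
  have hQ : D φ • T = ∑ i, ((l' i).smulRight (T (σ i)) + (l i).smulRight (T (N (σ i)))) := by
    refine LinearMap.ext fun s => ?_
    have h1 : D φ • s = ∑ i, (l' i s • σ i + l i s • N (σ i)) := by
      have h2 := hN φ s
      rw [hf, hf, map_sum] at h2
      have h3 : D φ • s = ∑ i, N (l i s • σ i) - ∑ i, l i (N s) • σ i := by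
        rw [h2]; abel
      rw [h3, ← Finset.sum_sub_distrib]
      refine Finset.sum_congr rfl fun i _ => ?_
      rw [hN, hl', sub_smul]
      abel
    rw [LinearMap.smul_apply, ← map_smul, h1, map_sum, LinearMap.sum_apply]
    simp
  have hQ' := congrArg traceLM hQ
  rw [map_smul, map_sum, smul_eq_mul] at hQ'
  simp only [map_add, traceLM_smulRight] at hQ'
  -- Differentiate `φ · tr T = ∑ lᵢ(T σᵢ)`. The unwanted term `Dφ · tr T` is known from the trace of
  -- `hQ`, and the difference is `∑ lᵢ([N, T] σᵢ)`.
  have h1 := congrArg D (mul_traceLM hf T)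
  rw [Derivation.leibniz, map_sum, smul_eq_mul, smul_eq_mul, mul_comm (traceLM T), hQ'] at h1
  rw [mul_traceLM hf, eq_sub_of_add_eq h1, ← Finset.sum_sub_distrib]
  refine Finset.sum_congr rfl fun i _ => ?_
  rw [covEnd_apply, map_sub, hl']
  ring

end Bundle

/-! ### The gradient `𝒟 f` and the identity `ρ ∘ 𝒟 = 0` -/

namespace CourantAlgebroid

variable {EM HM M : Type*} [NormedAddCommGroup EM] [NormedSpace ℝ EM]
  [TopologicalSpace HM] {I : ModelWithCorners ℝ EM HM} [TopologicalSpace M] [ChartedSpace HM M]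
  [IsManifold I ∞ M]
  {F : Type*} [NormedAddCommGroup F] [NormedSpace ℝ F]
  {E : M → Type*} [TopologicalSpace (TotalSpace F E)] [∀ x, TopologicalSpace (E x)]
  [FiberBundle F E] [∀ x, AddCommGroup (E x)] [∀ x, Module ℝ (E x)] [VectorBundle ℝ F E]
  [FiniteDimensional ℝ EM] [T2Space M] [FiniteDimensional ℝ F] [ContMDiffVectorBundle ∞ F E I]
  (𝒞 : CourantAlgebroid I F E)

theorem exists_section_apply_eq (x : M) (v : E x) : ∃ s : Cₛ^∞⟮I; F, E⟯, s x = v := by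
  obtain ⟨X, hX⟩ := exists_linear_extension (I := I) (F := F) (V := E) x
  exact ⟨X v, hX v⟩

theorem form_ext {x : M} {v w : E x} (h : ∀ s : Cₛ^∞⟮I; F, E⟯,
    𝒞.pairing.form x v (s x) = 𝒞.pairing.form x w (s x)) : v = w := by
  refine sub_eq_zero.1 (𝒞.pairing.nondegenerate x _ fun u => ?_)
  obtain ⟨s, rfl⟩ := exists_section_apply_eq (I := I) (F := F) x u
  rw [map_sub, sub_apply, h, sub_self]

theorem pair_apply (a b : Cₛ^∞⟮I; F, E⟯) (x : M) :
    𝒞.pairing.pair a b x = 𝒞.pairing.form x (a x) (b x) := rfl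

theorem pair_ext {s t : Cₛ^∞⟮I; F, E⟯} (h : ∀ e, 𝒞.pairing.pair s e = 𝒞.pairing.pair t e) :
    s = t := by
  ext x
  exact 𝒞.form_ext fun e => congrArg (fun f : C^∞⟮I, M; ℝ⟯ => f x) (h e)

theorem pair_smul_right (a b : Cₛ^∞⟮I; F, E⟯) (f : C^∞⟮I, M; ℝ⟯) :
    𝒞.pairing.pair a (f • b) = f * 𝒞.pairing.pair a b := by
  ext x
  rw [pair_apply, sec_smul_apply, map_smul]
  rfl

theorem pair_smul_left (a b : Cₛ^∞⟮I; F, E⟯) (f : C^∞⟮I, M; ℝ⟯) :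
    𝒞.pairing.pair (f • a) b = f * 𝒞.pairing.pair a b := by
  ext x
  rw [pair_apply, sec_smul_apply, map_smul]
  rfl

theorem pair_add_left (a a' b : Cₛ^∞⟮I; F, E⟯) :
    𝒞.pairing.pair (a + a') b = 𝒞.pairing.pair a b + 𝒞.pairing.pair a' b := by
  ext x
  rw [pair_apply, sec_add_apply, map_add]
  rfl

theorem fiber_trivial_or (x : M) : (∀ v : E x, v = 0) ∨ ∃ a b : Cₛ^∞⟮I; F, E⟯,
    𝒞.pairing.pair a b x ≠ 0 := by
  by_contra! h
  obtain ⟨⟨v, hv⟩, h2⟩ := h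
  refine hv (𝒞.pairing.nondegenerate x v fun w => ?_)
  obtain ⟨a, rfl⟩ := exists_section_apply_eq (I := I) (F := F) x v
  obtain ⟨b, rfl⟩ := exists_section_apply_eq (I := I) (F := F) x w
  exact h2 a b

/-- The section `𝒟 f` with `⟨𝒟 f, e⟩ = ρ(e)(f)`. -/
theorem exists_gradient (f : C^∞⟮I, M; ℝ⟯) :
    ∃ s : Cₛ^∞⟮I; F, E⟯, ∀ e, 𝒞.pairing.pair s e = 𝒞.anchor.der e f := by
  -- If some fibre is zero then the whole bundle is, and the zero section works.
  by_cases hE : ∃ x, ∀ v : E x, v = 0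
  · obtain ⟨x, hx⟩ := hE
    refine ⟨0, fun e => ?_⟩
    ext y
    rw [pair_apply, fiber_eq_zero F hx y (e y), map_zero, 𝒞.anchor.der_apply,
      fiber_eq_zero F hx y (e y), map_zero, map_zero]
  push Not at hE
  have hloc : ∀ x, ∃ (h : C^∞⟮I, M; ℝ⟯) (t : Cₛ^∞⟮I; F, E⟯), h x ≠ 0 ∧
      ∀ e, 𝒞.pairing.pair t e = h * 𝒞.anchor.der e f := by
    intro x
    obtain h | ⟨a, b, hab⟩ := 𝒞.fiber_trivial_or x
    · obtain ⟨v, hv⟩ := hE x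
      exact absurd (h v) hv
    -- By the symmetry axiom this section is `𝒟(f⟨a,b⟩) - f 𝒟⟨a,b⟩`, so it represents `⟨a,b⟩ 𝒟 f`.
    -- Dividing by `⟨a,b⟩` gives `𝒟 f` where the pairing does not vanish.
    · refine ⟨𝒞.pairing.pair a b, (𝒞.bracket a (f • b) + 𝒞.bracket (f • b) a) +
        (-f) • (𝒞.bracket a b + 𝒞.bracket b a), hab, fun e => ?_⟩
      rw [𝒞.pair_add_left, 𝒞.pair_smul_left, 𝒞.bracket_symm, 𝒞.bracket_symm, 𝒞.pair_smul_right,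
        Derivation.leibniz]
      simp only [smul_eq_mul]
      ring
  choose h t hne ht using hloc
  have hv : ∀ x y, h x y ≠ 0 → ∀ e : Cₛ^∞⟮I; F, E⟯,
      𝒞.pairing.form y ((h x y)⁻¹ • t x y) (e y) = 𝒞.anchor.der e f y := by
    intro x y hy e
    have h1 := congrArg (fun g : C^∞⟮I, M; ℝ⟯ => g y) (ht x e)
    rw [pair_apply, smooth_mul_apply] at h1
    rw [map_smul, smul_apply, h1, smul_eq_mul, inv_mul_cancel_left₀ hy]
  -- At each `y` the local solution chosen at `y` itself is used. By nondegeneracy it agrees near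
  -- `x` with the single smooth solution chosen at `x`.
  have hsm : ContMDiff I (I.prod 𝓘(ℝ, F)) ∞
      (fun y => TotalSpace.mk' F y ((h y y)⁻¹ • t y y)) := by
    intro x
    have h1 : ContMDiffAt I (I.prod 𝓘(ℝ, F)) ∞
        (fun y => TotalSpace.mk' F y ((h x y)⁻¹ • t x y)) x :=
      ((h x).contMDiff.contMDiffAt.inv₀ (hne x)).smul_section (t x).contMDiff.contMDiffAt
    refine h1.congr_of_eventuallyEq ?_
    filter_upwards [(h x).contMDiff.continuous.continuousAt.eventually_ne (hne x)] with y hy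
    congr 1
    exact 𝒞.form_ext fun e => (hv y y (hne y) e).trans (hv x y hy e).symm
  exact ⟨⟨_, hsm⟩, fun e => by ext y; exact hv y y (hne y) e⟩

/-- The section `𝒟 f`. -/
noncomputable def gradient (f : C^∞⟮I, M; ℝ⟯) : Cₛ^∞⟮I; F, E⟯ := (𝒞.exists_gradient f).choose

theorem pair_gradient (f : C^∞⟮I, M; ℝ⟯) (e : Cₛ^∞⟮I; F, E⟯) :
    𝒞.pairing.pair (𝒞.gradient f) e = 𝒞.anchor.der e f := (𝒞.exists_gradient f).choose_spec e

theorem gradient_add (f g : C^∞⟮I, M; ℝ⟯) :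
    𝒞.gradient (f + g) = 𝒞.gradient f + 𝒞.gradient g :=
  𝒞.pair_ext fun e => by rw [𝒞.pair_add_left]; simp only [pair_gradient, map_add]

theorem gradient_mul (f g : C^∞⟮I, M; ℝ⟯) :
    𝒞.gradient (f * g) = f • 𝒞.gradient g + g • 𝒞.gradient f :=
  𝒞.pair_ext fun e => by
    rw [𝒞.pair_add_left, 𝒞.pair_smul_left, 𝒞.pair_smul_left]
    simp only [pair_gradient, Derivation.leibniz, smul_eq_mul]

theorem bracket_add_bracket (a b : Cₛ^∞⟮I; F, E⟯) :
    𝒞.bracket a b + 𝒞.bracket b a = 𝒞.gradient (𝒞.pairing.pair a b) :=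
  𝒞.pair_ext fun e => by rw [𝒞.bracket_symm, pair_gradient]

theorem der_smul_apply (f : C^∞⟮I, M; ℝ⟯) (e : Cₛ^∞⟮I; F, E⟯) (g : C^∞⟮I, M; ℝ⟯) :
    𝒞.anchor.der (f • e) g = f * 𝒞.anchor.der e g := by
  ext x
  rw [𝒞.anchor.der_apply, sec_smul_apply, map_smul, map_smul]
  rfl

theorem der_add_apply (e e' : Cₛ^∞⟮I; F, E⟯) (g : C^∞⟮I, M; ℝ⟯) :
    𝒞.anchor.der (e + e') g = 𝒞.anchor.der e g + 𝒞.anchor.der e' g := by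
  ext x
  rw [𝒞.anchor.der_apply, sec_add_apply, map_add, map_add]
  rfl

/-- For `f = ⟨a,b⟩` the gradient is a symmetrised bracket, which the anchor maps to a sum of two
opposite commutators. In general expand `𝒟(f⟨a,b⟩)` by the Leibniz rule and divide by `⟨a,b⟩`; where
the fibre is zero there is nothing to prove. -/
theorem der_gradient (f g : C^∞⟮I, M; ℝ⟯) : 𝒞.anchor.der (𝒞.gradient f) g = 0 := by
  have h0 : ∀ a b, 𝒞.anchor.der (𝒞.gradient (𝒞.pairing.pair a b)) g = 0 := fun a b => by
    rw [← bracket_add_bracket, der_add_apply, anchor_bracket, anchor_bracket]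
    abel
  ext x
  obtain h | ⟨a, b, hab⟩ := 𝒞.fiber_trivial_or x
  · rw [𝒞.anchor.der_apply, h (𝒞.gradient f x), map_zero, map_zero]
    rfl
  · have h1 := h0 a (f • b)
    rw [𝒞.pair_smul_right, gradient_mul, der_add_apply, der_smul_apply, der_smul_apply, h0,
      mul_zero, zero_add] at h1
    have h2 := congrArg (fun k : C^∞⟮I, M; ℝ⟯ => k x) h1
    exact (mul_eq_zero.1 h2).resolve_left hab

end CourantAlgebroid
-- Smooth families of sections and endomorphisms
section EndFamilies

variable {EM HM M : Type*} [NormedAddCommGroup EM] [NormedSpace ℝ EM]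
  [TopologicalSpace HM] {I : ModelWithCorners ℝ EM HM} [TopologicalSpace M] [ChartedSpace HM M]
  {FB : Type*} [NormedAddCommGroup FB] [NormedSpace ℝ FB]
  {B : M → Type*} [TopologicalSpace (TotalSpace FB B)] [∀ x, TopologicalSpace (B x)]
  [FiberBundle FB B] [∀ x, AddCommGroup (B x)] [∀ x, Module ℝ (B x)] [VectorBundle ℝ FB B]
  [IsManifold I ∞ M]

/-- Smooth families of sections, tested on `C^∞(M)`-linear functionals. -/
def IsSmoothSec (s : unitInterval → Cₛ^∞⟮I; FB, B⟯) : Prop :=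
  ∀ l : Cₛ^∞⟮I; FB, B⟯ →ₗ[C^∞⟮I, M; ℝ⟯] C^∞⟮I, M; ℝ⟯, IsSmoothFamily fun t => l (s t)

/-- `s'` is the time derivative of the smooth family `s` of sections. -/
def HasSecDeriv (s s' : unitInterval → Cₛ^∞⟮I; FB, B⟯) : Prop :=
  ∀ l : Cₛ^∞⟮I; FB, B⟯ →ₗ[C^∞⟮I, M; ℝ⟯] C^∞⟮I, M; ℝ⟯,
    HasFamilyDeriv (fun t => l (s t)) fun t => l (s' t)

/-- Smooth families of endomorphisms. -/
def IsSmoothEnd (T : unitInterval → Module.End C^∞⟮I, M; ℝ⟯ Cₛ^∞⟮I; FB, B⟯) : Prop :=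
  ∀ b, IsSmoothSec fun t => T t b

/-- `T'` is the time derivative of the smooth family `T` of endomorphisms. -/
def HasEndDeriv (T T' : unitInterval → Module.End C^∞⟮I, M; ℝ⟯ Cₛ^∞⟮I; FB, B⟯) : Prop :=
  ∀ b, HasSecDeriv (fun t => T t b) fun t => T' t b

variable {s s' u u' : unitInterval → Cₛ^∞⟮I; FB, B⟯}
  {T T' U U' : unitInterval → Module.End C^∞⟮I, M; ℝ⟯ Cₛ^∞⟮I; FB, B⟯}

theorem HasSecDeriv.add (hs : HasSecDeriv s s') (hu : HasSecDeriv u u') :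
    HasSecDeriv (fun t => s t + u t) fun t => s' t + u' t := fun l => by
  simpa only [map_add] using (hs l).add (hu l)

theorem HasSecDeriv.sub (hs : HasSecDeriv s s') (hu : HasSecDeriv u u') :
    HasSecDeriv (fun t => s t - u t) fun t => s' t - u' t := fun l => by
  simpa only [map_sub] using (hs l).sub (hu l)

theorem HasSecDeriv.smooth (hs : HasSecDeriv s s') : IsSmoothSec s := fun l => (hs l).smooth

theorem HasSecDeriv.smooth_deriv (hs : HasSecDeriv s s') : IsSmoothSec s' :=
  fun l => (hs l).smooth_deriv

theorem HasEndDeriv.smooth (hT : HasEndDeriv T T') : IsSmoothEnd T := fun b => (hT b).smooth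

theorem HasEndDeriv.const (T : Module.End C^∞⟮I, M; ℝ⟯ Cₛ^∞⟮I; FB, B⟯) :
    HasEndDeriv (fun _ => T) fun _ => 0 := fun b l => by
  simpa only [LinearMap.zero_apply, map_zero] using! HasFamilyDeriv.const (l (T b))

theorem HasEndDeriv.add (hT : HasEndDeriv T T') (hU : HasEndDeriv U U') :
    HasEndDeriv (fun t => T t + U t) fun t => T' t + U' t := fun b => (hT b).add (hU b)

theorem HasEndDeriv.neg (hT : HasEndDeriv T T') : HasEndDeriv (fun t => -T t) fun t => -T' t :=
  fun b l => by simpa only [LinearMap.neg_apply, map_neg] using (hT b l).neg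

theorem HasEndDeriv.intCast_smul (hT : HasEndDeriv T T') (n : ℕ) :
    HasEndDeriv (fun t => (-1 : ℤ) ^ n • T t) fun t => (-1 : ℤ) ^ n • T' t := by
  rcases neg_one_pow_eq_or ℤ n with h | h
  · simpa only [h, one_smul] using hT
  · simpa only [h, neg_smul, one_smul] using hT.neg

theorem IsSmoothEnd.const (T : Module.End C^∞⟮I, M; ℝ⟯ Cₛ^∞⟮I; FB, B⟯) :
    IsSmoothEnd fun _ => T := (HasEndDeriv.const T).smooth

theorem IsSmoothEnd.add (hT : IsSmoothEnd T) (hU : IsSmoothEnd U) :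
    IsSmoothEnd fun t => T t + U t := fun b l => by
  simpa only [LinearMap.add_apply, map_add] using (hT b l).add (hU b l)

theorem IsSmoothEnd.neg (hT : IsSmoothEnd T) : IsSmoothEnd fun t => -T t :=
  fun b l => by simpa only [LinearMap.neg_apply, map_neg] using (hT b l).neg

theorem IsSmoothEnd.intCast_smul (hT : IsSmoothEnd T) (n : ℕ) :
    IsSmoothEnd fun t => (-1 : ℤ) ^ n • T t := by
  rcases neg_one_pow_eq_or ℤ n with h | h
  · simpa only [h, one_smul] using hT
  · simpa only [h, neg_smul, one_smul] using hT.neg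

variable [FiniteDimensional ℝ EM] [T2Space M] [FiniteDimensional ℝ FB]
  [ContMDiffVectorBundle ∞ FB B I]

/-- This separates `T` from `s`: after multiplication by a cutoff, `l(T s)` is a sum of products of
functions, one depending only on `s` and one only on `T`. Product rules for endomorphisms acting on
sections then follow from that for functions. -/
theorem mul_functional_comp {ι : Type*} [Fintype ι] {σ : ι → Cₛ^∞⟮I; FB, B⟯}
    {k : ι → Cₛ^∞⟮I; FB, B⟯ →ₗ[C^∞⟮I, M; ℝ⟯] C^∞⟮I, M; ℝ⟯} {φ : C^∞⟮I, M; ℝ⟯}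
    (h : ∀ s, φ • s = ∑ i, k i s • σ i) (l : Cₛ^∞⟮I; FB, B⟯ →ₗ[C^∞⟮I, M; ℝ⟯] C^∞⟮I, M; ℝ⟯)
    (T : Module.End C^∞⟮I, M; ℝ⟯ Cₛ^∞⟮I; FB, B⟯) (s : Cₛ^∞⟮I; FB, B⟯) :
    φ * l (T s) = ∑ i, k i s * l (T (σ i)) := by
  rw [← smul_eq_mul, ← map_smul, ← map_smul, h, map_sum, map_sum]
  simp only [map_smul, smul_eq_mul]

theorem isSmoothSec_of_contMDiffOn (h : ContMDiffOn (𝓘(ℝ, ℝ).prod I) (I.prod 𝓘(ℝ, FB)) ∞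
    (fun p : ℝ × M => TotalSpace.mk' FB p.2 (s (projIcc 0 1 zero_le_one p.1) p.2))
    (Icc 0 1 ×ˢ univ)) : IsSmoothSec s := fun l => by
  refine .of_local fun x => ?_
  obtain ⟨ι, _, σ, k, φ, hφ, hf, -, hk⟩ := exists_dual_frame (I := I) (F := FB) (V := B) x
  refine ⟨φ, hφ, ?_⟩
  have h1 : ∀ t, φ * l (s t) = ∑ i, k i (s t) * l (σ i) := fun t =>
    mul_functional_comp hf l LinearMap.id (s t)
  simp only [h1]
  exact .sum _ fun i => (hk s h i).mul (.const _)

theorem HasEndDeriv.apply (hT : HasEndDeriv T T') (hs : HasSecDeriv s s') :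
    HasSecDeriv (fun t => T t (s t)) fun t => T' t (s t) + T t (s' t) := fun l => by
  refine .of_local fun x => ?_
  obtain ⟨ι, _, σ, k, φ, hφ, hf, -, -⟩ := exists_dual_frame (I := I) (F := FB) (V := B) x
  refine ⟨φ, hφ, ?_⟩
  simp only [map_add, mul_add, mul_functional_comp hf l, ← Finset.sum_add_distrib]
  refine HasFamilyDeriv.sum _ fun i => ?_
  simpa only [add_comm] using (hs (k i)).mul (hT (σ i) l)

theorem IsSmoothEnd.apply (hT : IsSmoothEnd T) (hs : IsSmoothSec s) :
    IsSmoothSec fun t => T t (s t) := fun l => by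
  refine .of_local fun x => ?_
  obtain ⟨ι, _, σ, k, φ, hφ, hf, -, -⟩ := exists_dual_frame (I := I) (F := FB) (V := B) x
  refine ⟨φ, hφ, ?_⟩
  simp only [mul_functional_comp hf l]
  exact .sum _ fun i => (hs (k i)).mul (hT (σ i) l)

theorem HasEndDeriv.mul (hT : HasEndDeriv T T') (hU : HasEndDeriv U U') :
    HasEndDeriv (fun t => T t * U t) fun t => T' t * U t + T t * U' t :=
  fun b => hT.apply (hU b)

theorem IsSmoothEnd.mul (hT : IsSmoothEnd T) (hU : IsSmoothEnd U) :
    IsSmoothEnd fun t => T t * U t :=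
  fun b => hT.apply (hU b)

theorem HasEndDeriv.trace (hT : HasEndDeriv T T') :
    HasFamilyDeriv (fun t => traceLM (T t)) fun t => traceLM (T' t) := by
  refine .of_local fun x => ?_
  obtain ⟨ι, _, σ, k, φ, hφ, hf, -, -⟩ := exists_dual_frame (I := I) (F := FB) (V := B) x
  refine ⟨φ, hφ, ?_⟩
  simp only [mul_traceLM hf]
  exact .sum _ fun i => hT (σ i) (k i)

theorem IsSmoothEnd.trace (hT : IsSmoothEnd T) : IsSmoothFamily fun t => traceLM (T t) := by
  refine .of_local fun x => ?_
  obtain ⟨ι, _, σ, k, φ, hφ, hf, -, -⟩ := exists_dual_frame (I := I) (F := FB) (V := B) x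
  refine ⟨φ, hφ, ?_⟩
  simp only [mul_traceLM hf]
  exact .sum _ fun i => hT (σ i) (k i)

section List

open ListCochain

variable {S : Type*}
  {η η' ψ ψ' : unitInterval → ListCochain S (Module.End C^∞⟮I, M; ℝ⟯ Cₛ^∞⟮I; FB, B⟯)}

theorem HasEndDeriv.grade (h : ∀ l, HasEndDeriv (fun t => η t l) fun t => η' t l) (l : List S) :
    HasEndDeriv (fun t => grade (η t) l) fun t => grade (η' t) l :=
  (h l).intCast_smul _

theorem HasEndDeriv.list_mul (hη : ∀ l, HasEndDeriv (fun t => η t l) fun t => η' t l)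
    (hψ : ∀ l, HasEndDeriv (fun t => ψ t l) fun t => ψ' t l) (l : List S) :
    HasEndDeriv (fun t => (η t * ψ t) l) fun t => (η' t * ψ t + η t * ψ' t) l := by
  induction l generalizing η η' ψ ψ' with
  | nil => exact (hη []).mul (hψ [])
  | cons e l ih =>
    have h1 := ih (η := fun t => contract e (η t)) (η' := fun t => contract e (η' t))
      (fun l => hη (e :: l)) hψ
    have h2 := ih (η := fun t => ListCochain.grade (η t))
      (η' := fun t => ListCochain.grade (η' t)) (ψ := fun t => contract e (ψ t))
      (ψ' := fun t => contract e (ψ' t)) (HasEndDeriv.grade hη) (fun l => hψ (e :: l))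
    have h3 := h1.add h2
    simp only [mul_cons, ListCochain.add_apply] at h3 ⊢
    convert h3 using 2
    abel

theorem IsSmoothEnd.list_mul (hη : ∀ l, IsSmoothEnd fun t => η t l)
    (hψ : ∀ l, IsSmoothEnd fun t => ψ t l) (l : List S) :
    IsSmoothEnd fun t => (η t * ψ t) l := by
  induction l generalizing η ψ with
  | nil => exact (hη []).mul (hψ [])
  | cons e l ih =>
    exact (ih (η := fun t => contract e (η t)) (fun l => hη (e :: l)) hψ).add
      (ih (η := fun t => ListCochain.grade (η t)) (ψ := fun t => contract e (ψ t))
        (fun l => (hη l).intCast_smul _) fun l => hψ (e :: l))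

end List
end EndFamilies

/-! ### Connections: curvature and Chern forms as list cochains -/

section Connections

open ListCochain

variable {EM HM M : Type*} [NormedAddCommGroup EM] [NormedSpace ℝ EM]
  [TopologicalSpace HM] {I : ModelWithCorners ℝ EM HM} [TopologicalSpace M] [ChartedSpace HM M]
  [IsManifold I ∞ M]
  {F : Type*} [NormedAddCommGroup F] [NormedSpace ℝ F]
  {E : M → Type*} [TopologicalSpace (TotalSpace F E)] [∀ x, TopologicalSpace (E x)]
  [FiberBundle F E] [∀ x, AddCommGroup (E x)] [∀ x, Module ℝ (E x)] [VectorBundle ℝ F E]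
  [FiniteDimensional ℝ EM] [T2Space M] [FiniteDimensional ℝ F] [ContMDiffVectorBundle ∞ F E I]
  {𝒞 : CourantAlgebroid I F E}
  {FB : Type*} [NormedAddCommGroup FB] [NormedSpace ℝ FB] [FiniteDimensional ℝ FB]
  {B : M → Type*} [TopologicalSpace (TotalSpace FB B)] [∀ x, TopologicalSpace (B x)]
  [FiberBundle FB B] [∀ x, AddCommGroup (B x)] [∀ x, Module ℝ (B x)] [VectorBundle ℝ FB B]
  [ContMDiffVectorBundle ∞ FB B I]

namespace CourantAlgebroid

/-- The Courant bracket as a plain operation. -/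
noncomputable def br (𝒞 : CourantAlgebroid I F E) (a b : Cₛ^∞⟮I; F, E⟯) : Cₛ^∞⟮I; F, E⟯ := 𝒞.bracket a b

/-- The action of sections of `E` on functions. -/
noncomputable def act (𝒞 : CourantAlgebroid I F E) (a : Cₛ^∞⟮I; F, E⟯) :
    C^∞⟮I, M; ℝ⟯ →+ C^∞⟮I, M; ℝ⟯ := (𝒞.anchor.der a).toLinearMap.toAddMonoidHom

end CourantAlgebroid

namespace EConnection

variable (D : EConnection 𝒞 FB B)

/-- The induced connection on `End B`. -/
noncomputable def cov (e : Cₛ^∞⟮I; F, E⟯) :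
    Module.End C^∞⟮I, M; ℝ⟯ Cₛ^∞⟮I; FB, B⟯ →+ Module.End C^∞⟮I, M; ℝ⟯ Cₛ^∞⟮I; FB, B⟯ :=
  covEnd (D.toFun e) (𝒞.anchor.der e) (D.leibniz e)

theorem cov_apply (e : Cₛ^∞⟮I; F, E⟯) (T : Module.End C^∞⟮I, M; ℝ⟯ Cₛ^∞⟮I; FB, B⟯)
    (b : Cₛ^∞⟮I; FB, B⟯) : D.cov e T b = D.toFun e (T b) - T (D.toFun e b) := rfl

theorem curvature_apply (e₁ e₂ : Cₛ^∞⟮I; F, E⟯) (b : Cₛ^∞⟮I; FB, B⟯) : D.curvature e₁ e₂ b =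
    D.toFun e₁ (D.toFun e₂ b) - D.toFun e₂ (D.toFun e₁ b) - D.toFun (𝒞.bracket e₁ e₂) b := rfl

/-- The curvature as a list cochain. -/
noncomputable def curvList :
    ListCochain Cₛ^∞⟮I; F, E⟯ (Module.End C^∞⟮I, M; ℝ⟯ Cₛ^∞⟮I; FB, B⟯) :=
  ⟨fun l => match l with
    | [a, b] => D.curvature a b
    | _ => 0⟩

theorem curvList_pair (a b : Cₛ^∞⟮I; F, E⟯) : D.curvList [a, b] = D.curvature a b := rfl

theorem homogeneous_curvList : Homogeneous 2 D.curvList := fun l hl => by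
  match l with
  | [] => rfl
  | [_] => rfl
  | [_, _] => exact absurd rfl hl
  | _ :: _ :: _ :: _ => rfl

theorem homogeneous_curvList_pow (k : ℕ) : Homogeneous (2 * k) (D.curvList ^ k) := by
  induction k with
  | zero => exact homogeneous_one
  | succ k ih => rw [pow_succ]; exact ih.mul D.homogeneous_curvList

theorem curvaturePow_eq (k : ℕ) :
    D.curvaturePow k = fun e => (D.curvList ^ k) (List.ofFn e) := by
  induction k with
  | zero => rfl
  | succ k ih =>
    funext e
    rw [pow_succ, ← cup_ofFn (D.homogeneous_curvList_pow k) D.homogeneous_curvList e,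
      curvaturePow, ih]
    rfl

/-- The Chern form as a list cochain. -/
noncomputable def chernList (k : ℕ) : ListCochain Cₛ^∞⟮I; F, E⟯ C^∞⟮I, M; ℝ⟯ :=
  mapVal traceLM.toAddMonoidHom (D.curvList ^ k)

theorem chern_eq (k : ℕ) : D.chern k = fun e => D.chernList k (List.ofFn e) := by
  funext e
  rw [chern, curvaturePow_eq]
  rfl

end EConnection

end Connections
-- Symbols and derivatives of powers
namespace ListCochain

variable {S A K : Type*} [AddCommGroup A] (br : S → S → S) (δ : S → A →+ A)

theorem lie_cons (e f : S) (φ : ListCochain S A) (l : List S) :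
    lie br δ e φ (f :: l) = lie br δ e (contract f φ) l - φ (br e f :: l) := rfl

theorem diff_cons (e : S) (φ : ListCochain S A) (l : List S) :
    diff br δ φ (e :: l) = lie br δ e φ l - diff br δ (contract e φ) l := rfl

theorem Homogeneous.lie {n : ℕ} {φ : ListCochain S A} (h : Homogeneous n φ) (e : S) :
    Homogeneous n (lie br δ e φ) := by
  intro l
  induction l generalizing n φ with
  | nil =>
    intro hl
    rw [lie_nil, h [] hl, map_zero]
  | cons f l ih =>
    intro hl
    rw [lie_cons, h (br e f :: l) hl, sub_zero]
    cases n with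
    | zero => rw [h.contract_zero, map_zero, zero_apply]
    | succ n => exact ih (h.contract f) fun hl' => hl (by rw [List.length_cons, hl'])

theorem Homogeneous.diff {n : ℕ} {φ : ListCochain S A} (h : Homogeneous n φ) :
    Homogeneous (n + 1) (diff br δ φ) := by
  intro l
  induction l generalizing n φ with
  | nil => intro _; rfl
  | cons f l ih =>
    intro hl
    rw [diff_cons, h.lie br δ f l fun hl' => hl (by rw [List.length_cons, hl'])]
    cases n with
    | zero => rw [h.contract_zero, map_zero, zero_apply, sub_zero]
    | succ n => rw [ih (h.contract f) fun hl' => hl (by rw [List.length_cons, hl']), sub_zero]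

/-- A map `K → ListCochain S A` satisfying the Leibniz rule. -/
structure IsSymbolDer [CommRing K] [Algebra ℝ K] [Module K A] (σ : K → ListCochain S A) : Prop where
  add (f g : K) : σ (f + g) = σ f + σ g
  mul (f g : K) : σ (f * g) = f • σ g + g • σ f
  const (c : ℝ) : σ (algebraMap ℝ K c) = 0

theorem isSymbolDer_zero [CommRing K] [Algebra ℝ K] [Module K A] :
    IsSymbolDer fun _ : K => (0 : ListCochain S A) :=
  ⟨fun _ _ => (add_zero 0).symm, fun f g => by simp, fun _ => rfl⟩

theorem IsSymbolDer.product {A : Type*} [CommRing K] [Algebra ℝ K] [Ring A] [Algebra K A]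
    {σ τ : K → ListCochain S A} (hσ : IsSymbolDer σ) (hτ : IsSymbolDer τ)
    (φ ψ : ListCochain S A) : IsSymbolDer fun f => σ f * ψ + φ * τ f where
  add f g := by
    rw [hσ.add, hτ.add, add_mul, mul_add]
    abel
  mul f g := by
    rw [hσ.mul, hτ.mul, add_mul, mul_add]
    simp only [smul_mul_assoc, mul_smul_comm, smul_add]
    abel
  const c := by rw [hσ.const, hτ.const, zero_mul, mul_zero, add_zero]

theorem IsSymbolDer.mapVal {A' : Type*} [CommRing K] [Algebra ℝ K] [Module K A] [AddCommGroup A']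
    [Module K A'] {σ : K → ListCochain S A} (hσ : IsSymbolDer σ) (T : A →ₗ[K] A') :
    IsSymbolDer fun f => mapVal T.toAddMonoidHom (σ f) where
  add f g := by rw [hσ.add, map_add]
  mul f g := by
    rw [hσ.mul, map_add]
    congr 1 <;> exact ext fun l => map_smul T _ _
  const c := by rw [hσ.const, map_zero]

/-- The derivation of `K` at a list of arguments. -/
noncomputable def IsSymbolDer.derivation [CommRing K] [Algebra ℝ K] {σ : K → ListCochain S K}
    (hσ : IsSymbolDer σ) (l : List S) : Derivation ℝ K K :=
  Derivation.mk'
    { toFun := fun f => σ f l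
      map_add' := fun f g => by rw [hσ.add]; rfl
      map_smul' := fun c f => by
        rw [Algebra.smul_def c f, hσ.mul, hσ.const, smul_zero, add_zero, RingHom.id_apply,
          Algebra.smul_def c (σ f l)]
        rfl }
    fun f g => by
      change σ (f * g) l = _
      rw [hσ.mul]
      rfl

/-- The recursor is the Leibniz expansion of the `k`-th power, that is `∑ φ^i · σ f · φ^(k-1-i)`.
The same expression describes time derivatives of powers below. -/
theorem hasSymbol_pow {A : Type*} [Ring A] {p : S → S → K} {φ : ListCochain S A}
    {σ : K → ListCochain S A} (h : HasSymbol p φ σ) (k : ℕ) :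
    HasSymbol p (φ ^ k) fun f => k.rec 0 fun j τ => τ * φ + φ ^ j * σ f := by
  induction k with
  | zero =>
    intro l₁ a b l₂
    rw [pow_zero, homogeneous_one _ (by simp), homogeneous_one _ (by simp), add_zero]
    rfl
  | succ k ih =>
    rw [pow_succ]
    exact ih.mul h

theorem isSymbolDer_pow {A : Type*} [CommRing K] [Algebra ℝ K] [Ring A] [Algebra K A]
    (φ : ListCochain S A) {σ : K → ListCochain S A} (h : IsSymbolDer σ) (k : ℕ) :
    IsSymbolDer fun f => (k.rec 0 fun j τ => τ * φ + φ ^ j * σ f : ListCochain S A) := by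
  induction k with
  | zero => exact isSymbolDer_zero
  | succ k ih => exact ih.product h (φ ^ k) φ

theorem linearLast_one {A : Type*} [Ring A] [CommRing K] [Algebra K A] [AddCommGroup S]
    [Module K S] : LinearLast (K := K) (1 : ListCochain S A) := by
  have h : ∀ (l : List S) (a : S), (1 : ListCochain S A) (l ++ [a]) = 0 := fun l a =>
    homogeneous_one _ (by simp)
  exact ⟨fun l a b => by simp only [h, add_zero], fun l f a => by simp only [h, smul_zero]⟩

theorem linearLast_pow {A : Type*} [Ring A] [CommRing K] [Algebra K A] [AddCommGroup S]
    [Module K S] {φ : ListCochain S A} (h : LinearLast (K := K) φ) (k : ℕ) :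
    LinearLast (K := K) (φ ^ k) := by
  induction k with
  | zero => rw [pow_zero]; exact linearLast_one
  | succ k ih => rw [pow_succ]; exact ih.mul h

theorem diff_pow_eq_zero {A : Type*} [Ring A] (δ : S → A →+ A)
    (hδ : ∀ e a b, δ e (a * b) = δ e a * b + a * δ e b) {φ : ListCochain S A}
    (h : ListCochain.diff br δ φ = 0) (k : ℕ) (h1 : ListCochain.diff br δ 1 = 0) :
    ListCochain.diff br δ (φ ^ k) = 0 := by
  induction k with
  | zero => rwa [pow_zero]
  | succ k ih => rw [pow_succ, diff_mul br δ hδ, ih, h, zero_mul, mul_zero, add_zero]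

/-- The derivative of a power under a trace: `tr (∑ φⁱ φ' φᵏ⁻ⁱ) = (k + 1) tr (φ' φᵏ)`. -/
theorem trace_powDeriv {A G : Type*} [Ring A] [AddCommGroup G] (tr : A →+ G)
    (htr : ∀ a b, tr (a * b) = tr (b * a)) (φ φ' : ListCochain S A)
    (hφ : grade φ = φ) (hφ' : grade φ' = φ') (k j : ℕ) :
    mapVal tr (((k + 1).rec 0 fun i τ => τ * φ + φ ^ i * φ' : ListCochain S A) * φ ^ j) =
      (k + 1) • mapVal tr (φ' * φ ^ (k + j)) := by
  have hpow : ∀ n, grade (φ ^ n) = φ ^ n := fun n => by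
    induction n with
    | zero => rw [pow_zero, grade_one]
    | succ n ih => rw [pow_succ, grade_mul, ih, hφ]
  -- Elements of even parity commute under the trace without sign. The extra factor `φ ^ j` in the
  -- statement is what keeps the induction on `k` going.
  have hcomm : ∀ χ ξ : ListCochain S A, grade χ = χ → grade ξ = ξ →
      mapVal tr (χ * ξ) = mapVal tr (ξ * χ) := fun χ ξ h1 h2 => by
    simpa using trace_mul_comm tr htr 0 0 χ ξ (by simpa using h1) (by simpa using h2)
  have hstep : ∀ k j, mapVal tr (φ ^ k * φ' * φ ^ j) = mapVal tr (φ' * φ ^ (k + j)) :=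
    fun k j => by
      rw [mul_assoc, hcomm _ _ (hpow k) (by rw [grade_mul, hφ', hpow]), mul_assoc, ← pow_add,
        add_comm]
  induction k generalizing j with
  | zero => simp
  | succ k ih =>
    have h1 : ((k + 1 + 1).rec 0 fun i τ => τ * φ + φ ^ i * φ' : ListCochain S A) =
      ((k + 1).rec 0 fun i τ => τ * φ + φ ^ i * φ' : ListCochain S A) * φ + φ ^ (k + 1) * φ' := rfl
    rw [h1, add_mul, map_add, hstep, mul_assoc, ← pow_succ', ih,
      show k + (j + 1) = k + 1 + j by omega]
    exact (succ_nsmul _ (k + 1)).symm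

end ListCochain

/-! ### Bianchi identity; Chern forms are cocycles -/

section Connections

open ListCochain

variable {EM HM M : Type*} [NormedAddCommGroup EM] [NormedSpace ℝ EM]
  [TopologicalSpace HM] {I : ModelWithCorners ℝ EM HM} [TopologicalSpace M] [ChartedSpace HM M]
  [IsManifold I ∞ M]
  {F : Type*} [NormedAddCommGroup F] [NormedSpace ℝ F]
  {E : M → Type*} [TopologicalSpace (TotalSpace F E)] [∀ x, TopologicalSpace (E x)]
  [FiberBundle F E] [∀ x, AddCommGroup (E x)] [∀ x, Module ℝ (E x)] [VectorBundle ℝ F E]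
  [FiniteDimensional ℝ EM] [T2Space M] [FiniteDimensional ℝ F] [ContMDiffVectorBundle ∞ F E I]
  {𝒞 : CourantAlgebroid I F E}
  {FB : Type*} [NormedAddCommGroup FB] [NormedSpace ℝ FB] [FiniteDimensional ℝ FB]
  {B : M → Type*} [TopologicalSpace (TotalSpace FB B)] [∀ x, TopologicalSpace (B x)]
  [FiberBundle FB B] [∀ x, AddCommGroup (B x)] [∀ x, Module ℝ (B x)] [VectorBundle ℝ FB B]
  [ContMDiffVectorBundle ∞ FB B I]

namespace EConnection

variable (D : EConnection 𝒞 FB B)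

theorem cov_mul (e : Cₛ^∞⟮I; F, E⟯) (T T' : Module.End C^∞⟮I, M; ℝ⟯ Cₛ^∞⟮I; FB, B⟯) :
    D.cov e (T * T') = D.cov e T * T' + T * D.cov e T' := covEnd_mul _ _ _ T T'

theorem cov_one (e : Cₛ^∞⟮I; F, E⟯) : D.cov e 1 = 0 :=
  LinearMap.ext fun s => by rw [cov_apply]; exact sub_self _

theorem trace_cov (e : Cₛ^∞⟮I; F, E⟯) (T : Module.End C^∞⟮I, M; ℝ⟯ Cₛ^∞⟮I; FB, B⟯) :
    𝒞.act e (traceLM T) = traceLM (D.cov e T) := 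
  (traceLM_covEnd (D.toFun e) (𝒞.anchor.der e) (D.leibniz e) T).symm

/-- The Bianchi identity. -/
theorem diff_curvList : diff 𝒞.br D.cov D.curvList = 0 := by
  have h := D.homogeneous_curvList.diff 𝒞.br D.cov
  refine ListCochain.ext fun l => ?_
  match l with
  | [] => rfl
  | [_] => exact h _ (by simp)
  | [_, _] => exact h _ (by simp)
  | _ :: _ :: _ :: _ :: l => exact h _ (by simp)
  -- Only degree three has content. There both sides expand into iterated covariant derivatives, and
  -- everything cancels once the double brackets are rewritten by Jacobi.
  | [a, b, c] =>
    refine LinearMap.ext fun s => ?_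
    simp only [diff_cons, lie_cons, lie_nil, diff_nil, contract_apply, curvList_pair, sub_zero,
      LinearMap.sub_apply, cov_apply, curvature_apply, CourantAlgebroid.br, map_sub, 𝒞.jacobi,
      ListCochain.zero_apply, LinearMap.zero_apply]
    abel

theorem diff_one : diff 𝒞.br D.cov 1 = 0 := by
  have h := homogeneous_one.diff 𝒞.br D.cov
  refine ListCochain.ext fun l => ?_
  match l with
  | [] => rfl
  | [a] =>
    rw [diff_cons, lie_nil, diff_nil, one_nil, cov_one, sub_zero]
    rfl
  | _ :: _ :: l => exact h _ (by simp)

theorem diff_curvList_pow (k : ℕ) : diff 𝒞.br D.cov (D.curvList ^ k) = 0 :=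
  diff_pow_eq_zero 𝒞.br D.cov D.cov_mul D.diff_curvList k D.diff_one

theorem diff_chernList (k : ℕ) : diff 𝒞.br 𝒞.act (D.chernList k) = 0 := by
  rw [chernList, diff_mapVal 𝒞.br D.cov _ _ D.trace_cov, diff_curvList_pow, map_zero]

/-- The endomorphism `-∇_{𝒟 f}`. -/
noncomputable def gradEnd (f : C^∞⟮I, M; ℝ⟯) : Module.End C^∞⟮I, M; ℝ⟯ Cₛ^∞⟮I; FB, B⟯ where
  toFun b := -D.toFun (𝒞.gradient f) b
  map_add' b c := by rw [map_add, neg_add]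
  map_smul' g b := by
    -- The Leibniz term is `ρ(𝒟 f)(g) = 0`.
    rw [D.leibniz, 𝒞.der_gradient, zero_smul, add_zero, RingHom.id_apply, smul_neg]

theorem gradEnd_apply (f : C^∞⟮I, M; ℝ⟯) (b : Cₛ^∞⟮I; FB, B⟯) :
    D.gradEnd f b = -D.toFun (𝒞.gradient f) b := rfl

/-- The symbol of the curvature. -/
noncomputable def curvSymbol (f : C^∞⟮I, M; ℝ⟯) :
    ListCochain Cₛ^∞⟮I; F, E⟯ (Module.End C^∞⟮I, M; ℝ⟯ Cₛ^∞⟮I; FB, B⟯) :=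
  ⟨fun l => match l with
    | [] => D.gradEnd f
    | _ => 0⟩

theorem gradient_algebraMap (c : ℝ) : 𝒞.gradient (algebraMap ℝ C^∞⟮I, M; ℝ⟯ c) = 0 :=
  𝒞.pair_ext fun e => by
    rw [𝒞.pair_gradient, Derivation.map_algebraMap]
    ext x
    rw [𝒞.pair_apply]
    change 0 = 𝒞.pairing.form x 0 (e x)
    rw [map_zero]
    rfl

theorem isSymbolDer_curvSymbol : IsSymbolDer D.curvSymbol where
  add f g := by
    refine ListCochain.ext fun l => ?_
    match l with
    | [] =>
      refine LinearMap.ext fun b => ?_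
      change D.gradEnd (f + g) b = D.gradEnd f b + D.gradEnd g b
      rw [gradEnd_apply, 𝒞.gradient_add, map_add, LinearMap.add_apply, neg_add]
      rfl
    | _ :: _ => exact (add_zero _).symm
  mul f g := by
    refine ListCochain.ext fun l => ?_
    match l with
    | [] =>
      refine LinearMap.ext fun b => ?_
      change D.gradEnd (f * g) b = f • D.gradEnd g b + g • D.gradEnd f b
      rw [gradEnd_apply, 𝒞.gradient_mul, map_add, LinearMap.add_apply, neg_add, D.smul_left,
        D.smul_left, gradEnd_apply, gradEnd_apply, smul_neg, smul_neg]
    | _ :: _ => exact (by rw [smul_zero, smul_zero, add_zero] :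
        (0 : Module.End C^∞⟮I, M; ℝ⟯ Cₛ^∞⟮I; FB, B⟯) = f • 0 + g • 0)
  const c := by
    refine ListCochain.ext fun l => ?_
    match l with
    | [] =>
      refine LinearMap.ext fun b => ?_
      change D.gradEnd _ b = 0
      rw [gradEnd_apply, gradient_algebraMap, map_zero, LinearMap.zero_apply, neg_zero]
    | _ :: _ => rfl

/-- The commutator part of the curvature is skew, so symmetrisation leaves only `-∇` along `⟦a,b⟧ +
⟦b,a⟧ = 𝒟⟨a,b⟩`. In degrees other than two all terms vanish. -/
theorem hasSymbol_curvList : HasSymbol 𝒞.pairing.pair D.curvList D.curvSymbol := by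
  intro l₁ a b l₂
  by_cases h : l₁.length + l₂.length = 0
  · obtain ⟨rfl, rfl⟩ : l₁ = [] ∧ l₂ = [] := by
      constructor <;> apply List.eq_nil_of_length_eq_zero <;> omega
    refine LinearMap.ext fun s => ?_
    change D.curvature a b s + D.curvature b a s = D.gradEnd _ s
    rw [gradEnd_apply, ← 𝒞.bracket_add_bracket, curvature_apply, curvature_apply, map_add,
      LinearMap.add_apply]
    abel
  · have h1 : ∀ c d, D.curvList (l₁ ++ c :: d :: l₂) = 0 := fun c d =>
      D.homogeneous_curvList _ (by simp only [List.length_append, List.length_cons]; omega)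
    rw [h1, h1, add_zero]
    match h2 : l₁ ++ l₂ with
    | [] => exact absurd (by rw [← List.length_append, h2]; rfl) h
    | _ :: _ => rfl

theorem linearLast_curvList : LinearLast (K := C^∞⟮I, M; ℝ⟯) D.curvList := by
  constructor
  · intro l a b
    match l with
    | [] => exact (add_zero _).symm
    | [c] =>
      refine LinearMap.ext fun s => ?_
      change D.curvature c (a + b) s = D.curvature c a s + D.curvature c b s
      simp only [curvature_apply, map_add, LinearMap.add_apply]
      abel
    | [_, _] => exact (add_zero _).symm
    | _ :: _ :: _ :: _ => exact (add_zero _).symm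
  · intro l f a
    match l with
    | [] => exact (smul_zero _).symm
    | [c] =>
      refine LinearMap.ext fun s => ?_
      change D.curvature c (f • a) s = f • D.curvature c a s
      -- The term `ρ(c)(f) ∇_a s` from the Leibniz rule of `∇_c` cancels against the one from the
      -- bracket `⟦c, f a⟧`.
      simp only [curvature_apply, D.smul_left, D.leibniz, 𝒞.bracket_smul, map_add,
        LinearMap.add_apply, smul_sub]
      abel
    | [_, _] => exact (smul_zero _).symm
    | _ :: _ :: _ :: _ => exact (smul_zero _).symm

theorem chern_mem_cochains (k n : ℕ) :
    (fun e : Fin n → Cₛ^∞⟮I; F, E⟯ => D.chernList k (List.ofFn e)) ∈ cochains 𝒞.pairing n :=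
  isCochain_ofFn 𝒞.pairing ((linearLast_pow D.linearLast_curvList k).mapVal traceLM)
    (σ := ((isSymbolDer_pow D.curvList D.isSymbolDer_curvSymbol k).mapVal traceLM).derivation)
    ((hasSymbol_pow D.hasSymbol_curvList k).mapVal _) n

theorem d_chern (k : ℕ) : 𝒞.d (2 * k) (D.chern k) = 0 := by
  rw [chern_eq, 𝒞.d_ofFn]
  funext e
  exact DFunLike.congr_fun (D.diff_chernList k) _

theorem chern_mem_cocycles (k : ℕ) : D.chern k ∈ 𝒞.cocycles (2 * k) :=
  ⟨by rw [chern_eq]; exact D.chern_mem_cochains k (2 * k), D.d_chern k⟩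

end EConnection
end Connections
-- Integration of families of cochains
section Connections

open ListCochain

variable {EM HM M : Type*} [NormedAddCommGroup EM] [NormedSpace ℝ EM]
  [TopologicalSpace HM] {I : ModelWithCorners ℝ EM HM} [TopologicalSpace M] [ChartedSpace HM M]
  [IsManifold I ∞ M]
  {F : Type*} [NormedAddCommGroup F] [NormedSpace ℝ F]
  {E : M → Type*} [TopologicalSpace (TotalSpace F E)] [∀ x, TopologicalSpace (E x)]
  [FiberBundle F E] [∀ x, AddCommGroup (E x)] [∀ x, Module ℝ (E x)] [VectorBundle ℝ F E]
  [FiniteDimensional ℝ EM] [T2Space M] [FiniteDimensional ℝ F] [ContMDiffVectorBundle ∞ F E I]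
  {𝒞 : CourantAlgebroid I F E}

section Integral

variable [BoundarylessManifold I M]
  {φ : unitInterval → ListCochain Cₛ^∞⟮I; F, E⟯ C^∞⟮I, M; ℝ⟯}
  {Φ : ListCochain Cₛ^∞⟮I; F, E⟯ C^∞⟮I, M; ℝ⟯}

theorem HasFamilyIntegral.lie (h : ∀ l, HasFamilyIntegral (fun t => φ t l) (Φ l))
    (e : Cₛ^∞⟮I; F, E⟯) (l : List Cₛ^∞⟮I; F, E⟯) :
    HasFamilyIntegral (fun t => ListCochain.lie 𝒞.br 𝒞.act e (φ t) l)
      (ListCochain.lie 𝒞.br 𝒞.act e Φ l) := by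
  induction l generalizing φ Φ with
  | nil => exact (h []).der 𝒞.anchor e
  | cons f l ih =>
    exact (ih (φ := fun t => contract f (φ t)) (Φ := contract f Φ) fun l => h (f :: l)).sub
      (h (𝒞.br e f :: l))

theorem HasFamilyIntegral.diff (h : ∀ l, HasFamilyIntegral (fun t => φ t l) (Φ l))
    (l : List Cₛ^∞⟮I; F, E⟯) :
    HasFamilyIntegral (fun t => ListCochain.diff 𝒞.br 𝒞.act (φ t) l)
      (ListCochain.diff 𝒞.br 𝒞.act Φ l) := by
  induction l generalizing φ Φ with
  | nil => exact .zero
  | cons f l ih =>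
    exact (HasFamilyIntegral.lie h f l).sub
      (ih (φ := fun t => contract f (φ t)) (Φ := contract f Φ) fun l => h (f :: l))

theorem HasFamilyIntegral.linearLast (h : ∀ l, HasFamilyIntegral (fun t => φ t l) (Φ l))
    (hφ : ∀ t, LinearLast (K := C^∞⟮I, M; ℝ⟯) (φ t)) : LinearLast (K := C^∞⟮I, M; ℝ⟯) Φ := by
  constructor
  · intro l a b
    refine (h _).unique ?_
    simpa only [(hφ _).1] using (h (l ++ [a])).add (h (l ++ [b]))
  · intro l f a
    refine (h _).unique ?_
    simpa only [(hφ _).2] using! (h (l ++ [a])).const_mul f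

variable {σ : unitInterval → C^∞⟮I, M; ℝ⟯ → ListCochain Cₛ^∞⟮I; F, E⟯ C^∞⟮I, M; ℝ⟯}
  {τ : C^∞⟮I, M; ℝ⟯ → ListCochain Cₛ^∞⟮I; F, E⟯ C^∞⟮I, M; ℝ⟯}

/-- An identity that is linear in the family holds for the integrals because both sides integrate
one and the same family. -/
theorem HasFamilyIntegral.hasSymbol (h : ∀ l, HasFamilyIntegral (fun t => φ t l) (Φ l))
    (hσ : ∀ f l, HasFamilyIntegral (fun t => σ t f l) (τ f l))
    {p : Cₛ^∞⟮I; F, E⟯ → Cₛ^∞⟮I; F, E⟯ → C^∞⟮I, M; ℝ⟯} (hφ : ∀ t, HasSymbol p (φ t) (σ t)) :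
    HasSymbol p Φ τ := by
  intro l₁ a b l₂
  refine HasFamilyIntegral.unique ?_ (hσ _ _)
  simpa only [(hφ _) _ _ _ _] using (h (l₁ ++ a :: b :: l₂)).add (h (l₁ ++ b :: a :: l₂))

theorem HasFamilyIntegral.isSymbolDer (hσ : ∀ f l, HasFamilyIntegral (fun t => σ t f l) (τ f l))
    (h : ∀ t, IsSymbolDer (σ t)) : IsSymbolDer τ where
  add f g := ListCochain.ext fun l => (hσ _ _).unique (by
    simpa only [(h _).add] using! (hσ f l).add (hσ g l))
  mul f g := ListCochain.ext fun l => (hσ _ _).unique (by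
    simpa only [(h _).mul] using! ((hσ g l).const_mul f).add ((hσ f l).const_mul g))
  const c := ListCochain.ext fun l => (hσ _ _).unique (by
    simpa only [(h _).const] using! HasFamilyIntegral.zero)

end Integral

variable {FB : Type*} [NormedAddCommGroup FB] [NormedSpace ℝ FB] [FiniteDimensional ℝ FB]
  {B : M → Type*} [TopologicalSpace (TotalSpace FB B)] [∀ x, TopologicalSpace (B x)]
  [FiberBundle FB B] [∀ x, AddCommGroup (B x)] [∀ x, Module ℝ (B x)] [VectorBundle ℝ FB B]
  [ContMDiffVectorBundle ∞ FB B I]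

section Powers

variable {S : Type*}
  {η η' : unitInterval → ListCochain S (Module.End C^∞⟮I, M; ℝ⟯ Cₛ^∞⟮I; FB, B⟯)}

theorem HasEndDeriv.list_pow (hη : ∀ l, HasEndDeriv (fun t => η t l) fun t => η' t l) (k : ℕ)
    (l : List S) : HasEndDeriv (fun t => (η t ^ k) l) fun t =>
      (k.rec 0 fun i τ => τ * η t + η t ^ i * η' t :
        ListCochain S (Module.End C^∞⟮I, M; ℝ⟯ Cₛ^∞⟮I; FB, B⟯)) l := by
  induction k generalizing l with
  | zero => simpa only [pow_zero] using! HasEndDeriv.const ((1 : ListCochain S _) l)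
  | succ k ih => simpa only [pow_succ] using HasEndDeriv.list_mul ih hη l

theorem IsSmoothEnd.list_powDeriv (hη : ∀ l, IsSmoothEnd fun t => η t l)
    (hη' : ∀ l, IsSmoothEnd fun t => η' t l) (k : ℕ) (l : List S) : IsSmoothEnd fun t =>
      (k.rec 0 fun i τ => τ * η t + η t ^ i * η' t :
        ListCochain S (Module.End C^∞⟮I, M; ℝ⟯ Cₛ^∞⟮I; FB, B⟯)) l := by
  have hpow : ∀ k l, IsSmoothEnd fun t => (η t ^ k) l := fun k => by
    induction k with
    | zero => exact fun l => by simpa only [pow_zero] using! IsSmoothEnd.const ((1 : ListCochain S _) l)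
    | succ k ih => exact fun l => by simpa only [pow_succ] using IsSmoothEnd.list_mul ih hη l
  induction k generalizing l with
  | zero => exact .const 0
  | succ k ih => exact (IsSmoothEnd.list_mul ih hη l).add (IsSmoothEnd.list_mul (hpow k) hη' l)

end Powers

/-! ### The affine path between two connections -/

namespace EConnection

variable (D D' : EConnection 𝒞 FB B)

/-- The analogue of `mul_functional_comp` for the first-order operator `∇_e`, obtained by applying
it to the resolution of `φ • s`; the corrections are derivatives of `φ` and of the coefficients. -/
theorem mul_functional_apply {ι : Type*} [Fintype ι] {σ : ι → Cₛ^∞⟮I; FB, B⟯}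
    {k : ι → Cₛ^∞⟮I; FB, B⟯ →ₗ[C^∞⟮I, M; ℝ⟯] C^∞⟮I, M; ℝ⟯} {φ : C^∞⟮I, M; ℝ⟯}
    (h : ∀ s, φ • s = ∑ i, k i s • σ i) (l : Cₛ^∞⟮I; FB, B⟯ →ₗ[C^∞⟮I, M; ℝ⟯] C^∞⟮I, M; ℝ⟯)
    (e : Cₛ^∞⟮I; F, E⟯) (s : Cₛ^∞⟮I; FB, B⟯) :
    φ * l (D.toFun e s) = ∑ i, (k i s * l (D.toFun e (σ i)) + 𝒞.anchor.der e (k i s) * l (σ i)) -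
      𝒞.anchor.der e φ * l s := by
  have h1 := congrArg (fun s => l (D.toFun e s)) (h s)
  simp only [D.leibniz, map_sum, map_add, map_smul, smul_eq_mul] at h1
  rw [← h1, add_sub_cancel_right]

/-- The affine combination `(1 - t) ∇ + t ∇'`. -/
noncomputable def affine (t : ℝ) : EConnection 𝒞 FB B where
  toFun := (1 - t) • D.toFun + t • D'.toFun
  leibniz e f b := by
    simp only [LinearMap.add_apply, LinearMap.smul_apply, leibniz, smul_add, smul_comm _ f]
    rw [add_add_add_comm, ← add_smul, sub_add_cancel, one_smul]
  smul_left f e b := by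
    simp only [LinearMap.add_apply, LinearMap.smul_apply, smul_left, smul_add, smul_comm _ f]

theorem affine_zero : D.affine D' 0 = D := by
  simp [affine]

theorem affine_one : D.affine D' 1 = D' := by
  simp [affine]

/-- The affine path from `∇` to `∇'`. -/
noncomputable def affinePath : EConnectionPath 𝒞 FB B where
  toFun t := D.affine D' t
  contMDiffOn e b := by
    rintro ⟨t, x⟩ htx
    rw [contMDiffWithinAt_totalSpace]
    refine ⟨contMDiffWithinAt_snd, ?_⟩
    let T := trivializationAt FB B x
    have hx : x ∈ T.baseSet := FiberBundle.mem_baseSet_trivializationAt FB B x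
    have hs : ∀ s : Cₛ^∞⟮I; FB, B⟯, ContMDiffWithinAt (𝓘(ℝ, ℝ).prod I) 𝓘(ℝ, FB) ∞
        (fun p : ℝ × M => (T ⟨p.2, s p.2⟩).2) (Icc 0 1 ×ˢ univ) (t, x) := fun s =>
      (((contMDiffAt_section x).1 (s.contMDiff x)).comp (t, x)
        contMDiffAt_snd).contMDiffWithinAt
    have ht : ContMDiffWithinAt (𝓘(ℝ, ℝ).prod I) 𝓘(ℝ, ℝ) ∞ (fun p : ℝ × M => p.1)
        (Icc 0 1 ×ˢ univ) (t, x) := contMDiffWithinAt_fst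
    have h1 := (((contMDiffWithinAt_const (c := (1 : ℝ))).sub ht).smul (hs (D.toFun e b))).add
      (ht.smul (hs (D'.toFun e b)))
    have h2 : ∀ᶠ p : ℝ × M in 𝓝 (t, x), p.2 ∈ T.baseSet :=
      (continuous_snd.tendsto (t, x)).eventually (T.open_baseSet.mem_nhds hx)
    -- In a trivialization the path is affine in `t`, with smooth coefficients.
    have h3 : ∀ p : ℝ × M, p.1 ∈ Icc (0 : ℝ) 1 → p.2 ∈ T.baseSet →
        (T (TotalSpace.mk' FB p.2
          ((D.affine D' (projIcc 0 1 zero_le_one p.1)).toFun e b p.2))).2 =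
        (1 - p.1) • (T ⟨p.2, D.toFun e b p.2⟩).2 + p.1 • (T ⟨p.2, D'.toFun e b p.2⟩).2 := by
      intro p hp hp2
      rw [projIcc_of_mem _ hp]
      have h4 := (T.linearMapAt ℝ p.2).map_add ((1 - p.1) • D.toFun e b p.2)
        (p.1 • D'.toFun e b p.2)
      rw [map_smul, map_smul] at h4
      simp only [T.linearMapAt_apply, if_pos hp2] at h4
      exact h4
    refine h1.congr_of_eventuallyEq ?_ (h3 (t, x) htx.1 hx)
    filter_upwards [mem_nhdsWithin_of_mem_nhds h2, self_mem_nhdsWithin] with p hp hp2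
      using h3 p hp2.1 hp

end EConnection

/-! ### Variation of the curvature and the Chern–Simons form -/

namespace EConnectionPath

variable [∀ x, IsTopologicalAddGroup (B x)] [∀ x, ContinuousSMul ℝ (B x)]
  (γ : EConnectionPath 𝒞 FB B)

theorem velocity_eq {t : unitInterval} {e : Cₛ^∞⟮I; F, E⟯} {b c : Cₛ^∞⟮I; FB, B⟯}
    (h : ∀ x, HasDerivWithinAt
      (fun r : ℝ => (γ.toFun (projIcc 0 1 zero_le_one r)).toFun e b x) (c x) (Icc 0 1) t) :
    γ.velocity t e b = c :=
  ((γ.existsUnique_deriv t e b).choose_spec.2 c h).symm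

theorem hasDerivWithinAt_velocity (t : unitInterval) (e : Cₛ^∞⟮I; F, E⟯) (b : Cₛ^∞⟮I; FB, B⟯)
    (x : M) : HasDerivWithinAt (fun r : ℝ => (γ.toFun (projIcc 0 1 zero_le_one r)).toFun e b x)
      (γ.velocity t e b x) (Icc 0 1) t :=
  (γ.existsUnique_deriv t e b).choose_spec.1 x

theorem velocity_add (t : unitInterval) (e e' : Cₛ^∞⟮I; F, E⟯) :
    γ.velocity t (e + e') = γ.velocity t e + γ.velocity t e' :=
  LinearMap.ext fun b => γ.velocity_eq fun x => by
    simpa only [map_add] using! hasDerivWithinAt_add_tvs (γ.hasDerivWithinAt_velocity t e b x)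
      (γ.hasDerivWithinAt_velocity t e' b x)

theorem velocity_smul (t : unitInterval) (f : C^∞⟮I, M; ℝ⟯) (e : Cₛ^∞⟮I; F, E⟯) :
    γ.velocity t (f • e) = f • γ.velocity t e :=
  LinearMap.ext fun b => γ.velocity_eq fun x => by
    simpa only [EConnection.smul_left] using! hasDerivWithinAt_clm_comp
      (f x • ContinuousLinearMap.id ℝ (B x)) (γ.hasDerivWithinAt_velocity t e b x)

theorem hasSecDeriv_apply (e : Cₛ^∞⟮I; F, E⟯) (b : Cₛ^∞⟮I; FB, B⟯) :
    HasSecDeriv (fun t => (γ.toFun t).toFun e b) fun t => γ.velocity t e b := fun l =>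
  ⟨isSmoothSec_of_contMDiffOn (s := fun t => (γ.toFun t).toFun e b) (γ.contMDiffOn e b) l,
    fun t x => by
      simpa only [fiberFunctionalL_apply] using hasDerivWithinAt_clm_comp (fiberFunctionalL l x)
        (γ.hasDerivWithinAt_velocity t e b x)⟩

variable [BoundarylessManifold I M]

/-- The product rule for `∇_{t,e} s_t`. As `∇` differentiates the coefficients of `s_t`, the
commutation of `d/dt` with `ρ(e)` is needed. -/
theorem hasSecDeriv_conn (e : Cₛ^∞⟮I; F, E⟯) {s s' : unitInterval → Cₛ^∞⟮I; FB, B⟯}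
    (hs : HasSecDeriv s s') : HasSecDeriv (fun t => (γ.toFun t).toFun e (s t)) fun t =>
      (γ.toFun t).toFun e (s' t) + γ.velocity t e (s t) := fun l => by
  refine .of_local fun x => ?_
  obtain ⟨ι, _, σ, k, φ, hφ, hf, -, -⟩ := exists_dual_frame (I := I) (F := FB) (V := B) x
  refine ⟨φ, hφ, ?_⟩
  have h1 := (HasFamilyDeriv.sum Finset.univ fun i =>
    ((hs (k i)).mul (γ.hasSecDeriv_apply e (σ i) l)).add
      (((hs (k i)).der 𝒞.anchor e).mul (.const (l (σ i))))).sub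
      ((hs l).const_mul (𝒞.anchor.der e φ))
  simp only [map_add, mul_add, mul_functional_comp hf l, EConnection.mul_functional_apply _ hf l]
  convert h1 using 2 with t
  simp only [Finset.sum_add_distrib, Pi.zero_apply, mul_zero, add_zero]
  abel

/-- The time derivative of the connection as a list cochain. -/
noncomputable def velList (t : unitInterval) :
    ListCochain Cₛ^∞⟮I; F, E⟯ (Module.End C^∞⟮I, M; ℝ⟯ Cₛ^∞⟮I; FB, B⟯) :=
  ⟨fun l => match l with
    | [a] => γ.velocity t a
    | _ => 0⟩

theorem velList_singleton (t : unitInterval) (a : Cₛ^∞⟮I; F, E⟯) :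
    γ.velList t [a] = γ.velocity t a := rfl

theorem homogeneous_velList (t : unitInterval) : Homogeneous 1 (γ.velList t) := fun l hl => by
  match l with
  | [] => rfl
  | [_] => exact absurd rfl hl
  | _ :: _ :: _ => rfl

theorem linearLast_velList (t : unitInterval) :
    LinearLast (K := C^∞⟮I, M; ℝ⟯) (γ.velList t) := by
  constructor
  · intro l a b
    match l with
    | [] => exact γ.velocity_add t a b
    | [_] => exact (add_zero _).symm
    | _ :: _ :: _ => exact (add_zero _).symm
  · intro l f a
    match l with
    | [] => exact γ.velocity_smul t f a
    | [_] => exact (smul_zero _).symm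
    | _ :: _ :: _ => exact (smul_zero _).symm

/-- A cochain of degree one has no adjacent pair of entries to exchange. -/
theorem hasSymbol_velList (t : unitInterval) :
    HasSymbol 𝒞.pairing.pair (γ.velList t) fun _ => 0 := by
  intro l₁ a b l₂
  have h1 : ∀ c d, γ.velList t (l₁ ++ c :: d :: l₂) = 0 := fun c d =>
    γ.homogeneous_velList t _ (by simp only [List.length_append, List.length_cons]; omega)
  rw [h1, h1, add_zero]
  rfl

/-- The variation formula `dF/dt = d_∇(d∇/dt)`: differentiating both factors of the commutator gives
the two covariant derivatives of the velocity, and the bracket term is linear in `∇`. -/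
theorem hasEndDeriv_curvList (l : List Cₛ^∞⟮I; F, E⟯) :
    HasEndDeriv (fun t => (γ.toFun t).curvList l) fun t =>
      diff 𝒞.br (γ.toFun t).cov (γ.velList t) l := by
  by_cases hl : l.length = 2
  · obtain ⟨a, b, rfl⟩ := List.length_eq_two.1 hl
    intro s
    have h1 := ((γ.hasSecDeriv_conn a (γ.hasSecDeriv_apply b s)).sub
      (γ.hasSecDeriv_conn b (γ.hasSecDeriv_apply a s))).sub (γ.hasSecDeriv_apply (𝒞.bracket a b) s)
    simp only [EConnection.curvList_pair, EConnection.curvature_apply]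
    convert h1 using 2 with t
    simp only [diff_cons, lie_cons, lie_nil, diff_nil, contract_apply, velList_singleton, sub_zero,
      LinearMap.sub_apply, EConnection.cov_apply, CourantAlgebroid.br]
    abel
  · have h1 : ∀ t, (γ.toFun t).curvList l = 0 := fun t => (γ.toFun t).homogeneous_curvList l hl
    have h2 : ∀ t, diff 𝒞.br (γ.toFun t).cov (γ.velList t) l = 0 := fun t =>
      (γ.homogeneous_velList t).diff _ _ l hl
    simpa only [h1, h2] using HasEndDeriv.const 0

theorem isSmoothEnd_velList (l : List Cₛ^∞⟮I; F, E⟯) : IsSmoothEnd fun t => γ.velList t l := by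
  match l with
  | [] => exact .const 0
  | [a] => exact fun b => (γ.hasSecDeriv_apply a b).smooth_deriv
  | _ :: _ :: _ => exact .const 0

theorem isSmoothEnd_curvSymbol (f : C^∞⟮I, M; ℝ⟯) (l : List Cₛ^∞⟮I; F, E⟯) :
    IsSmoothEnd fun t => (γ.toFun t).curvSymbol f l := by
  match l with
  | [] =>
    intro b l
    have h1 := (γ.hasSecDeriv_apply (𝒞.gradient f) b l).smooth.neg
    change IsSmoothFamily fun t => l (-(γ.toFun t).toFun (𝒞.gradient f) b)
    simpa only [map_neg] using h1
  | _ :: _ => exact .const 0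

/-- The transgression form `tr(d/dt [∇_t] ⌣ F_{∇_t}^k)` as a list cochain. -/
noncomputable def tgList (k : ℕ) (t : unitInterval) :
    ListCochain Cₛ^∞⟮I; F, E⟯ C^∞⟮I, M; ℝ⟯ :=
  mapVal traceLM.toAddMonoidHom (γ.velList t * (γ.toFun t).curvList ^ k)

theorem transgression_eq (k : ℕ) (t : unitInterval) (e : Fin (2 * k + 1) → Cₛ^∞⟮I; F, E⟯) :
    γ.transgression k t e = γ.tgList k t (List.ofFn e) := by
  have h1 := cup_ofFn (γ.homogeneous_velList t) ((γ.toFun t).homogeneous_curvList_pow k)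
    fun i => e (Fin.cast (Nat.add_comm 1 (2 * k)) i)
  rw [← List.ofFn_congr (Nat.add_comm 1 (2 * k)).symm e] at h1
  rw [transgression, (γ.toFun t).curvaturePow_eq]
  exact congrArg bundleTrace h1

/-- The symbol of the transgression form. -/
noncomputable def tgSymbol (k : ℕ) (t : unitInterval) (f : C^∞⟮I, M; ℝ⟯) :
    ListCochain Cₛ^∞⟮I; F, E⟯ C^∞⟮I, M; ℝ⟯ :=
  mapVal traceLM.toAddMonoidHom (γ.velList t * (k.rec 0 fun j τ =>
    τ * (γ.toFun t).curvList + (γ.toFun t).curvList ^ j * (γ.toFun t).curvSymbol f :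
      ListCochain Cₛ^∞⟮I; F, E⟯ (Module.End C^∞⟮I, M; ℝ⟯ Cₛ^∞⟮I; FB, B⟯)))

theorem isSymbolDer_tgSymbol (k : ℕ) (t : unitInterval) : IsSymbolDer (γ.tgSymbol k t) := by
  have h1 := (isSymbolDer_zero.product (isSymbolDer_pow (γ.toFun t).curvList
    (γ.toFun t).isSymbolDer_curvSymbol k) (γ.velList t) 0).mapVal traceLM
  simpa only [zero_mul, zero_add] using! h1

theorem hasSymbol_tgList (k : ℕ) (t : unitInterval) :
    HasSymbol 𝒞.pairing.pair (γ.tgList k t) (γ.tgSymbol k t) := by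
  have h1 := ((γ.hasSymbol_velList t).mul (hasSymbol_pow (γ.toFun t).hasSymbol_curvList k)).mapVal
    traceLM.toAddMonoidHom
  simpa only [zero_mul, zero_add] using! h1

theorem linearLast_tgList (k : ℕ) (t : unitInterval) :
    LinearLast (K := C^∞⟮I, M; ℝ⟯) (γ.tgList k t) :=
  ((γ.linearLast_velList t).mul (linearLast_pow (γ.toFun t).linearLast_curvList k)).mapVal traceLM

theorem isSmoothFamily_tgList (k : ℕ) (l : List Cₛ^∞⟮I; F, E⟯) :
    IsSmoothFamily fun t => γ.tgList k t l :=
  (IsSmoothEnd.list_mul γ.isSmoothEnd_velList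
    (fun l => (HasEndDeriv.list_pow γ.hasEndDeriv_curvList k l).smooth) l).trace

theorem isSmoothFamily_tgSymbol (k : ℕ) (f : C^∞⟮I, M; ℝ⟯) (l : List Cₛ^∞⟮I; F, E⟯) :
    IsSmoothFamily fun t => γ.tgSymbol k t f l :=
  (IsSmoothEnd.list_mul γ.isSmoothEnd_velList (IsSmoothEnd.list_powDeriv
    (fun l => (γ.hasEndDeriv_curvList l).smooth) (γ.isSmoothEnd_curvSymbol f) k) l).trace

/-- Pass `d_E` through the trace; by Bianchi only the derivative of the velocity survives in the
Leibniz rule. -/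
theorem diff_tgList (k : ℕ) (t : unitInterval) :
    diff 𝒞.br 𝒞.act (γ.tgList k t) = mapVal traceLM.toAddMonoidHom
      (diff 𝒞.br (γ.toFun t).cov (γ.velList t) * (γ.toFun t).curvList ^ k) := by
  rw [tgList, diff_mapVal 𝒞.br (γ.toFun t).cov _ _ (γ.toFun t).trace_cov,
    diff_mul 𝒞.br _ (γ.toFun t).cov_mul, (γ.toFun t).diff_curvList_pow, mul_zero, add_zero]

/-- The curvature and its variation both have degree two, so under the trace all `k + 1` terms of
the derivative of the power coincide. -/
theorem hasFamilyDeriv_chernList (k : ℕ) (l : List Cₛ^∞⟮I; F, E⟯) :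
    HasFamilyDeriv (fun t => (γ.toFun t).chernList (k + 1) l) fun t =>
      (k + 1) • diff 𝒞.br 𝒞.act (γ.tgList k t) l := by
  have h1 := (HasEndDeriv.list_pow γ.hasEndDeriv_curvList (k + 1) l).trace
  have h2 : ∀ t, grade (γ.toFun t).curvList = (γ.toFun t).curvList := fun t => by
    rw [(γ.toFun t).homogeneous_curvList.grade_eq]
    simp
  have h3 : ∀ t, grade (diff 𝒞.br (γ.toFun t).cov (γ.velList t)) =
      diff 𝒞.br (γ.toFun t).cov (γ.velList t) := fun t => by
    rw [((γ.homogeneous_velList t).diff _ _).grade_eq]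
    simp
  have h4 := fun t => DFunLike.congr_fun (trace_powDeriv traceLM.toAddMonoidHom traceLM_mul_comm
    (γ.toFun t).curvList _ (h2 t) (h3 t) k 0) l
  simp only [pow_zero, mul_one, add_zero, ← γ.diff_tgList] at h4
  have h5 : (fun t => (k + 1) • diff 𝒞.br 𝒞.act (γ.tgList k t) l) = _ :=
    funext fun t => (h4 t).symm
  rw [h5]
  exact h1

/-- The transgression form and its symbol are integrated separately on each list of arguments. The
integral is a cochain whose symbol is the integrated one, and `d_E` commutes with the integral. -/
theorem exists_chernSimons (k : ℕ) : ∃ cs ∈ cochains 𝒞.pairing (2 * k + 1),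
    (∀ e x, cs e x = γ.chernSimons k e x) ∧
      𝒞.d (2 * k + 1) cs = (γ.toFun 1).chern (k + 1) - (γ.toFun 0).chern (k + 1) := by
  choose Φ hΦ using fun l => (γ.isSmoothFamily_tgList k l).exists_hasFamilyIntegral
  choose τ hτ using fun f l => (γ.isSmoothFamily_tgSymbol k f l).exists_hasFamilyIntegral
  let Ψ : ListCochain Cₛ^∞⟮I; F, E⟯ C^∞⟮I, M; ℝ⟯ := ⟨Φ⟩
  let υ : C^∞⟮I, M; ℝ⟯ → ListCochain Cₛ^∞⟮I; F, E⟯ C^∞⟮I, M; ℝ⟯ := fun f => ⟨τ f⟩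
  have hΨ : ∀ l, HasFamilyIntegral (fun t => γ.tgList k t l) (Ψ l) := hΦ
  have hυ : ∀ f l, HasFamilyIntegral (fun t => γ.tgSymbol k t f l) (υ f l) := hτ
  have hder : IsSymbolDer υ := HasFamilyIntegral.isSymbolDer hυ (γ.isSymbolDer_tgSymbol k)
  have hmem : (fun e : Fin (2 * k + 1) → Cₛ^∞⟮I; F, E⟯ => Ψ (List.ofFn e)) ∈
      cochains 𝒞.pairing (2 * k + 1) :=
    isCochain_ofFn 𝒞.pairing (HasFamilyIntegral.linearLast hΨ (γ.linearLast_tgList k))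
      (σ := hder.derivation) (HasFamilyIntegral.hasSymbol hΨ hυ (γ.hasSymbol_tgList k)) _
  -- Both sides are the integral of `d/dt tr F^(k+1)`: the left by differentiation under the
  -- integral, the right by the fundamental theorem of calculus.
  have hdiff : ∀ l, ((k : ℝ) + 1) • diff 𝒞.br 𝒞.act Ψ l =
      (γ.toFun 1).chernList (k + 1) l - (γ.toFun 0).chernList (k + 1) l := fun l => by
    refine HasFamilyIntegral.unique ?_ (γ.hasFamilyDeriv_chernList k l).hasFamilyIntegral
    have h1 := (HasFamilyIntegral.diff (𝒞 := 𝒞) hΨ l).const_mul ((k + 1 : ℕ) : C^∞⟮I, M; ℝ⟯)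
    simp only [← nsmul_eq_mul] at h1
    convert h1 using 1
    rw [← Nat.cast_smul_eq_nsmul ℝ, Nat.cast_succ]
  refine ⟨((k : ℝ) + 1) • fun e => Ψ (List.ofFn e), Submodule.smul_mem _ _ hmem, fun e x => ?_, ?_⟩
  · change ((k : ℝ) + 1) * Ψ (List.ofFn e) x = _
    rw [(hΨ _).eq_integral_unitInterval]
    simp only [chernSimons, γ.transgression_eq]
  · rw [map_smul, 𝒞.d_ofFn, EConnection.chern_eq, EConnection.chern_eq]
    funext e
    exact hdiff _

theorem integrable_transgression (k : ℕ) (e : Fin (2 * k + 1) → Cₛ^∞⟮I; F, E⟯) (x : M) :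
    MeasureTheory.Integrable fun t : unitInterval => γ.transgression k t e x := by
  simpa only [γ.transgression_eq] using (γ.isSmoothFamily_tgList k (List.ofFn e)).integrable x

end EConnectionPath

theorem EConnection.cohomologyClass_eq [BoundarylessManifold I M]
    [∀ x, IsTopologicalAddGroup (B x)] [∀ x, ContinuousSMul ℝ (B x)]
    (D D' : EConnection 𝒞 FB B) (k : ℕ) :
    𝒞.cohomologyClass ⟨D.chern (k + 1), D.chern_mem_cocycles (k + 1)⟩ =
      𝒞.cohomologyClass ⟨D'.chern (k + 1), D'.chern_mem_cocycles (k + 1)⟩ := by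
  -- The path runs from `D'` to `D`, so that `d_E cs` is the difference in the order required by the
  -- quotient.
  obtain ⟨cs, hcs, -, h⟩ := (D'.affinePath D).exists_chernSimons k
  refine (Submodule.Quotient.eq _).2 ⟨cs, hcs, h.trans ?_⟩
  have h0 : (D'.affinePath D).toFun 0 = D' := D'.affine_zero D
  have h1 : (D'.affinePath D).toFun 1 = D := D'.affine_one D
  rw [h0, h1]
  rfl

end Connections
end CourantCS

theorem mainTheorem6
    -- the smooth manifold `M`
    {EM HM M : Type*} [NormedAddCommGroup EM] [NormedSpace ℝ EM] [FiniteDimensional ℝ EM]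
    [TopologicalSpace HM] {I : ModelWithCorners ℝ EM HM} [TopologicalSpace M] [ChartedSpace HM M]
    [IsManifold I ∞ M] [BoundarylessManifold I M] [T2Space M] [SigmaCompactSpace M]
    -- the vector bundle `E → M`
    {F : Type*} [NormedAddCommGroup F] [NormedSpace ℝ F] [FiniteDimensional ℝ F]
    {E : M → Type*} [TopologicalSpace (TotalSpace F E)] [∀ x, TopologicalSpace (E x)]
    [FiberBundle F E] [∀ x, AddCommGroup (E x)] [∀ x, Module ℝ (E x)] [VectorBundle ℝ F E]
    [ContMDiffVectorBundle ∞ F E I]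
    -- the vector bundle `B → M`
    {FB : Type*} [NormedAddCommGroup FB] [NormedSpace ℝ FB] [FiniteDimensional ℝ FB]
    {B : M → Type*} [TopologicalSpace (TotalSpace FB B)] [∀ x, TopologicalSpace (B x)]
    [FiberBundle FB B] [∀ x, AddCommGroup (B x)] [∀ x, Module ℝ (B x)] [VectorBundle ℝ FB B]
    [ContMDiffVectorBundle ∞ FB B I]
    [∀ x, IsTopologicalAddGroup (B x)] [∀ x, ContinuousSMul ℝ (B x)]
    -- the Courant algebroid structure on `E`; the degree index of the Chern form is `k + 1 ≥ 1`
    (𝒞 : CourantCS.CourantAlgebroid I F E) (k : ℕ) :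
    (∀ γ : CourantCS.EConnectionPath 𝒞 FB B,
      (∀ e x, MeasureTheory.Integrable (fun t : unitInterval => γ.transgression k t e x)) ∧
      ∃ cs ∈ CourantCS.cochains 𝒞.pairing (2 * k + 1),
        (∀ e x, cs e x = γ.chernSimons k e x) ∧
        𝒞.d (2 * k + 1) cs = (γ.toFun 1).chern (k + 1) - (γ.toFun 0).chern (k + 1)) ∧
    ∃ h : ∀ D : CourantCS.EConnection 𝒞 FB B, D.chern (k + 1) ∈ 𝒞.cocycles (2 * (k + 1)),
      ∀ D D' : CourantCS.EConnection 𝒞 FB B,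
        𝒞.cohomologyClass ⟨D.chern (k + 1), h D⟩ = 𝒞.cohomologyClass ⟨D'.chern (k + 1), h D'⟩ := by
  refine ⟨fun γ => ⟨fun e x => γ.integrable_transgression k e x, γ.exists_chernSimons k⟩,
    fun D => D.chern_mem_cocycles (k + 1), fun D D' => D.cohomologyClass_eq D' k⟩
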